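/- Let $\sigma\in\mathbb{R}\setminus\{0\}$, let $\phi_n$ ($n\ge 0$) be the $L^2$-normalised Hermite functions, $K_{n,n_1,n_2,n_3}=\int_{\mathbb{R}}\phi_n\phi_{n_1}\phi_{n_2}\phi_{n_3}\,dx$, let $l^2_s(\mathbb{N})$ be the space of real sequences with $\|{\bf a}\|_{l^2_s}^2=\sum_{n\ge0}(1+n)^{2s}|a_n|^2<\infty$, and let $\langle\cdot,\cdot\rangle$ be the inner product of $l^2(\mathbb{N})$. A *dark soliton family* is a pair of maps $\varepsilon\mapsto{\bf A}(\varepsilon)\in l^2_{1/2}(\mathbb{N})$, $\varepsilon\mapsto\mu(\varepsilon)\in\mathbb{R}$ which, for $\varepsilon$ in a neighbourhood of $0$, are $C^\infty$ and satisfy $$(\mu-n)A_n-\sigma\sum_{n_1,n_2,n_3}K_{n,n_1,n_2,n_3}A_{n_1}A_{n_2}A_{n_3}=0\quad(n\ge 0),$$ $$\|{\bf A}-\varepsilon{\bf e}_1\|_{l^2_{1/2}}\le C_1|\varepsilon|^3,\qquad \Big|\mu-1-\frac{3\sigma\varepsilon^2}{\sqrt{32\pi}}\Big|\le C_2\varepsilon^4$$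 with constants $C_1,C_2$ independent of $\varepsilon$. Write $\partial_\mu{\bf A}=(d\mu/d\varepsilon)^{-1}\,d{\bf A}/d\varepsilon$. With $V_{n,n_1}=\sum_{n_2,n_3}K_{n,n_1,n_2,n_3}A_{n_2}A_{n_3}$ let $$(L_+{\bf B})_n=(n-\mu)B_n+3\sigma\sum_{n_1}V_{n,n_1}B_{n_1},\qquad (L_-{\bf C})_n=(n-\mu)C_n+\sigma\sum_{n_1}V_{n,n_1}C_{n_1}$$ on the domain $l^2_1(\mathbb{N})$, and consider the eigenvalue problem $$L_+{\bf B}=\Omega{\bf C},\qquad L_-{\bf C}=\Omega{\bf B},\qquad ({\bf B},{\bf C})\ne(0,0).$$ (Multiple sums are read as iterated sums.) **Lemma.** Dark soliton families exist. For every dark soliton family there is $\varepsilon_0>0$ such that for all $0<|\varepsilon|<\varepsilon_0$: 1. $d\mu/d\varepsilon\ne0$, the sequences ${\bf A}$ and $\partial_\mu{\bf A}$ lie in $l^2_1(\mathbb{N})$, $L_-{\bf A}=0$, $L_+\partial_\mu{\bf A}={\bf A}$, and $\langle{\bf A},\partial_\mu{\bf A}\rangle\ne0$. 2. The positive eigenvalues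 can be listed, each once, as a sequence $\{\Omega_m\}_{m=0}^\infty$. For any such listing and any real eigenvectors $[{\bf B}_m,{\bf C}_m]^T$ for $\Omega_m$: - $\langle{\bf B}_{m'},{\bf C}_m\rangle=0$ for all $m'\ne m$, and $\langle{\bf B}_m,{\bf C}_m\rangle\ne0$ for all $m$; - all vectors $[{\bf B}_m,\pm{\bf C}_m]^T$ are orthogonal to $[{\bf 0},{\bf A}]^T$ and $[\partial_\mu{\bf A},{\bf 0}]^T$ with respect to the symplectic form $\omega([{\bf B},{\bf C}],[{\bf B}',{\bf C}'])=\langle{\bf B},{\bf C}'\rangle-\langle{\bf C},{\bf B}'\rangle$; - the set $$\{[{\bf B}_m,{\bf C}_m]^T\}_{m=0}^\infty\cup\{[{\bf B}_m,-{\bf C}_m]^T\}_{m=0}^\infty\cup\{[{\bf 0},{\bf A}]^T,[\partial_\mu{\bf A},{\bf 0}]^T\}$$ is an (unconditional Schauder) basis of $l^2(\mathbb{N},\mathbb{R}^2)$, and after normalising its members to unit length it is a Riesz basis. -/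

import Mathlib

open scoped ContDiff

noncomputable section

namespace DarkSoliton

/-- The real sequence space `l²(ℕ)`. -/
abbrev Ell2 := lp (fun _ : ℕ => ℝ) 2

/-- The Hilbert space `l²(ℕ, ℝ²)`, written as the `l²` sum of two copies of `l²(ℕ)`. -/
abbrev Ell2Pair := WithLp 2 (Ell2 × Ell2)

/-- The element `[B, C]ᵀ` of `l²(ℕ, ℝ²)`. -/
def pair (B C : Ell2) : Ell2Pair := WithLp.toLp 2 (B, C)

/-- Physicists' Hermite polynomials `H₀ = 1`, `H₁ = 2x`, `H₂ = 4x² - 2`, …, obtained from Mathlib's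
probabilists' polynomials by `Hₙ(x) = 2^{n/2} Heₙ(√2 x)`. -/
def physHermite (n : ℕ) (x : ℝ) : ℝ :=
  √2 ^ n * Polynomial.aeval (√2 * x) (Polynomial.hermite n)

/-- The `L²`-normalised Hermite functions `φₙ`. -/
def hermiteFun (n : ℕ) (x : ℝ) : ℝ :=
  1 / √(2 ^ n * (n.factorial : ℝ) * √Real.pi) * physHermite n x * Real.exp (-x ^ 2 / 2)

/-- `K_{n,n₁,n₂,n₃} = (φₙ, φₙ₁ φₙ₂ φₙ₃)`, the inner product being that of `L²(ℝ)`. -/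
def K (n n₁ n₂ n₃ : ℕ) : ℝ :=
  ∫ x : ℝ, hermiteFun n x * (hermiteFun n₁ x * hermiteFun n₂ x * hermiteFun n₃ x)

/-- Membership in the weighted space `l²_s(ℕ)`. -/
def MemWeighted (s : ℝ) (a : ℕ → ℝ) : Prop :=
  Summable fun n : ℕ => (1 + (n : ℝ)) ^ (2 * s) * |a n| ^ 2

/-- The norm of `l²_s(ℕ)` (meaningful on members of `l²_s(ℕ)`). -/
def weightedNorm (s : ℝ) (a : ℕ → ℝ) : ℝ :=
  √(∑' n : ℕ, (1 + (n : ℝ)) ^ (2 * s) * |a n| ^ 2)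

/-- The family `A : ℝ → l²(ℕ)` takes its values over `S` in `l²_s(ℕ)` and is smooth there with
respect to the norm of `l²_s(ℕ)`: the map `a ↦ ((1 + n)^s aₙ)ₙ` is an isometry of `l²_s(ℕ)` onto
`l²(ℕ)`, and the family is smooth after composition with it. -/
def SmoothInWeighted (s : ℝ) (A : ℝ → Ell2) (S : Set ℝ) : Prop :=
  ∃ W : ℝ → Ell2, (∀ ε ∈ S, ∀ n : ℕ, W ε n = (1 + (n : ℝ)) ^ s * A ε n) ∧ ContDiffOn ℝ ∞ W S

/-- The stationary vector field `F(A, μ)`, for real-valued `A`. -/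
def stationaryField (σ : ℝ) (A : ℕ → ℝ) (μ : ℝ) (n : ℕ) : ℝ :=
  (μ - n) * A n - σ * ∑' n₁ : ℕ, ∑' n₂ : ℕ, ∑' n₃ : ℕ, K n n₁ n₂ n₃ * A n₁ * A n₂ * A n₃

/-- The potential matrix `V_{n,n₁}`. -/
def V (A : ℕ → ℝ) (n n₁ : ℕ) : ℝ :=
  ∑' n₂ : ℕ, ∑' n₃ : ℕ, K n n₁ n₂ n₃ * A n₂ * A n₃

/-- The matrix operator `L₊` at `(A, μ)`. -/
def Lplus (σ : ℝ) (A : ℕ → ℝ) (μ : ℝ) (B : ℕ → ℝ) (n : ℕ) : ℝ :=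
  ((n : ℝ) - μ) * B n + 3 * σ * ∑' n₁ : ℕ, V A n n₁ * B n₁

/-- The matrix operator `L₋` at `(A, μ)`. -/
def Lminus (σ : ℝ) (A : ℕ → ℝ) (μ : ℝ) (C : ℕ → ℝ) (n : ℕ) : ℝ :=
  ((n : ℝ) - μ) * C n + σ * ∑' n₁ : ℕ, V A n n₁ * C n₁

/-- `[B, C]ᵀ` is a real-valued eigenvector of the linear problem `L₊ B = Ω C`, `L₋ C = Ω B` for the
real eigenvalue `Ω`; the domain of both operators is `l²_1(ℕ)`. -/
structure IsEigenvector (σ : ℝ) (A : ℕ → ℝ) (μ Ω : ℝ) (B C : Ell2) : Prop where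
  ne_zero : pair B C ≠ 0
  mem_left : MemWeighted 1 B
  mem_right : MemWeighted 1 C
  left_eq : ∀ n, Lplus σ A μ B n = Ω * C n
  right_eq : ∀ n, Lminus σ A μ C n = Ω * B n

/-- The set of positive eigenvalues of the linear problem. -/
def posEigenvalues (σ : ℝ) (A : ℕ → ℝ) (μ : ℝ) : Set ℝ :=
  {Ω | 0 < Ω ∧ ∃ B C : Ell2, IsEigenvector σ A μ Ω B C}

/-- `Ω` lists the positive eigenvalues, each of them once. -/
def ListsPosEigenvalues (σ : ℝ) (A : ℕ → ℝ) (μ : ℝ) (Ω : ℕ → ℝ) : Prop :=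
  Function.Injective Ω ∧ Set.range Ω = posEigenvalues σ A μ

/-- `ε ↦ (A(ε), μ(ε))` is, near `ε = 0`, the family of dark solitons bifurcating from
`(0, 1)` along `e₁`: a smooth family of real roots of the stationary vector field in `l²_{1/2}(ℕ)`
with `‖A - ε e₁‖ ≤ C₁ |ε|³` in `l²_{1/2}(ℕ)` and `|μ - 1 - 3 σ ε² / √(32 π)| ≤ C₂ ε⁴`. -/
def IsDarkSolitonFamily (σ : ℝ) (A : ℝ → Ell2) (μ : ℝ → ℝ) : Prop :=
  ∃ r > 0, ∃ C₁ C₂ : ℝ,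
    SmoothInWeighted (1 / 2) A (Set.Ioo (-r) r) ∧
    ContDiffOn ℝ ∞ μ (Set.Ioo (-r) r) ∧
    ∀ ε ∈ Set.Ioo (-r) r,
      (∀ n, stationaryField σ (A ε) (μ ε) n = 0) ∧
      weightedNorm (1 / 2) (A ε - lp.single 2 1 ε : Ell2) ≤ C₁ * |ε| ^ 3 ∧
      |μ ε - 1 - 3 * σ * ε ^ 2 / √(32 * Real.pi)| ≤ C₂ * ε ^ 4

/-- The derivative `∂_μ A` along the family, `(dA/dε) / (dμ/dε)`. -/
def dMu (A : ℝ → Ell2) (μ : ℝ → ℝ) (ε : ℝ) : Ell2 :=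
  (deriv μ ε)⁻¹ • deriv A ε

/-- The standard symplectic form on `l²(ℕ, ℝ²)`. -/
def symp (x y : Ell2Pair) : ℝ :=
  inner ℝ x.fst y.snd - inner ℝ x.snd y.fst

/-- The set of vectors `[B_m, C_m]`, `[B_m, -C_m]`, `m ∈ ℕ`, together with `[0, A]` and
`[A', 0]`. -/
def completeSet (B C : ℕ → Ell2) (A A' : Ell2) : ℕ ⊕ ℕ ⊕ Fin 2 → Ell2Pair :=
  Sum.elim (fun m => pair (B m) (C m))
    (Sum.elim (fun m => pair (B m) (-C m)) ![pair 0 A, pair A' 0])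

/-- `v` is an unconditional Schauder basis. -/
def IsUnconditionalBasis {ι E : Type*} [NormedAddCommGroup E] [NormedSpace ℝ E] (v : ι → E) :
    Prop :=
  ∃ b : UnconditionalSchauderBasis ι ℝ E, ∀ i, b i = v i

/-- `v` is a Riesz basis: the image of a Hilbert basis under a bounded invertible operator. -/
def IsRieszBasis {ι E : Type*} [NormedAddCommGroup E] [InnerProductSpace ℝ E] (v : ι → E) :
    Prop :=
  ∃ (b : HilbertBasis ι ℝ E) (T : E ≃L[ℝ] E), ∀ i, v i = T (b i)

end DarkSoliton

end

/-!
In the coordinates `b n = √(1 + n) A n`, which identify `l²_{1/2}` with `l²`, evaluation at a point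
is a bounded functional, so multiplication by a product of two functions is a bounded self-adjoint
operator with norm controlled by the two factors. The stationary equation becomes a smooth equation
in `l²`, and Lyapunov–Schmidt reduction at `e₁` yields the family.

Adding and subtracting the two components turns the linear problem into `diag(n - 1)` on one copy of
`l²` and `diag(1 - n)` on another, plus a bounded operator `R` of size `O(ε²)`. Division by the
difference of two distinct integer levels is a bounded Schur multiplier, so the off-diagonal blocks
of `R` are removed by a similarity close to the identity, and the eigenvectors of the blocks form a
Riesz basis. All levels but `0`, `1` and `-1` are simple. Level `0` is spanned by `[0, A]` and
`[∂_μ A, 0]`. At level `1` the dipole mode `[∂ₓA, -xA]` is an exact eigenvector with eigenvalue `1`,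
and the trace of the block is different from `2` because `K₂₂₁₁ ≠ K₀₀₁₁`, so the second eigenvalue
is different from the first. Since eigenvectors to distinct eigenvalues are symplectically
orthogonal and the vectors found are complete, there are no further positive eigenvalues, and the
form cannot vanish on a pair `[B, ±C]`.
-/

namespace DarkSoliton

/-! ### Operators on `l²` and their matrices -/

/-- The real space `l²(ι)`. -/
abbrev L2 (ι : Type*) := lp (fun _ : ι => ℝ) 2

section L2

variable {ι κ : Type*}

theorem hasSum_sq (x : L2 ι) : HasSum (fun i => x i ^ 2) (‖x‖ ^ 2) := by
  simpa [real_inner_self_eq_norm_sq, ← sq] using lp.hasSum_inner (𝕜 := ℝ) x x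

theorem abs_apply_le_norm (x : L2 ι) (i : ι) : |x i| ≤ ‖x‖ := by
  simpa using lp.norm_apply_le_norm (p := 2) (by simp) x i

theorem sum_sq_le_norm_sq (x : L2 ι) (s : Finset ι) : ∑ i ∈ s, x i ^ 2 ≤ ‖x‖ ^ 2 :=
  sum_le_hasSum _ (fun _ _ => sq_nonneg _) (hasSum_sq x)

theorem memℓp_two_iff_summable_sq (f : ι → ℝ) : Memℓp f 2 ↔ Summable fun i => f i ^ 2 := by
  rw [memℓp_gen_iff (by norm_num)]
  simp

/-- The coordinate functional of `l²(ι)`. -/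
noncomputable def coordCLM (i : ι) : L2 ι →L[ℝ] ℝ := lp.evalCLM ℝ (fun _ : ι => ℝ) 2 i

@[simp] theorem coordCLM_apply (i : ι) (x : L2 ι) : coordCLM i x = x i := rfl

theorem exists_clm_of_sum_sq_le {E : Type*} [NormedAddCommGroup E] [NormedSpace ℝ E]
    (f : E →ₗ[ℝ] ι → ℝ) {C : ℝ} (hC : 0 ≤ C)
    (hf : ∀ x (s : Finset ι), ∑ i ∈ s, f x i ^ 2 ≤ (C * ‖x‖) ^ 2) :
    ∃ T : E →L[ℝ] L2 ι, ‖T‖ ≤ C ∧ ∀ x i, T x i = f x i := by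
  have hmem (x : E) : Memℓp (f x) 2 :=
    (memℓp_two_iff_summable_sq _).2 (summable_of_sum_le (fun _ => sq_nonneg _) (hf x))
  let T₀ : E →ₗ[ℝ] L2 ι :=
    { toFun := fun x => ⟨f x, hmem x⟩
      map_add' := fun x y => Subtype.ext (map_add f x y)
      map_smul' := fun c x => Subtype.ext (map_smul f c x) }
  have hT₀ (x : E) : ‖T₀ x‖ ≤ C * ‖x‖ :=
    le_of_sq_le_sq (hasSum_le_of_sum_le (hasSum_sq (T₀ x)) (hf x)) (by positivity)
  exact ⟨T₀.mkContinuous C hT₀, T₀.mkContinuous_norm_le hC hT₀, fun _ _ => rfl⟩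

theorem exists_weighted_comp (φ : ι → κ) (g : ι → ℝ) {C : ℝ} (hC : 0 ≤ C) (hg : ∀ i, |g i| ≤ C)
    (hφ : Set.InjOn φ (Function.support g)) :
    ∃ T : L2 κ →L[ℝ] L2 ι, ‖T‖ ≤ C ∧ ∀ x i, T x i = g i * x (φ i) := by
  classical
  refine exists_clm_of_sum_sq_le
    (LinearMap.pi fun i => g i • (coordCLM (φ i) : L2 κ →ₗ[ℝ] ℝ)) hC fun x s => ?_
  calc ∑ i ∈ s, (g i * x (φ i)) ^ 2 = ∑ i ∈ s with g i ≠ 0, (g i * x (φ i)) ^ 2 :=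
        (Finset.sum_filter_of_ne fun i _ => mt fun hg0 => by rw [hg0]; ring).symm
    _ ≤ ∑ i ∈ s with g i ≠ 0, C ^ 2 * x (φ i) ^ 2 := by
        gcongr with i
        rw [mul_pow]
        gcongr ?_ * _
        exact sq_le_sq.2 ((hg i).trans (le_abs_self C))
    _ = C ^ 2 * ∑ i ∈ s with g i ≠ 0, x (φ i) ^ 2 := Finset.mul_sum .. |>.symm
    _ = C ^ 2 * ∑ k ∈ ({i ∈ s | g i ≠ 0}).image φ, x k ^ 2 := by
        rw [Finset.sum_image]
        exact fun i hi j hj => hφ (Finset.mem_filter.1 hi).2 (Finset.mem_filter.1 hj).2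
    _ ≤ C ^ 2 * ‖x‖ ^ 2 := by gcongr; exact sum_sq_le_norm_sq x _
    _ = (C * ‖x‖) ^ 2 := (mul_pow ..).symm

theorem exists_diagonal (g : ι → ℝ) {C : ℝ} (hC : 0 ≤ C) (hg : ∀ i, |g i| ≤ C) :
    ∃ T : L2 ι →L[ℝ] L2 ι, ‖T‖ ≤ C ∧ ∀ x i, T x i = g i * x i :=
  exists_weighted_comp id g hC hg (Set.injOn_id _)

/-- The matrix `a` has a bilinear form bounded by `C` in the `l²` norms of finitely supported
vectors. -/
def FormBoundedBy (a : ι → κ → ℝ) (C : ℝ) : Prop :=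
  ∀ (s : Finset ι) (t : Finset κ) (x : ι → ℝ) (y : κ → ℝ),
    |∑ i ∈ s, ∑ j ∈ t, x i * a i j * y j| ≤ C * √(∑ i ∈ s, x i ^ 2) * √(∑ j ∈ t, y j ^ 2)

theorem FormBoundedBy.sum_sq_mulVec_le {a : ι → κ → ℝ} {C : ℝ} (h : FormBoundedBy a C)
    (s : Finset ι) (t : Finset κ) (y : κ → ℝ) :
    ∑ i ∈ s, (∑ j ∈ t, a i j * y j) ^ 2 ≤ C ^ 2 * ∑ j ∈ t, y j ^ 2 := by
  set N := ∑ i ∈ s, (∑ j ∈ t, a i j * y j) ^ 2 with hN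
  have hN0 : 0 ≤ N := Finset.sum_nonneg fun _ _ => sq_nonneg _
  have hy0 : 0 ≤ ∑ j ∈ t, y j ^ 2 := Finset.sum_nonneg fun _ _ => sq_nonneg _
  have hform : ∑ i ∈ s, ∑ j ∈ t, (∑ k ∈ t, a i k * y k) * a i j * y j = N := by
    simp only [hN, mul_assoc, ← Finset.mul_sum, sq]
  have hself : N ≤ C * √N * √(∑ j ∈ t, y j ^ 2) := by
    simpa only [hform, abs_of_nonneg hN0] using h s t (fun i => ∑ j ∈ t, a i j * y j) y
  rcases hN0.eq_or_lt with hN0' | hNpos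
  · rw [← hN0']; positivity
  · have hsqrt : √N ≤ C * √(∑ j ∈ t, y j ^ 2) := by
      refine le_of_mul_le_mul_left ?_ (Real.sqrt_pos.2 hNpos)
      rw [Real.mul_self_sqrt hN0]
      linarith
    calc N = √N ^ 2 := (Real.sq_sqrt hN0).symm
      _ ≤ (C * √(∑ j ∈ t, y j ^ 2)) ^ 2 := by gcongr
      _ = C ^ 2 * ∑ j ∈ t, y j ^ 2 := by rw [mul_pow, Real.sq_sqrt hy0]

open scoped Classical in
/-- The coordinate vector of `l²(ι)`. The entry `(i, j)` of the matrix of an operator `T` is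
`T (basisVec j) i`. -/
noncomputable def basisVec (i : ι) : L2 ι := lp.single 2 i (1 : ℝ)

theorem basisVec_apply (i j : ι) [Decidable (j = i)] :
    basisVec i j = if j = i then (1 : ℝ) else 0 := by
  by_cases h : j = i <;> simp [basisVec, h]

@[simp] theorem basisVec_self (i : ι) : basisVec i i = (1 : ℝ) := by simp [basisVec]

theorem basisVec_of_ne {i j : ι} (h : j ≠ i) : basisVec i j = (0 : ℝ) := by
  simp [basisVec, h]

@[simp] theorem norm_basisVec (i : ι) : ‖basisVec i‖ = 1 := by
  simp [basisVec, lp.norm_single]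

theorem inner_basisVec_left (i : ι) (x : L2 ι) : inner ℝ (basisVec i) x = x i := by
  simp [basisVec, lp.inner_single_left]

theorem inner_basisVec_right (i : ι) (x : L2 ι) : inner ℝ x (basisVec i) = x i := by
  simp [basisVec, lp.inner_single_right]

theorem hasSum_smul_basisVec (x : L2 ι) : HasSum (fun i => x i • basisVec i) x := by
  classical
  convert! lp.hasSum_single (E := fun _ : ι => ℝ) (p := 2) (by simp) x using 2 with i
  rw [basisVec, ← lp.single_smul, smul_eq_mul, mul_one]

theorem hasSum_entries (T : L2 ι →L[ℝ] L2 κ) (x : L2 ι) (k : κ) :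
    HasSum (fun i => T (basisVec i) k * x i) (T x k) := by
  have h := ((coordCLM k).comp T).hasSum (hasSum_smul_basisVec x)
  simpa [mul_comm] using h

theorem clm_ext_basisVec {F : Type*} [NormedAddCommGroup F] [NormedSpace ℝ F]
    {S T : L2 ι →L[ℝ] F} (h : ∀ i, S (basisVec i) = T (basisVec i)) : S = T := by
  ext x
  refine (S.hasSum (hasSum_smul_basisVec x)).unique ?_
  simpa [h] using T.hasSum (hasSum_smul_basisVec x)

theorem clm_ext_entries {S T : L2 ι →L[ℝ] L2 κ}
    (h : ∀ i k, S (basisVec i) k = T (basisVec i) k) : S = T :=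
  clm_ext_basisVec fun i => by ext k; exact h i k

/-- The element of `l²(ι)` with prescribed coordinates in a finite set. -/
noncomputable def finVec (s : Finset ι) (x : ι → ℝ) : L2 ι := ∑ i ∈ s, x i • basisVec i

theorem finVec_apply (s : Finset ι) (x : ι → ℝ) (j : ι) [Decidable (j ∈ s)] :
    finVec s x j = if j ∈ s then x j else 0 := by
  classical
  have hsum : finVec s x j = ∑ i ∈ s, x i * basisVec i j := by
    rw [finVec, ← coordCLM_apply, map_sum]
    simp
  simp [hsum, basisVec_apply]

theorem norm_finVec (s : Finset ι) (x : ι → ℝ) : ‖finVec s x‖ = √(∑ i ∈ s, x i ^ 2) := by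
  classical
  rw [← Real.sqrt_sq (norm_nonneg (finVec s x)), ← (hasSum_sq (finVec s x)).tsum_eq,
    tsum_eq_sum (s := s) fun i hi => by simp [finVec_apply, hi]]
  exact congrArg _ (Finset.sum_congr rfl fun i hi => by simp [finVec_apply, hi])

theorem inner_finVec (s : Finset ι) (x : ι → ℝ) (y : L2 ι) :
    inner ℝ (finVec s x) y = ∑ i ∈ s, x i * y i := by
  simp [finVec, sum_inner, inner_smul_left, inner_basisVec_left]

theorem formBoundedBy_entries (T : L2 κ →L[ℝ] L2 ι) :
    FormBoundedBy (fun i j => T (basisVec j) i) ‖T‖ := by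
  intro s t x y
  have hform : ∑ i ∈ s, ∑ j ∈ t, x i * T (basisVec j) i * y j =
      inner ℝ (finVec s x) (T (finVec t y)) := by
    rw [inner_finVec]
    refine Finset.sum_congr rfl fun i _ => ?_
    simp only [finVec, map_sum, map_smul, lp.coeFn_sum, Finset.sum_apply, lp.coeFn_smul,
      Pi.smul_apply, smul_eq_mul, Finset.mul_sum]
    exact Finset.sum_congr rfl fun j _ => by ring
  rw [hform, ← norm_finVec, ← norm_finVec]
  calc _ ≤ ‖finVec s x‖ * ‖T (finVec t y)‖ := abs_real_inner_le_norm _ _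
    _ ≤ ‖finVec s x‖ * (‖T‖ * ‖finVec t y‖) := by gcongr; exact T.le_opNorm _
    _ = _ := by ring

theorem FormBoundedBy.summable_sq_row {a : ι → κ → ℝ} {C : ℝ} (h : FormBoundedBy a C) (i : ι) :
    Summable fun j => a i j ^ 2 := by
  refine summable_of_sum_le (c := C ^ 2) (fun _ => sq_nonneg _) fun t => ?_
  have hrow : (∑ j ∈ t, a i j ^ 2) ^ 2 ≤ C ^ 2 * ∑ j ∈ t, a i j ^ 2 := by
    simpa only [Finset.sum_singleton, ← sq] using h.sum_sq_mulVec_le {i} t (a i)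
  by_contra! hlt
  nlinarith [sq_nonneg C]

theorem FormBoundedBy.exists_clm {a : ι → κ → ℝ} {C : ℝ} (hC : 0 ≤ C) (h : FormBoundedBy a C) :
    ∃ T : L2 κ →L[ℝ] L2 ι, ‖T‖ ≤ C ∧ ∀ i j, T (basisVec j) i = a i j := by
  let row (i : ι) : L2 κ := ⟨a i, (memℓp_two_iff_summable_sq _).2 (h.summable_sq_row i)⟩
  have hrow (i : ι) (y : L2 κ) : HasSum (fun j => a i j * y j) (inner ℝ (row i) y) := by
    simpa [row, mul_comm] using lp.hasSum_inner (𝕜 := ℝ) (row i) y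
  have hbound (y : L2 κ) (s : Finset ι) : ∑ i ∈ s, inner ℝ (row i) y ^ 2 ≤ (C * ‖y‖) ^ 2 := by
    have hlim : Filter.Tendsto (fun t : Finset κ => ∑ i ∈ s, (∑ j ∈ t, a i j * y j) ^ 2)
        Filter.atTop (nhds (∑ i ∈ s, inner ℝ (row i) y ^ 2)) :=
      tendsto_finsetSum _ fun i _ => (hrow i y).pow 2
    refine le_of_tendsto hlim (Filter.Eventually.of_forall fun t => ?_)
    rw [mul_pow]
    exact (h.sum_sq_mulVec_le s t y).trans (by gcongr; exact sum_sq_le_norm_sq y t)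
  obtain ⟨T, hTC, hT⟩ :=
    exists_clm_of_sum_sq_le (LinearMap.pi fun i => innerₛₗ ℝ (row i)) hC hbound
  exact ⟨T, hTC, fun i j => (hT _ i).trans (inner_basisVec_right j (row i))⟩

end L2

/-! ### Schur multipliers -/

section Schur

variable {ι κ : Type*}

theorem sqrt_sum_mul_sq_le (s : Finset ι) (x γ : ι → ℝ) {M : ℝ} (hM : 0 ≤ M)
    (hγ : ∀ i, |γ i| ≤ M) : √(∑ i ∈ s, (x i * γ i) ^ 2) ≤ M * √(∑ i ∈ s, x i ^ 2) := by
  refine Real.sqrt_le_iff.2 ⟨by positivity, ?_⟩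
  rw [mul_pow, Real.sq_sqrt (Finset.sum_nonneg fun _ _ => sq_nonneg _), Finset.mul_sum]
  refine Finset.sum_le_sum fun i _ => ?_
  rw [mul_pow, mul_comm]
  gcongr ?_ * _
  exact sq_le_sq.2 ((hγ i).trans (le_abs_self M))

theorem FormBoundedBy.mul_weights {a : ι → κ → ℝ} {C G H : ℝ} (h : FormBoundedBy a C) (hC : 0 ≤ C)
    {α : ι → ℝ} {β : κ → ℝ} (hα : ∀ i, |α i| ≤ G) (hβ : ∀ j, |β j| ≤ H) (hG : 0 ≤ G) (hH : 0 ≤ H) :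
    FormBoundedBy (fun i j => α i * β j * a i j) (C * G * H) := by
  intro s t x y
  calc |∑ i ∈ s, ∑ j ∈ t, x i * (α i * β j * a i j) * y j|
      = |∑ i ∈ s, ∑ j ∈ t, x i * α i * a i j * (y j * β j)| :=
        congrArg _ (Finset.sum_congr rfl fun i _ => Finset.sum_congr rfl fun j _ => by ring)
    _ ≤ C * √(∑ i ∈ s, (x i * α i) ^ 2) * √(∑ j ∈ t, (y j * β j) ^ 2) := h s t _ _
    _ ≤ C * (G * √(∑ i ∈ s, x i ^ 2)) * (H * √(∑ j ∈ t, y j ^ 2)) := by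
        gcongr
        · exact sqrt_sum_mul_sq_le s x α hG hα
        · exact sqrt_sum_mul_sq_le t y β hH hβ
    _ = C * G * H * √(∑ i ∈ s, x i ^ 2) * √(∑ j ∈ t, y j ^ 2) := by ring

theorem FormBoundedBy.intervalIntegral {a : ℝ → ι → κ → ℝ} {p q C : ℝ}
    (hcont : ∀ i j, Continuous fun θ => a θ i j)
    (h : ∀ θ ∈ Set.uIoc p q, FormBoundedBy (a θ) C) :
    FormBoundedBy (fun i j => ∫ θ in p..q, a θ i j) (C * |q - p|) := by
  intro s t x y
  have hform : ∑ i ∈ s, ∑ j ∈ t, x i * (∫ θ in p..q, a θ i j) * y j =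
      ∫ θ in p..q, ∑ i ∈ s, ∑ j ∈ t, x i * a θ i j * y j := by
    rw [intervalIntegral.integral_finsetSum
      fun i _ => Continuous.intervalIntegrable (by fun_prop) _ _]
    refine Finset.sum_congr rfl fun i _ => ?_
    rw [intervalIntegral.integral_finsetSum
      fun j _ => Continuous.intervalIntegrable (by fun_prop) _ _]
    simp
  rw [hform, ← Real.norm_eq_abs]
  refine (intervalIntegral.norm_integral_le_of_norm_le_const
    fun θ hθ => h θ hθ s t x y).trans (le_of_eq ?_)
  ring

/-- Entrywise multiplication by the matrix `a` is a bounded operator on the space of bounded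
operators. -/
def IsSchurMultiplier (a : ι → κ → ℝ) : Prop :=
  ∃ S : (L2 κ →L[ℝ] L2 ι) →L[ℝ] (L2 κ →L[ℝ] L2 ι),
    ∀ Y i j, S Y (basisVec j) i = a i j * Y (basisVec j) i

theorem IsSchurMultiplier.of_formBoundedBy {a : ι → κ → ℝ} {C : ℝ} (hC : 0 ≤ C)
    (h : ∀ Y : L2 κ →L[ℝ] L2 ι, FormBoundedBy (fun i j => a i j * Y (basisVec j) i) (C * ‖Y‖)) :
    IsSchurMultiplier a := by
  choose S hSC hS using fun Y => (h Y).exists_clm (by positivity)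
  let S₀ : (L2 κ →L[ℝ] L2 ι) →ₗ[ℝ] (L2 κ →L[ℝ] L2 ι) :=
    { toFun := S
      map_add' := fun Y Z => clm_ext_entries fun i k => by simp [hS, mul_add]
      map_smul' := fun c Y => clm_ext_entries fun i k => by simp [hS]; ring }
  exact ⟨S₀.mkContinuous C hSC, hS⟩

theorem IsSchurMultiplier.add {a b : ι → κ → ℝ} (ha : IsSchurMultiplier a)
    (hb : IsSchurMultiplier b) : IsSchurMultiplier fun i j => a i j + b i j := by
  obtain ⟨S, hS⟩ := ha
  obtain ⟨U, hU⟩ := hb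
  exact ⟨S + U, fun Y i j => by simp [hS, hU, add_mul]⟩

theorem IsSchurMultiplier.const_mul {a : ι → κ → ℝ} (ha : IsSchurMultiplier a) (c : ℝ) :
    IsSchurMultiplier fun i j => c * a i j := by
  obtain ⟨S, hS⟩ := ha
  exact ⟨c • S, fun Y i j => by simp [hS, mul_assoc]⟩

theorem isSchurMultiplier_integral {α : ι → ℝ → ℝ} {β : κ → ℝ → ℝ} {p q G H : ℝ}
    (hα : ∀ i, Continuous (α i)) (hβ : ∀ j, Continuous (β j)) (hG : 0 ≤ G) (hH : 0 ≤ H)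
    (hαG : ∀ θ ∈ Set.uIoc p q, ∀ i, |α i θ| ≤ G) (hβH : ∀ θ ∈ Set.uIoc p q, ∀ j, |β j θ| ≤ H) :
    IsSchurMultiplier fun i j => ∫ θ in p..q, α i θ * β j θ := by
  refine .of_formBoundedBy (C := G * H * |q - p|) (by positivity) fun Y => ?_
  have h := FormBoundedBy.intervalIntegral (a := fun θ i j => α i θ * β j θ * Y (basisVec j) i)
    (p := p) (q := q) (by fun_prop) fun θ hθ =>
      (formBoundedBy_entries Y).mul_weights (norm_nonneg _) (hαG θ hθ) (hβH θ hθ) hG hH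
  simp only [intervalIntegral.integral_mul_const] at h
  convert h using 1
  ring

variable {w : ℝ → ℝ} {p q : ℝ}

theorem isSchurMultiplier_integral_mul {f g : ℝ → ℝ} (hw : Continuous w) (hf : Continuous f)
    (hg : Continuous g) (hf1 : ∀ x, |f x| ≤ 1) (hg1 : ∀ x, |g x| ≤ 1) (l : ι → ℝ) (m : κ → ℝ) :
    IsSchurMultiplier fun i j => ∫ θ in p..q, w θ * f (l i * θ) * g (m j * θ) := by
  obtain ⟨M, hM⟩ :=
    isCompact_uIcc.exists_bound_of_continuousOn (hw.continuousOn (s := Set.uIcc p q))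
  refine isSchurMultiplier_integral (G := M) (H := 1) (by fun_prop) (by fun_prop)
    ((norm_nonneg _).trans (hM p Set.left_mem_uIcc)) zero_le_one (fun θ hθ i => ?_)
    fun θ _ j => hg1 _
  rw [abs_mul]
  exact (mul_le_of_le_one_right (abs_nonneg _) (hf1 _)).trans (hM θ (Set.uIoc_subset_uIcc hθ))

theorem isSchurMultiplier_integral_mul_cos (hw : Continuous w) (l : ι → ℝ) (m : κ → ℝ) :
    IsSchurMultiplier fun i j => ∫ θ in p..q, w θ * Real.cos ((l i - m j) * θ) := by
  have hcos := isSchurMultiplier_integral_mul (p := p) (q := q) hw Real.continuous_cos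
    Real.continuous_cos Real.abs_cos_le_one Real.abs_cos_le_one l m
  have hsin := isSchurMultiplier_integral_mul (p := p) (q := q) hw Real.continuous_sin
    Real.continuous_sin Real.abs_sin_le_one Real.abs_sin_le_one l m
  convert hcos.add hsin using 3 with i j
  rw [← intervalIntegral.integral_add (Continuous.intervalIntegrable (by fun_prop) _ _)
    (Continuous.intervalIntegrable (by fun_prop) _ _)]
  refine intervalIntegral.integral_congr fun θ _ => ?_
  simp only [sub_mul, Real.cos_sub]
  ring

theorem isSchurMultiplier_integral_mul_sin (hw : Continuous w) (l : ι → ℝ) (m : κ → ℝ) :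
    IsSchurMultiplier fun i j => ∫ θ in p..q, w θ * Real.sin ((l i - m j) * θ) := by
  have hsc := isSchurMultiplier_integral_mul (p := p) (q := q) hw Real.continuous_sin
    Real.continuous_cos Real.abs_sin_le_one Real.abs_cos_le_one l m
  have hcs := isSchurMultiplier_integral_mul (p := p) (q := q) hw Real.continuous_cos
    Real.continuous_sin Real.abs_cos_le_one Real.abs_sin_le_one l m
  convert hsc.add (hcs.const_mul (-1)) using 3 with i j
  rw [← intervalIntegral.integral_const_mul, ← intervalIntegral.integral_add
    (Continuous.intervalIntegrable (by fun_prop) _ _)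
    (Continuous.intervalIntegrable (by fun_prop) _ _)]
  refine intervalIntegral.integral_congr fun θ _ => ?_
  simp only [sub_mul, Real.sin_sub]
  ring

theorem sin_int_mul_two_pi (k : ℤ) : Real.sin (k * (2 * Real.pi)) = 0 := by
  simpa [mul_assoc] using Real.sin_int_mul_pi (k * 2)

theorem integral_cos_int_mul (k : ℤ) :
    ∫ θ in 0..(2 * Real.pi), Real.cos (k * θ) = if k = 0 then 2 * Real.pi else 0 := by
  split_ifs with hk
  · simp [hk]
  · rw [intervalIntegral.integral_comp_mul_left (fun θ => Real.cos θ) (Int.cast_ne_zero.2 hk),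
      integral_cos, sin_int_mul_two_pi]
    simp

theorem integral_pi_sub_mul_sin_int_mul (k : ℤ) :
    ∫ θ in 0..(2 * Real.pi), (Real.pi - θ) * Real.sin (k * θ) = 2 * Real.pi * (k : ℝ)⁻¹ := by
  rcases eq_or_ne k 0 with rfl | hk
  · simp
  have hk' : (k : ℝ) ≠ 0 := Int.cast_ne_zero.2 hk
  have hderiv (θ : ℝ) : HasDerivAt
      (fun θ => -(Real.pi - θ) * Real.cos (k * θ) / k - Real.sin (k * θ) / k ^ 2)
      ((Real.pi - θ) * Real.sin (k * θ)) θ := by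
    have hlin : HasDerivAt (fun θ : ℝ => (k : ℝ) * θ) k θ := by
      simpa using (hasDerivAt_id θ).const_mul (k : ℝ)
    refine (((((hasDerivAt_id θ).const_sub Real.pi).neg.mul hlin.cos).div_const (k : ℝ)).sub
      (hlin.sin.div_const ((k : ℝ) ^ 2))).congr_deriv ?_
    simp only [Pi.neg_apply, id]
    field_simp
    ring
  rw [intervalIntegral.integral_eq_sub_of_hasDerivAt (fun θ _ => hderiv θ)
    (Continuous.intervalIntegrable (by fun_prop) _ _)]
  simp only [sin_int_mul_two_pi, Real.cos_int_mul_two_pi, mul_zero, Real.sin_zero, Real.cos_zero]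
  field_simp
  ring

variable (l : ι → ℤ) (m : κ → ℤ)

-- The sawtooth `(π - θ) / 2` has the Fourier sine coefficients `1 / k`; at `k = 0` both sides
-- vanish by the convention `0⁻¹ = 0`.
theorem isSchurMultiplier_inv_sub : IsSchurMultiplier fun i j => ((l i : ℝ) - m j)⁻¹ := by
  have h := (isSchurMultiplier_integral_mul_sin (w := fun θ => Real.pi - θ) (p := 0)
    (q := 2 * Real.pi) (by fun_prop) (fun i => (l i : ℝ)) (fun j => (m j : ℝ))).const_mul
    (2 * Real.pi)⁻¹
  convert h using 3 with i j
  have hintegral := integral_pi_sub_mul_sin_int_mul (l i - m j)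
  push_cast at hintegral
  rw [hintegral, inv_mul_cancel_left₀ (by positivity)]

theorem isSchurMultiplier_ite_eq :
    IsSchurMultiplier fun i j => if l i = m j then (1 : ℝ) else 0 := by
  have h := (isSchurMultiplier_integral_mul_cos (w := 1) (p := 0) (q := 2 * Real.pi)
    continuous_one (fun i => (l i : ℝ)) (fun j => (m j : ℝ))).const_mul (2 * Real.pi)⁻¹
  convert h using 3 with i j
  have hintegral := integral_cos_int_mul (l i - m j)
  push_cast at hintegral
  simp only [Pi.one_apply, one_mul, hintegral, sub_eq_zero]
  split_ifs
  · rw [inv_mul_cancel₀ (by positivity)]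
  · rw [mul_zero]

end Schur

/-! ### Bounded perturbations of diagonal operators with integer spectrum -/

section DiagAdd

variable {ι : Type*}

/-- `x` lies in the domain of the unbounded operator `diag(lam) + R` on `l²(ι)`, which maps it
to `z`. -/
def DiagAddMaps (lam : ι → ℤ) (R : L2 ι →L[ℝ] L2 ι) (x z : L2 ι) : Prop :=
  ∀ i, lam i * x i + R x i = z i

namespace DiagAddMaps

variable {lam : ι → ℤ} {R : L2 ι →L[ℝ] L2 ι} {x z x' z' : L2 ι}

theorem add (h : DiagAddMaps lam R x z) (h' : DiagAddMaps lam R x' z') :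
    DiagAddMaps lam R (x + x') (z + z') := fun i => by
  simp only [map_add, lp.coeFn_add, Pi.add_apply]
  linear_combination h i + h' i

theorem smul (c : ℝ) (h : DiagAddMaps lam R x z) : DiagAddMaps lam R (c • x) (c • z) := fun i => by
  simp only [map_smul, lp.coeFn_smul, Pi.smul_apply, smul_eq_mul]
  linear_combination c * h i

theorem sub (h : DiagAddMaps lam R x z) (h' : DiagAddMaps lam R x' z') :
    DiagAddMaps lam R (x - x') (z - z') := by
  simpa [sub_eq_add_neg] using h.add (h'.smul (-1))

theorem unique (h : DiagAddMaps lam R x z) (h' : DiagAddMaps lam R x z') : z = z' := by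
  ext i
  exact (h i).symm.trans (h' i)

theorem eq_zero_of_gap {s d : ℝ} (hgap : ∀ i, x i ≠ 0 → d ≤ |lam i - s|) (hR : ‖R‖ < d)
    (h : DiagAddMaps lam R x (s • x)) : x = 0 := by
  have hd : 0 < d := (norm_nonneg R).trans_lt hR
  have hentry (i : ι) : d ^ 2 * x i ^ 2 ≤ R x i ^ 2 := by
    have hRx : R x i = -((lam i - s) * x i) := by
      have hi := h i
      simp only [lp.coeFn_smul, Pi.smul_apply, smul_eq_mul] at hi
      linarith
    rw [hRx, neg_sq, mul_pow, ← sq_abs (lam i - s : ℝ)]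
    rcases eq_or_ne (x i) 0 with hi | hi
    · simp [hi]
    · gcongr
      exact hgap i hi
  have hsq : (d * ‖x‖) ^ 2 ≤ ‖R x‖ ^ 2 := by
    rw [mul_pow]
    exact hasSum_le hentry ((hasSum_sq x).mul_left _) (hasSum_sq (R x))
  have hle : d * ‖x‖ ≤ ‖R‖ * ‖x‖ :=
    (le_of_sq_le_sq hsq (norm_nonneg _)).trans (R.le_opNorm x)
  by_contra hx
  exact hR.not_ge (le_of_mul_le_mul_right hle (norm_pos_iff.2 hx))

end DiagAddMaps

theorem exists_equiv_one_add {E : Type*} [NormedAddCommGroup E] [NormedSpace ℝ E] [CompleteSpace E]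
    {X : E →L[ℝ] E} (hX : ‖X‖ < 1) : ∃ T : E ≃L[ℝ] E, ∀ x, T x = x + X x := by
  refine ⟨ContinuousLinearEquiv.unitsEquiv ℝ E (Units.oneSub (-X) (by rwa [norm_neg])),
    fun x => ?_⟩
  change (Units.oneSub (-X) (by rwa [norm_neg]) : E →L[ℝ] E) x = x + X x
  simp

theorem exists_diagAddMaps_of_gap {lam : ι → ℤ} {R : L2 ι →L[ℝ] L2 ι} {s d : ℝ}
    (hgap : ∀ i, d ≤ |lam i - s|) (hR : ‖R‖ < d) (z : L2 ι) :
    ∃ x, DiagAddMaps lam R x (z + s • x) := by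
  have hd : 0 < d := (norm_nonneg R).trans_lt hR
  obtain ⟨Q, hQd, hQ⟩ := exists_diagonal (fun i => (lam i - s : ℝ)⁻¹) (C := d⁻¹) (by positivity)
    fun i => by rw [abs_inv]; exact inv_anti₀ hd (hgap i)
  have hQR : ‖Q * R‖ < 1 :=
    calc ‖Q * R‖ ≤ ‖Q‖ * ‖R‖ := norm_mul_le _ _
      _ ≤ d⁻¹ * ‖R‖ := by gcongr
      _ < 1 := by rwa [inv_mul_lt_one₀ hd]
  obtain ⟨U, hU⟩ := exists_equiv_one_add hQR
  refine ⟨U.symm (Q z), fun i => ?_⟩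
  set x := U.symm (Q z) with hx
  have hres : x + Q (R x) = Q z := by rw [← U.apply_symm_apply (Q z), ← hx, hU]; rfl
  have hentry : x i + (lam i - s : ℝ)⁻¹ * R x i = (lam i - s : ℝ)⁻¹ * z i := by
    rw [← hQ, ← hQ, ← hres]
    rfl
  have hne : (lam i - s : ℝ) ≠ 0 := abs_pos.1 (hd.trans_le (hgap i))
  simp only [lp.coeFn_add, lp.coeFn_smul, Pi.add_apply, Pi.smul_apply, smul_eq_mul]
  field_simp at hentry
  linarith

theorem half_le_abs_sub_half (k : ℤ) : 1 / 2 ≤ |(k : ℝ) - 1 / 2| := by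
  rcases le_or_gt k 0 with hk | hk
  · have hk' : (k : ℝ) ≤ 0 := by exact_mod_cast hk
    rw [abs_of_neg (by linarith)]
    linarith
  · have hk' : (1 : ℝ) ≤ k := by exact_mod_cast hk
    rw [abs_of_pos (by linarith)]
    linarith

theorem DiagAddMaps.conj {lam : ι → ℤ} {R X D : L2 ι →L[ℝ] L2 ι}
    (hXD : ∀ i j, lam i * X (basisVec j) i - X (basisVec j) i * lam j + R (basisVec j) i +
      R (X (basisVec j)) i = D (basisVec j) i + X (D (basisVec j)) i)
    {y z : L2 ι} (h : DiagAddMaps lam D y z) : DiagAddMaps lam R (y + X y) (z + X z) := by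
  intro i
  have hsum := ((((hasSum_entries X y i).mul_left (lam i : ℝ)).add (hasSum_entries R y i)).add
    (hasSum_entries (R * X) y i)).sub ((hasSum_entries D y i).add (hasSum_entries (X * D) y i))
  have hterm (j : ι) : X (basisVec j) i * (z - D y : L2 ι) j = lam i * (X (basisVec j) i * y j) +
      R (basisVec j) i * y j + (R * X) (basisVec j) i * y j -
      (D (basisVec j) i * y j + (X * D) (basisVec j) i * y j) := by
    simp only [lp.coeFn_sub, Pi.sub_apply, mul_apply_eq_comp]
    linear_combination (-y j) * hXD i j - X (basisVec j) i * h j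
  have heq := (hasSum_entries X (z - D y) i).unique (by simpa only [hterm] using hsum)
  simp only [mul_apply_eq_comp, map_sub, map_add, lp.coeFn_sub, lp.coeFn_add, Pi.sub_apply,
    Pi.add_apply] at heq ⊢
  linear_combination h i - heq

end DiagAdd

section BlockDiagonal

theorem exists_zero_norm_le_of_contDiffAt {E F : Type*} [NormedAddCommGroup E] [NormedSpace ℝ E]
    [CompleteSpace E] [NormedAddCommGroup F] [NormedSpace ℝ F] [CompleteSpace F] {f : E × F → F}
    (hf : ContDiffAt ℝ 1 f 0) (hf0 : ∀ v, f (0, v) = v) :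
    ∃ δ > 0, ∃ c > 0, ∀ u, ‖u‖ < δ → ∃ v, f (u, v) = 0 ∧ ‖v‖ ≤ c * ‖u‖ := by
  have hpartial : fderiv ℝ f (0, 0) ∘L .inr ℝ E F = .id ℝ F := by
    have hcomp : HasFDerivAt (fun v : F => f (0, v)) (fderiv ℝ f (0, 0) ∘L .inr ℝ E F) 0 :=
      HasFDerivAt.comp (g := f) (f := fun v : F => ((0 : E), v)) 0
        (hf.differentiableAt one_ne_zero).hasFDerivAt (hasFDerivAt_prodMk_right _ _)
    rw [funext hf0] at hcomp
    exact hcomp.unique (hasFDerivAt_id _)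
  have hinv : (fderiv ℝ f (0, 0) ∘L .inr ℝ E F).IsInvertible := by
    rw [hpartial]
    exact ⟨.refl ℝ _, rfl⟩
  let ψ := ContDiffAt.implicitFunction (u := ((0 : E), (0 : F))) hf one_ne_zero hinv
  have hψ0 : ψ 0 = 0 := ContDiffAt.implicitFunction_apply_self hf one_ne_zero hinv
  have hψ : ∀ᶠ u in nhds 0, f (u, ψ u) = f (0, 0) :=
    ContDiffAt.eventually_apply_implicitFunction hf one_ne_zero hinv
  have hψd : ContDiffAt ℝ 1 ψ 0 := ContDiffAt.contDiffAt_implicitFunction hf one_ne_zero hinv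
  obtain ⟨c, hcpos, hc⟩ := (hψd.differentiableAt one_ne_zero).isBigO_sub.exists_pos
  obtain ⟨δ, hδ, hball⟩ := Metric.eventually_nhds_iff.1 (hψ.and hc.bound)
  refine ⟨δ, hδ, c, hcpos, fun u hu => ⟨ψ u, ?_, ?_⟩⟩
  · rw [(hball (by simpa using hu)).1, hf0]
  · simpa [hψ0] using (hball (y := u) (by simpa using hu)).2

variable {ι : Type*} {lam : ι → ℤ}

/-- The matrix of `D` is block diagonal for the partition of `ι` into the level sets of `lam`. -/
def IsBlockDiagonal (lam : ι → ℤ) (D : L2 ι →L[ℝ] L2 ι) : Prop :=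
  ∀ i j, lam i ≠ lam j → D (basisVec j) i = 0

/-- The similarity `T` turns `diag(lam) + R` into `diag(lam) + D`, where `D` is block diagonal and
too small to let the spectra of different blocks meet. -/
structure IsBlockDiagonalisation (lam : ι → ℤ) (R : L2 ι →L[ℝ] L2 ι) (T : L2 ι ≃L[ℝ] L2 ι)
    (D : L2 ι →L[ℝ] L2 ι) : Prop where
  isBlockDiagonal : IsBlockDiagonal lam D
  norm_lt : ‖D‖ < 1 / 2
  maps_iff : ∀ {y z}, DiagAddMaps lam R (T y) (T z) ↔ DiagAddMaps lam D y z

theorem isBlockDiagonalisation_of_homological {R X D : L2 ι →L[ℝ] L2 ι} {T : L2 ι ≃L[ℝ] L2 ι}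
    (hT : ∀ x, T x = x + X x) (hD : IsBlockDiagonal lam D) (hRnorm : ‖R‖ < 1 / 2)
    (hDnorm : ‖D‖ < 1 / 2)
    (hXD : ∀ i j, lam i * X (basisVec j) i - X (basisVec j) i * lam j + R (basisVec j) i +
      R (X (basisVec j)) i = D (basisVec j) i + X (D (basisVec j)) i) :
    IsBlockDiagonalisation lam R T D where
  isBlockDiagonal := hD
  norm_lt := hDnorm
  maps_iff {y z} := by
    have hconj {y z : L2 ι} (h : DiagAddMaps lam D y z) : DiagAddMaps lam R (T y) (T z) := by
      simpa only [hT] using h.conj hXD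
    refine ⟨fun h => ?_, hconj⟩
    -- `1/2` is in the resolvent set of both operators, so the two resolvents can be compared.
    have hgap (i : ι) := half_le_abs_sub_half (lam i)
    obtain ⟨u, hu⟩ := exists_diagAddMaps_of_gap hgap hDnorm (z - (1 / 2 : ℝ) • y)
    have hsub : DiagAddMaps lam R (T (u - y)) ((1 / 2 : ℝ) • T (u - y)) := by
      convert (hconj hu).sub h using 1 <;> simp only [map_sub, map_add, map_smul]
      module
    have huy : u = y :=
      sub_eq_zero.1 (T.map_eq_zero_iff.1 (hsub.eq_zero_of_gap (fun i _ => hgap i) hRnorm))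
    rw [huy] at hu
    convert hu using 1
    module

/-- The fixed point equation for `X` is the homological equation
`[diag(lam), X] + R + R X = D + X D`, divided by the energy differences off the diagonal blocks. -/
theorem homological_equation {R X D : L2 ι →L[ℝ] L2 ι}
    (hX : ∀ i j, X (basisVec j) i = -((lam i - lam j : ℝ)⁻¹ *
      (R (basisVec j) i + R (X (basisVec j)) i - X (D (basisVec j)) i)))
    (hD : ∀ i j, D (basisVec j) i =
      (if lam i = lam j then 1 else 0) * (R (basisVec j) i + R (X (basisVec j)) i)) (i j : ι) :
    lam i * X (basisVec j) i - X (basisVec j) i * lam j + R (basisVec j) i +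
      R (X (basisVec j)) i = D (basisVec j) i + X (D (basisVec j)) i := by
  by_cases hij : lam i = lam j
  · have hXD : X (D (basisVec j)) i = 0 := by
      refine (hasSum_entries X (D (basisVec j)) i).unique ?_
      convert! hasSum_zero using 2 with k
      by_cases hik : lam i = lam k
      · rw [hX, hik]
        simp
      · rw [hD k j, if_neg (by rw [← hij]; exact Ne.symm hik)]
        simp
    rw [hXD, hD i j, if_pos hij, hij]
    ring
  · have hne : (lam i - lam j : ℝ) ≠ 0 := sub_ne_zero.2 (by exact_mod_cast hij)
    have hXij := hX i j
    rw [hD i j, if_neg hij]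
    field_simp at hXij
    linear_combination hXij

theorem exists_homological_fixedPoint {E : Type*} [NormedRing E] [NormedAlgebra ℝ E]
    [CompleteSpace E] (S P : E →L[ℝ] E) :
    ∃ δ > 0, ∃ c > 0, ∀ R : E, ‖R‖ < δ → ∃ X : E,
      X = -S (R + R * X - X * P (R + R * X)) ∧ ‖X‖ ≤ c * ‖R‖ ∧
        ‖R‖ < 1 / 2 ∧ ‖X‖ < 1 / 2 ∧ ‖P (R + R * X)‖ < 1 / 2 := by
  let f (u : E × E) : E := u.2 + S (u.1 + u.1 * u.2 - u.2 * P (u.1 + u.1 * u.2))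
  have hf : ContDiff ℝ 1 f := by
    have hRX : ContDiff ℝ 1 fun u : E × E => u.1 + u.1 * u.2 :=
      contDiff_fst.add (contDiff_fst.mul contDiff_snd)
    exact contDiff_snd.add (S.contDiff.comp (hRX.sub (contDiff_snd.mul (P.contDiff.comp hRX))))
  obtain ⟨δ, hδ, c, hc, hsol⟩ :=
    exists_zero_norm_le_of_contDiffAt hf.contDiffAt fun v => by simp [f]
  refine ⟨min δ (min (2 * c)⁻¹ (4 * (‖P‖ + 1))⁻¹), by positivity, c, hc, fun R hR => ?_⟩
  obtain ⟨hRδ, hRc, hRP⟩ : ‖R‖ < δ ∧ ‖R‖ < (2 * c)⁻¹ ∧ ‖R‖ < (4 * (‖P‖ + 1))⁻¹ := by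
    simpa only [lt_min_iff] using hR
  obtain ⟨X, hX, hXR⟩ := hsol R hRδ
  have hXnorm : ‖X‖ < 1 / 2 :=
    calc ‖X‖ ≤ c * ‖R‖ := hXR
      _ < c * (2 * c)⁻¹ := by gcongr
      _ = 1 / 2 := by field_simp
  have hRP' : 4 * ((‖P‖ + 1) * ‖R‖) < 1 := by
    rw [← mul_assoc, ← lt_inv_mul_iff₀ (by positivity), mul_one]
    exact hRP
  have hRnorm : ‖R‖ < 1 / 2 := by nlinarith [norm_nonneg P, norm_nonneg R]
  have hRX : ‖R + R * X‖ ≤ ‖R‖ + ‖R‖ * ‖X‖ :=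
    (norm_add_le _ _).trans (by gcongr; exact norm_mul_le _ _)
  refine ⟨X, eq_neg_of_add_eq_zero_left hX, hXR, hRnorm, hXnorm, ?_⟩
  calc ‖P (R + R * X)‖ ≤ ‖P‖ * (‖R‖ + ‖R‖ * ‖X‖) := P.le_of_opNorm_le_of_le le_rfl hRX
    _ < 1 / 2 := by nlinarith [mul_nonneg (norm_nonneg P) (norm_nonneg R), norm_nonneg R]

theorem exists_isBlockDiagonalisation (lam : ι → ℤ) :
    ∃ δ > 0, ∃ c > 0, ∀ R : L2 ι →L[ℝ] L2 ι, ‖R‖ < δ → ∃ T D, IsBlockDiagonalisation lam R T D ∧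
      ∀ i j, lam i = lam j → |D (basisVec j) i - R (basisVec j) i| ≤ c * ‖R‖ ^ 2 := by
  obtain ⟨S, hS⟩ := isSchurMultiplier_inv_sub lam lam
  obtain ⟨P, hP⟩ := isSchurMultiplier_ite_eq lam lam
  obtain ⟨δ, hδ, c, hc, hsol⟩ := exists_homological_fixedPoint S P
  refine ⟨δ, hδ, c, hc, fun R hR => ?_⟩
  obtain ⟨X, hfixed, hXR, hRnorm, hXnorm, hDnorm⟩ := hsol R hR
  obtain ⟨T, hT⟩ := exists_equiv_one_add (hXnorm.trans (by norm_num))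
  set D := P (R + R * X)
  have hD (i j : ι) : D (basisVec j) i =
      (if lam i = lam j then 1 else 0) * (R (basisVec j) i + R (X (basisVec j)) i) := hP _ _ _
  have hX (i j : ι) : X (basisVec j) i = -((lam i - lam j : ℝ)⁻¹ *
      (R (basisVec j) i + R (X (basisVec j)) i - X (D (basisVec j)) i)) := by
    conv_lhs => rw [hfixed]
    exact congrArg Neg.neg (hS (R + R * X - X * D) i j)
  refine ⟨T, D, isBlockDiagonalisation_of_homological hT (fun i j hij => by simp [hD, hij]) hRnorm
    hDnorm (homological_equation hX hD), fun i j hij => ?_⟩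
  calc |D (basisVec j) i - R (basisVec j) i| = |(R * X) (basisVec j) i| := by
        rw [hD, if_pos hij, one_mul, add_sub_cancel_left]
        rfl
    _ ≤ ‖R * X‖ * ‖(basisVec j : L2 ι)‖ :=
        (abs_apply_le_norm _ _).trans (ContinuousLinearMap.le_opNorm _ _)
    _ ≤ ‖R‖ * (c * ‖R‖) := by
        rw [norm_basisVec, mul_one]
        exact (norm_mul_le _ _).trans (by gcongr)
    _ = c * ‖R‖ ^ 2 := by ring

end BlockDiagonal

/-! ### Riesz bases -/

section RieszBasis

variable {ι E : Type*} [NormedAddCommGroup E] [InnerProductSpace ℝ E]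

theorem exists_hilbertBasis_basisVec : ∃ b : HilbertBasis ι ℝ (L2 ι), ∀ i, b i = basisVec i := by
  classical
  exact ⟨HilbertBasis.ofRepr (LinearIsometryEquiv.refl ℝ _), fun i => by
    rw [← HilbertBasis.repr_symm_single]; rfl⟩

theorem exists_hilbertBasis_reindex {κ : Type*} [CompleteSpace E] (b : HilbertBasis ι ℝ E)
    (e : κ ≃ ι) : ∃ b' : HilbertBasis κ ℝ E, ∀ k, b' k = b (e k) := by
  have hspan : Set.range (b ∘ e) = Set.range b := e.surjective.range_comp b
  exact ⟨HilbertBasis.mk (b.orthonormal.comp e e.injective) (by rw [hspan, b.dense_span]),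
    fun k => by rw [HilbertBasis.coe_mk, Function.comp_apply]⟩

theorem exists_equiv_smul_hilbertBasis (b : HilbertBasis ι ℝ E) (f : ι → ℝ) {m C : ℝ} (hm : 0 < m)
    (hf : ∀ i, m ≤ |f i|) (hC : ∀ i, |f i| ≤ C) :
    ∃ S : E ≃L[ℝ] E, ∀ i, S (b i) = f i • b i := by
  classical
  have hf0 (i : ι) : f i ≠ 0 := abs_pos.1 (hm.trans_le (hf i))
  obtain ⟨S, -, hS⟩ :=
    exists_diagonal f (abs_nonneg C) fun i => (hC i).trans (le_abs_self C)
  obtain ⟨S', -, hS'⟩ := exists_diagonal (fun i => (f i)⁻¹) (C := m⁻¹) (by positivity) fun i => by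
    rw [abs_inv]; exact inv_anti₀ hm (hf i)
  let D := ContinuousLinearEquiv.equivOfInverse S S'
    (fun x => by ext i; rw [hS', hS, inv_mul_cancel_left₀ (hf0 i)])
    (fun x => by ext i; rw [hS, hS', mul_inv_cancel_left₀ (hf0 i)])
  let r := b.repr.toContinuousLinearEquiv
  refine ⟨(r.trans D).trans r.symm, fun i => ?_⟩
  change b.repr.symm (S (b.repr (b i))) = f i • b i
  rw [b.repr_self, ← b.repr_symm_single, ← map_smul]
  congr 1
  ext j
  rw [hS]
  rcases eq_or_ne j i with rfl | hj
  · simp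
  · simp [hj]

/-- A Riesz basis up to normalisation: `v` consists of nonzero multiples of the members of a Riesz
basis. The multiples are arbitrary because eigenvectors are not normalised. -/
def IsScaledRieszBasis (v : ι → E) : Prop :=
  ∃ (b : HilbertBasis ι ℝ E) (T : E ≃L[ℝ] E) (c : ι → ℝ), (∀ i, c i ≠ 0) ∧ ∀ i, v i = c i • T (b i)

namespace IsScaledRieszBasis

variable {v : ι → E}

theorem smul {w : ι → E} (h : IsScaledRieszBasis v) {c : ι → ℝ} (hc : ∀ i, c i ≠ 0)
    (hw : ∀ i, w i = c i • v i) : IsScaledRieszBasis w := by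
  obtain ⟨b, T, d, hd, hv⟩ := h
  exact ⟨b, T, fun i => c i * d i, fun i => mul_ne_zero (hc i) (hd i), fun i => by
    rw [hw, hv, smul_smul]⟩

theorem reindex {κ : Type*} [CompleteSpace E] (h : IsScaledRieszBasis v) (e : κ ≃ ι) :
    IsScaledRieszBasis fun k => v (e k) := by
  obtain ⟨b, T, d, hd, hv⟩ := h
  obtain ⟨b', hb'⟩ := exists_hilbertBasis_reindex b e
  exact ⟨b', T, fun k => d (e k), fun k => hd _, fun k => by simp only [hv, hb']⟩

theorem map (h : IsScaledRieszBasis v) (T : E ≃L[ℝ] E) : IsScaledRieszBasis fun i => T (v i) := by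
  obtain ⟨b, S, d, hd, hv⟩ := h
  exact ⟨b, S.trans T, d, hd, fun i => by simp [hv]⟩

theorem of_isometry {E' : Type*} [NormedAddCommGroup E'] [InnerProductSpace ℝ E']
    (e : E ≃ₗᵢ[ℝ] E') (h : IsScaledRieszBasis fun i => e (v i)) : IsScaledRieszBasis v := by
  classical
  obtain ⟨b, T, c, hc, hv⟩ := h
  refine ⟨HilbertBasis.ofRepr (e.trans b.repr),
    (e.toContinuousLinearEquiv.trans T).trans e.symm.toContinuousLinearEquiv, c, hc, fun i => ?_⟩
  have hb : HilbertBasis.ofRepr (e.trans b.repr) i = e.symm (b i) := by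
    rw [← HilbertBasis.repr_symm_single, ← HilbertBasis.repr_symm_single]
    rfl
  rw [hb]
  change v i = c i • e.symm (T (e (e.symm (b i))))
  rw [e.apply_symm_apply, ← map_smul, ← hv, e.symm_apply_apply]

theorem isUnconditionalBasis (h : IsScaledRieszBasis v) : IsUnconditionalBasis v := by
  classical
  obtain ⟨b, T, d, hd, hv⟩ := h
  let u := b.toUnconditionalSchauderBasis
  have hub (i : ι) : u.basis i = b i := rfl
  refine ⟨{ basis := v
            coord := fun i => (d i)⁻¹ • (u.coord i).comp (T.symm : E →L[ℝ] E)
            ortho := fun i j => ?_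
            expansion := fun x => ?_ }, fun i => rfl⟩
  · simp only [hv, smul_apply, ContinuousLinearMap.comp_apply, map_smul,
      ContinuousLinearEquiv.coe_coe, T.symm_apply_apply]
    rw [← hub, u.ortho i j]
    rcases eq_or_ne i j with rfl | hij
    · simp [hd]
    · simp [hij]
  · have hsum := (T : E →L[ℝ] E).hasSum (u.expansion (T.symm x))
    simp only [map_smul, ContinuousLinearEquiv.coe_coe, T.apply_symm_apply] at hsum
    convert hsum using 2 with i
    rw [hv, hub, smul_apply, ContinuousLinearMap.comp_apply, smul_smul, smul_eq_mul,
      ContinuousLinearEquiv.coe_coe, mul_right_comm, inv_mul_cancel₀ (hd i), one_mul]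

theorem eq_zero_of_inner_eq_zero (h : IsScaledRieszBasis v) {x : E}
    (hx : ∀ i, inner ℝ x (v i) = 0) : x = 0 := by
  obtain ⟨b, hb⟩ := h.isUnconditionalBasis
  have hsum := (innerSL ℝ x).hasSum (b.expansion x)
  have hb' (i : ι) : b.basis i = v i := hb i
  simp only [map_smul, innerSL_apply_apply, hb', hx, smul_zero] at hsum
  exact inner_self_eq_zero.1 (hsum.unique hasSum_zero)

theorem isRieszBasis (h : IsScaledRieszBasis v) : IsRieszBasis fun i => ‖v i‖⁻¹ • v i := by
  obtain ⟨b, T, d, hd, hv⟩ := h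
  rcases isEmpty_or_nonempty ι with hι | ⟨⟨i₀⟩⟩
  · exact ⟨b, T, fun i => hι.elim i⟩
  have hb (i : ι) : ‖b i‖ = 1 := b.orthonormal.1 i
  have hlower (i : ι) : 1 ≤ ‖(T.symm : E →L[ℝ] E)‖ * ‖T (b i)‖ := by
    simpa [hb] using (T.symm : E →L[ℝ] E).le_opNorm (T (b i))
  have hupper (i : ι) : ‖T (b i)‖ ≤ ‖(T : E →L[ℝ] E)‖ := by
    simpa [hb] using (T : E →L[ℝ] E).le_opNorm (b i)
  have hTb (i : ι) : 0 < ‖T (b i)‖ :=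
    pos_of_mul_pos_right (one_pos.trans_le (hlower i)) (norm_nonneg _)
  have hscale (i : ι) : |‖v i‖⁻¹ * d i| = ‖T (b i)‖⁻¹ := by
    rw [hv, norm_smul, mul_inv, Real.norm_eq_abs, abs_mul, abs_mul, abs_inv, abs_inv, abs_abs,
      abs_norm, mul_right_comm, inv_mul_cancel₀ (abs_ne_zero.2 (hd i)), one_mul]
  obtain ⟨S, hS⟩ := exists_equiv_smul_hilbertBasis b (fun i => ‖v i‖⁻¹ * d i)
    (inv_pos.2 ((hTb i₀).trans_le (hupper i₀)))
    (fun i => by rw [hscale]; exact inv_anti₀ (hTb i) (hupper i))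
    (fun i => by rw [hscale, inv_eq_one_div, div_le_iff₀ (hTb i)]; exact hlower i)
  refine ⟨b, S.trans T, fun i => ?_⟩
  rw [ContinuousLinearEquiv.trans_apply, hS, map_smul, mul_smul, ← hv]

end IsScaledRieszBasis

end RieszBasis

section FiniteChange

theorem bijective_one_add_of_injective {E : Type*} [NormedAddCommGroup E] [NormedSpace ℝ E]
    [CompleteSpace E] {S : E →L[ℝ] E} (hS : IsCompactOperator S)
    (hinj : Function.Injective (1 + S : E →L[ℝ] E)) : Function.Bijective (1 + S : E →L[ℝ] E) := by
  rcases hS.hasEigenvalue_or_mem_resolventSet (μ := (-1 : ℝ)) (by norm_num) with heig | hres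
  · obtain ⟨x, hx, hx0⟩ := heig.exists_hasEigenvector
    have hSx : S x = (-1 : ℝ) • x := Module.End.mem_eigenspace_iff.1 hx
    exact absurd (hinj (by simp [hSx] : (1 + S) x = (1 + S) 0)) hx0
  · rw [spectrum.mem_resolventSet_iff, ← IsUnit.neg_iff] at hres
    rw [← ContinuousLinearMap.isUnit_iff_bijective]
    convert hres using 1
    ext x
    simp [add_comm]

variable {ι : Type*}

/-- The finite rank operator that added to the identity replaces `basisVec i` by `w i` for all `i`
in the finite set `F`. -/
noncomputable def finiteChange (F : Finset ι) (w : ι → L2 ι) : L2 ι →L[ℝ] L2 ι :=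
  ∑ i ∈ F, (coordCLM i).smulRight (w i - basisVec i)

theorem finiteChange_apply (F : Finset ι) (w : ι → L2 ι) (x : L2 ι) :
    finiteChange F w x = ∑ i ∈ F, x i • (w i - basisVec i) := by
  simp only [finiteChange, sum_apply, ContinuousLinearMap.smulRight_apply, coordCLM_apply]

theorem isCompactOperator_finiteChange (F : Finset ι) (w : ι → L2 ι) :
    IsCompactOperator (finiteChange F w) :=
  Submodule.sum_mem (compactOperator (RingHom.id ℝ) (L2 ι) (L2 ι)) fun i _ =>
    (isCompactOperator_of_locallyCompactSpace_rng
      (ContinuousLinearMap.toSpanSingleton ℝ (w i - basisVec i))).comp_clm (coordCLM i)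

theorem finiteChange_apply_of_notMem {F : Finset ι} {w : ι → L2 ι}
    (hw : ∀ i ∈ F, ∀ j ∉ F, w i j = 0) (x : L2 ι) {j : ι} (hj : j ∉ F) :
    finiteChange F w x j = 0 := by
  rw [finiteChange_apply, ← coordCLM_apply, map_sum]
  refine Finset.sum_eq_zero fun i hi => ?_
  rw [map_smul, coordCLM_apply, lp.coeFn_sub, Pi.sub_apply, hw i hi j hj,
    basisVec_of_ne (ne_of_mem_of_not_mem hi hj).symm, sub_zero, smul_zero]

theorem injective_one_add_finiteChange {F : Finset ι} {w : ι → L2 ι}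
    (hw : ∀ i ∈ F, ∀ j ∉ F, w i j = 0) (hli : LinearIndepOn ℝ w (F : Set ι)) :
    Function.Injective (1 + finiteChange F w : L2 ι →L[ℝ] L2 ι) := by
  classical
  rw [injective_iff_map_eq_zero]
  intro x hx
  have hoff (j : ι) (hj : j ∉ F) : x j = 0 := by
    have hxj : x j + finiteChange F w x j = 0 := congrArg (fun y : L2 ι => y j) hx
    rwa [finiteChange_apply_of_notMem hw x hj, add_zero] at hxj
  have hxF : x = finVec F x := by
    ext j
    rw [finVec_apply]
    split_ifs with hj
    exacts [rfl, hoff j hj]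
  have hsum : ∑ i ∈ F, x i • w i = 0 :=
    calc ∑ i ∈ F, x i • w i = finVec F x + finiteChange F w x := by
          simp only [finiteChange_apply, finVec, smul_sub, Finset.sum_sub_distrib]
          abel
      _ = 0 := by rw [← hxF]; exact hx
  ext j
  by_cases hj : j ∈ F
  · exact linearIndepOn_finset_iff.1 hli x hsum j hj
  · exact hoff j hj

theorem exists_equiv_of_linearIndepOn (F : Finset ι) {w : ι → L2 ι}
    (hw : ∀ i ∈ F, ∀ j ∉ F, w i j = 0) (hli : LinearIndepOn ℝ w (F : Set ι)) :
    ∃ U : L2 ι ≃L[ℝ] L2 ι, (∀ i ∈ F, U (basisVec i) = w i) ∧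
      ∀ i ∉ F, U (basisVec i) = basisVec i := by
  have hinj := injective_one_add_finiteChange hw hli
  let U := ContinuousLinearEquiv.ofBijective (1 + finiteChange F w) (LinearMap.ker_eq_bot.2 hinj)
    (LinearMap.range_eq_top.2
      (bijective_one_add_of_injective (isCompactOperator_finiteChange F w) hinj).2)
  have hUbasis (i : ι) :
      U (basisVec i) = basisVec i + ∑ k ∈ F, basisVec i k • (w k - basisVec k) := by
    rw [← finiteChange_apply]
    rfl
  refine ⟨U, fun i hi => ?_, fun i hi => ?_⟩
  · rw [hUbasis, Finset.sum_eq_single_of_mem i hi fun k _ hk => by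
      rw [basisVec_of_ne hk, zero_smul]]
    simp
  · rw [hUbasis, Finset.sum_eq_zero, add_zero]
    intro k hk
    rw [basisVec_of_ne (ne_of_mem_of_not_mem hk hi), zero_smul]

end FiniteChange

/-! ### Spectral blocks -/

section Block

variable {ι : Type*} {lam : ι → ℤ} {k : ℤ} {D : L2 ι →L[ℝ] L2 ι} {x y z w : L2 ι}

/-- The sequences supported on the level set `lam = k`, i.e. the spectral subspace of `diag(lam)`
for the eigenvalue `k`. -/
def block (lam : ι → ℤ) (k : ℤ) : Submodule ℝ (L2 ι) where
  carrier := {y | ∀ i, lam i ≠ k → y i = 0}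
  add_mem' hy hz i hi := by rw [lp.coeFn_add, Pi.add_apply, hy i hi, hz i hi, add_zero]
  zero_mem' _ _ := rfl
  smul_mem' c y hy i hi := by rw [lp.coeFn_smul, Pi.smul_apply, hy i hi, smul_zero]

theorem basisVec_mem_block (i : ι) : basisVec i ∈ block lam (lam i) := fun _ hj =>
  basisVec_of_ne fun h => hj (h ▸ rfl)

theorem eq_smul_basisVec_of_mem_block {i : ι} (hi : ∀ j, lam j = lam i → j = i)
    (hy : y ∈ block lam (lam i)) : y = y i • basisVec i := by
  ext j
  rw [lp.coeFn_smul, Pi.smul_apply, smul_eq_mul]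
  rcases eq_or_ne j i with rfl | hj
  · rw [basisVec_self, mul_one]
  · rw [hy j (fun h => hj (hi j h)), basisVec_of_ne hj, mul_zero]

theorem eq_smul_add_smul_of_mem_block {p q : ι} (hpq : p ≠ q) (hk : ∀ j, lam j = k → j = p ∨ j = q)
    (hy : y ∈ block lam k) : y = y p • basisVec p + y q • basisVec q := by
  ext j
  simp only [lp.coeFn_add, Pi.add_apply, lp.coeFn_smul, Pi.smul_apply, smul_eq_mul]
  rcases eq_or_ne j p with rfl | hjp
  · rw [basisVec_self, basisVec_of_ne hpq, mul_one, mul_zero, add_zero]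
  rcases eq_or_ne j q with rfl | hjq
  · rw [basisVec_self, basisVec_of_ne hjp, mul_one, mul_zero, zero_add]
  · rw [hy j (fun h => (hk j h).elim hjp hjq), basisVec_of_ne hjp, basisVec_of_ne hjq, mul_zero,
      mul_zero, add_zero]

theorem linearIndependent_of_mem_block {w : ι → L2 ι} (hw : ∀ i, w i ∈ block lam (lam i))
    (hli : ∀ k, LinearIndepOn ℝ w {i | lam i = k}) : LinearIndependent ℝ w := by
  rw [linearIndependent_iff']
  intro s g hg i hi
  have hblock : ∑ j ∈ s with lam j = lam i, g j • w j = 0 := by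
    have hcoord (l : ι) : ∑ j ∈ s with lam j = lam l, g j * w j l = 0 := by
      have hsum : ∑ j ∈ s, g j * w j l = 0 := by
        simpa only [map_sum, map_smul, coordCLM_apply, smul_eq_mul, map_zero] using
          congrArg (coordCLM l) hg
      rw [← hsum]
      refine Finset.sum_filter_of_ne fun j _ hj => ?_
      by_contra hjl
      exact hj (by rw [hw j l (Ne.symm hjl), mul_zero])
    ext l
    rw [← coordCLM_apply, map_sum]
    simp only [map_smul, coordCLM_apply, smul_eq_mul]
    by_cases hl : lam l = lam i
    · rw [← hl]
      exact hcoord l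
    · refine Finset.sum_eq_zero fun j hj => ?_
      rw [hw j l (by rw [(Finset.mem_filter.1 hj).2]; exact hl), mul_zero]
  have hsub : ((s.filter fun j => lam j = lam i : Finset ι) : Set ι) ⊆ {j | lam j = lam i} :=
    fun j hj => (Finset.mem_filter.1 hj).2
  exact linearIndepOn_finset_iff.1 ((hli (lam i)).mono hsub) g hblock i
    (Finset.mem_filter.2 ⟨hi, rfl⟩)

/-- Outside finitely many indices the blocks are lines, so only finitely many vectors have to be
changed to reach the standard basis. -/
theorem isScaledRieszBasis_of_mem_block (F : Finset ι) (hF : ∀ i ∉ F, ∀ j, lam j = lam i → j = i)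
    {w : ι → L2 ι} (hw : ∀ i, w i ∈ block lam (lam i))
    (hli : ∀ k, LinearIndepOn ℝ w {i | lam i = k}) : IsScaledRieszBasis w := by
  classical
  have hindep := linearIndependent_of_mem_block hw hli
  obtain ⟨U, hUF, hUoff⟩ := exists_equiv_of_linearIndepOn F (w := w)
    (fun i hi j hj => hw i j fun hij => hj (hF j hj i hij.symm ▸ hi)) (hindep.linearIndepOn _)
  obtain ⟨b, hb⟩ := exists_hilbertBasis_basisVec (ι := ι)
  have hline {i : ι} (hi : i ∉ F) : w i = w i i • basisVec i :=
    eq_smul_basisVec_of_mem_block (hF i hi) (hw i)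
  refine ⟨b, U, fun i => if i ∈ F then 1 else w i i, fun i => ?_, fun i => ?_⟩
  · dsimp only
    split_ifs with hi
    · exact one_ne_zero
    · exact fun h0 => hindep.ne_zero i (by rw [hline hi, h0, zero_smul])
  · dsimp only
    rw [hb]
    split_ifs with hi
    · rw [hUF i hi, one_smul]
    · rw [hUoff i hi, ← hline hi]

theorem diagAddMaps_of_mem_block (hy : y ∈ block lam k) :
    DiagAddMaps lam D y ((k : ℝ) • y + D y) := fun i => by
  simp only [lp.coeFn_add, Pi.add_apply, lp.coeFn_smul, Pi.smul_apply, smul_eq_mul, add_left_inj]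
  by_cases hi : lam i = k
  · rw [hi]
  · rw [hy i hi, mul_zero, mul_zero]

theorem DiagAddMaps.apply_eq_of_mem_block (h : DiagAddMaps lam D y z) (hy : y ∈ block lam k) :
    D y = z - (k : ℝ) • y := by
  rw [h.unique (diagAddMaps_of_mem_block hy), add_sub_cancel_left]

theorem linearIndepOn_of_diagAddMaps {κ : Type*} {s : Set κ} {w : κ → L2 ι} {E : κ → ℝ}
    (hE : s.InjOn E) (hw : ∀ i ∈ s, w i ∈ block lam k) (hw0 : ∀ i ∈ s, w i ≠ 0)
    (hmaps : ∀ i ∈ s, DiagAddMaps lam D (w i) (E i • w i)) : LinearIndepOn ℝ w s := by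
  refine Module.End.eigenvectors_linearIndependent' (D : Module.End ℝ (L2 ι))
    (fun i : s => E i - k) (fun i j hij => Subtype.ext (hE i.2 j.2 (sub_left_injective hij))) _
    fun i => ⟨Module.End.mem_eigenspace_iff.2 ?_, hw0 i i.2⟩
  rw [sub_smul]
  exact (hmaps i i.2).apply_eq_of_mem_block (hw i i.2)

namespace IsBlockDiagonal

theorem map_mem_block (hD : IsBlockDiagonal lam D) (hy : y ∈ block lam k) : D y ∈ block lam k := by
  intro i hi
  refine (hasSum_entries D y i).unique ?_
  convert! hasSum_zero using 2 with j
  by_cases hj : lam j = k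
  · rw [hD i j (by rwa [hj]), zero_mul]
  · rw [hy j hj, mul_zero]

theorem mem_block_of_maps (hD : IsBlockDiagonal lam D) (hnorm : ‖D‖ < 1 / 2) {ν : ℝ}
    (hν : |(k : ℝ) - ν| < 1 / 2) (hw : w ∈ block lam k) (h : DiagAddMaps lam D y (w + ν • y)) :
    y ∈ block lam k := by
  obtain ⟨Q, -, hQ⟩ := exists_diagonal (fun i => if lam i = k then (0 : ℝ) else 1) zero_le_one
    fun i => by split_ifs <;> simp
  have hQD (i : ι) : D (Q y) i = if lam i = k then 0 else D y i := by
    refine (hasSum_entries D (Q y) i).unique ?_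
    split_ifs with hi
    · convert! hasSum_zero using 2 with j
      by_cases hj : lam j = k
      · rw [hQ, if_pos hj, zero_mul, mul_zero]
      · rw [hD i j (by rw [hi]; exact Ne.symm hj), zero_mul]
    · convert! hasSum_entries D y i using 2 with j
      by_cases hj : lam j = k
      · rw [hD i j (by rwa [hj]), zero_mul, zero_mul]
      · rw [hQ, if_neg hj, one_mul]
  have hQy : DiagAddMaps lam D (Q y) (ν • Q y) := fun i => by
    have hi := h i
    simp only [lp.coeFn_add, Pi.add_apply, lp.coeFn_smul, Pi.smul_apply, smul_eq_mul, hQ, hQD]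
      at hi ⊢
    split_ifs with hik
    · ring
    · rw [hw i hik] at hi
      linarith
  have hgap (i : ι) (hi : Q y i ≠ 0) : 1 / 2 ≤ |(lam i : ℝ) - ν| := by
    have hik : lam i ≠ k := fun hik => hi (by simp [hQ, hik])
    have hone : (1 : ℝ) ≤ |(lam i : ℝ) - k| := by
      exact_mod_cast Int.one_le_abs (sub_ne_zero.2 hik)
    linarith [abs_sub_le (lam i : ℝ) ν k, abs_sub_comm ν k]
  have hQ0 : Q y = 0 := hQy.eq_zero_of_gap hgap hnorm
  intro i hi
  have := hQ y i
  rw [hQ0, if_neg hi] at this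
  simpa using this.symm

theorem exists_trace_eigenvector (hD : IsBlockDiagonal lam D) {p q : ι} (hpq : p ≠ q)
    (hk : ∀ j, lam j = k ↔ j = p ∨ j = q) (hy : y ∈ block lam k) (hy0 : y ≠ 0) (hDy : D y = 0)
    (ht : D (basisVec p) p + D (basisVec q) q ≠ 0) :
    ∃ x ∈ block lam k, x ≠ 0 ∧ D x = (D (basisVec p) p + D (basisVec q) q) • x := by
  have hexpand {z : L2 ι} (hz : z ∈ block lam k) := eq_smul_add_smul_of_mem_block hpq
    (fun j => (hk j).1) hz
  wlog hyp : y p ≠ 0 generalizing p q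
  · have hyq : y q ≠ 0 := fun hyq => hy0 (by
      rw [hexpand hy, not_not.1 hyp, hyq, zero_smul, zero_smul, add_zero])
    have hswap := this hpq.symm (fun j => by rw [hk j, or_comm]) (by rwa [add_comm])
      (fun hz => by rw [add_comm]; exact hexpand hz) hyq
    rwa [add_comm (D (basisVec q) q)] at hswap
  set x := D (basisVec q) with hx
  have hxblock : x ∈ block lam k := by
    have hq : lam q = k := (hk q).2 (.inr rfl)
    exact hD.map_mem_block (hq ▸ basisVec_mem_block q)
  have hDp : D (basisVec p) = -(y q / y p) • x := by
    have hlin : y p • D (basisVec p) + y q • x = 0 := by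
      rw [hx, ← map_smul, ← map_smul, ← map_add, ← hexpand hy, hDy]
    rw [neg_smul, div_eq_inv_mul, mul_smul, ← smul_neg, ← eq_neg_of_add_eq_zero_left hlin,
      inv_smul_smul₀ hyp]
  refine ⟨x, hxblock, fun hx0 => ht (by rw [hDp, hx0]; simp), ?_⟩
  conv_lhs => rw [hexpand hxblock]
  rw [map_add, map_smul, map_smul, ← hx, hDp]
  simp only [lp.coeFn_smul, Pi.smul_apply, smul_eq_mul]
  module

end IsBlockDiagonal

namespace IsBlockDiagonalisation

variable {R : L2 ι →L[ℝ] L2 ι} {T : L2 ι ≃L[ℝ] L2 ι}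

theorem symm_mem_block (h : IsBlockDiagonalisation lam R T D) {ν : ℝ}
    (hν : |(k : ℝ) - ν| < 1 / 2) (hw : T.symm w ∈ block lam k)
    (hx : DiagAddMaps lam R x (w + ν • x)) : T.symm x ∈ block lam k := by
  refine h.isBlockDiagonal.mem_block_of_maps h.norm_lt hν hw (h.maps_iff.1 ?_)
  simpa using hx

theorem symm_mem_block_of_eigenvector (h : IsBlockDiagonalisation lam R T D) {ν : ℝ}
    (hν : |(k : ℝ) - ν| < 1 / 2) (hx : DiagAddMaps lam R x (ν • x)) : T.symm x ∈ block lam k :=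
  h.symm_mem_block hν (w := 0) (by simp) (by rwa [zero_add])

theorem maps_symm (h : IsBlockDiagonalisation lam R T D) (hx : DiagAddMaps lam R x z) :
    DiagAddMaps lam D (T.symm x) (T.symm z) :=
  h.maps_iff.1 (by simpa using hx)

theorem maps_of_mem_block (h : IsBlockDiagonalisation lam R T D) (hy : y ∈ block lam k) {t : ℝ}
    (hDy : D y = t • y) : DiagAddMaps lam R (T y) (((k : ℝ) + t) • T y) := by
  rw [← map_smul, add_smul, ← hDy]
  exact h.maps_iff.2 (diagAddMaps_of_mem_block hy)

theorem maps_basisVec (h : IsBlockDiagonalisation lam R T D) {i : ι}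
    (hi : ∀ j, lam j = lam i → j = i) :
    DiagAddMaps lam R (T (basisVec i)) ((lam i + D (basisVec i) i) • T (basisVec i)) :=
  h.maps_of_mem_block (basisVec_mem_block i)
    (eq_smul_basisVec_of_mem_block hi (h.isBlockDiagonal.map_mem_block (basisVec_mem_block i)))

theorem abs_lt_of_apply_eq_smul (h : IsBlockDiagonalisation lam R T D) {t : ℝ} (hy0 : y ≠ 0)
    (hDy : D y = t • y) : |t| < 1 / 2 := by
  have hle := D.le_opNorm y
  rw [hDy, norm_smul, Real.norm_eq_abs] at hle
  exact (le_of_mul_le_mul_right hle (norm_pos_iff.2 hy0)).trans_lt h.norm_lt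

theorem abs_apply_basisVec_lt (h : IsBlockDiagonalisation lam R T D) (i j : ι) :
    |D (basisVec i) j| < 1 / 2 := by
  refine ((abs_apply_le_norm _ j).trans (D.le_opNorm _)).trans_lt ?_
  rw [norm_basisVec, mul_one]
  exact h.norm_lt

theorem exists_trace_eigenvector (h : IsBlockDiagonalisation lam R T D) {p q : ι} (hpq : p ≠ q)
    (hk : ∀ j, lam j = k ↔ j = p ∨ j = q) (hx0 : x ≠ 0)
    (hx : DiagAddMaps lam R x ((k : ℝ) • x))
    (ht : D (basisVec p) p + D (basisVec q) q ≠ 0) :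
    |D (basisVec p) p + D (basisVec q) q| < 1 / 2 ∧ ∃ x' ≠ 0, DiagAddMaps lam R x'
      ((k + (D (basisVec p) p + D (basisVec q) q)) • x') := by
  have hblock : T.symm x ∈ block lam k := h.symm_mem_block_of_eigenvector (by norm_num) hx
  have hker : D (T.symm x) = 0 := by
    rw [(h.maps_symm hx).apply_eq_of_mem_block hblock, map_smul, sub_self]
  obtain ⟨y, hy, hy0, hDy⟩ := h.isBlockDiagonal.exists_trace_eigenvector hpq hk hblock
    (by simpa using hx0) hker ht
  exact ⟨h.abs_lt_of_apply_eq_smul hy0 hDy, T y, by simpa using hy0, h.maps_of_mem_block hy hDy⟩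

end IsBlockDiagonalisation

end Block

/-! ### Modes of the unperturbed problem -/

section Modes

/-- Labels of the eigenvalues of the problem at `ε = 0`: the positive ones, the negative ones, and
the two-dimensional kernel. -/
abbrev Mode := ℕ ⊕ ℕ ⊕ Fin 2

/-- The Hermite function carrying a mode at `ε = 0`. The positive eigenvalue `1` is carried both by
`φ₀` and by `φ₂`. -/
def level : Mode → ℕ
  | .inl 0 => 0
  | .inl (m + 1) => m + 2
  | .inr (.inl 0) => 0
  | .inr (.inl (m + 1)) => m + 2
  | .inr (.inr _) => 1

/-- The sign relating the components of an unperturbed mode, which is proportional to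
`[φ, modeSign • φ]` with `φ` the Hermite function of its level. -/
def modeSign : Mode → ℤ
  | .inl 0 => -1
  | .inl (_ + 1) => 1
  | .inr (.inl 0) => 1
  | .inr (.inl (_ + 1)) => -1
  | .inr (.inr 0) => 1
  | .inr (.inr 1) => -1

/-- The unperturbed eigenvalue of a mode. -/
def freq (i : Mode) : ℤ := modeSign i * (level i - 1)

theorem modeSign_mul_self (i : Mode) : modeSign i * modeSign i = 1 := by
  rcases i with (_ | m) | (_ | m) | i
  iterate 4 rfl
  fin_cases i <;> rfl

theorem freq_inl (m : ℕ) : freq (.inl m) = max 1 (m : ℤ) := by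
  cases m with
  | zero => rfl
  | succ m => simp [freq, modeSign, level]; omega

theorem freq_inr_inl (m : ℕ) : freq (.inr (.inl m)) = -max 1 (m : ℤ) := by
  cases m with
  | zero => rfl
  | succ m => simp [freq, modeSign, level]; omega

theorem freq_inr_inr (i : Fin 2) : freq (.inr (.inr i)) = 0 := by
  simp [freq, level]

theorem freq_eq_zero_iff {i : Mode} : freq i = 0 ↔ i = .inr (.inr 0) ∨ i = .inr (.inr 1) := by
  rcases i with m | m | i
  · simp [freq_inl]; omega
  · simp [freq_inr_inl]; omega
  · fin_cases i <;> simp [freq_inr_inr]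

theorem freq_eq_one_iff {i : Mode} : freq i = 1 ↔ i = .inl 0 ∨ i = .inl 1 := by
  rcases i with m | m | i
  · simp [freq_inl]; omega
  · simp [freq_inr_inl]; omega
  · simp [freq_inr_inr]

/-- The modes whose unperturbed eigenvalue is not simple. -/
def degenerateModes : Finset Mode :=
  {.inl 0, .inl 1, .inr (.inl 0), .inr (.inl 1), .inr (.inr 0), .inr (.inr 1)}

theorem eq_of_freq_eq {i j : Mode} (hi : i ∉ degenerateModes) (hij : freq j = freq i) :
    j = i := by
  simp only [degenerateModes, Finset.mem_insert, Finset.mem_singleton, not_or] at hi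
  rcases i with m | m | i
  · rcases j with k | k | j <;> simp [freq_inl, freq_inr_inl, freq_inr_inr] at hi hij ⊢ <;> omega
  · rcases j with k | k | j <;> simp [freq_inl, freq_inr_inl, freq_inr_inr] at hi hij ⊢ <;> omega
  · fin_cases i <;> simp at hi

end Modes

section ModeSystem

variable {R D : L2 Mode →L[ℝ] L2 Mode} {T : L2 Mode ≃L[ℝ] L2 Mode} {Ω : ℕ → ℝ} {v : Mode → L2 Mode}

/-- A system of eigenvectors and generalised kernel vectors of `diag(freq) + R`, labelled by the
modes from which they bifurcate. -/
structure IsModeSystem (R : L2 Mode →L[ℝ] L2 Mode) (Ω : ℕ → ℝ) (v : Mode → L2 Mode) : Prop where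
  ne_zero : ∀ i, v i ≠ 0
  close : ∀ m, |(freq (.inl m) : ℝ) - Ω m| < 1 / 2
  distinct : Ω 0 ≠ Ω 1
  pos : ∀ m, DiagAddMaps freq R (v (.inl m)) (Ω m • v (.inl m))
  neg : ∀ m, DiagAddMaps freq R (v (.inr (.inl m))) ((-Ω m) • v (.inr (.inl m)))
  ker : DiagAddMaps freq R (v (.inr (.inr 0))) 0
  gen_ker : DiagAddMaps freq R (v (.inr (.inr 1))) (v (.inr (.inr 0)))

namespace IsModeSystem

theorem eigenvalue_pos (hv : IsModeSystem R Ω v) (m : ℕ) : 0 < Ω m := by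
  have hclose := (abs_lt.1 (hv.close m)).2
  have hfreq : (1 : ℝ) ≤ freq (.inl m) := by
    rw [freq_inl]
    exact_mod_cast le_max_left _ _
  linarith

theorem freq_eq_of_eigenvalue_eq (hv : IsModeSystem R Ω v) {m k : ℕ} (h : Ω m = Ω k) :
    freq (.inl m) = freq (.inl k) := by
  refine sub_eq_zero.1 (Int.abs_lt_one_iff.1 ?_)
  have hm := hv.close m
  have hk := hv.close k
  rw [h] at hm
  rw [abs_sub_comm] at hk
  have htri := abs_sub_le (freq (.inl m) : ℝ) (Ω k) (freq (.inl k))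
  exact_mod_cast (by linarith : |(freq (.inl m) : ℝ) - freq (.inl k)| < 1)

theorem injective (hv : IsModeSystem R Ω v) : Function.Injective Ω := by
  intro m k h
  have hmax := hv.freq_eq_of_eigenvalue_eq h
  rw [freq_inl, freq_inl] at hmax
  rcases (by omega : m = k ∨ m = 0 ∧ k = 1 ∨ m = 1 ∧ k = 0) with hmk | ⟨rfl, rfl⟩ | ⟨rfl, rfl⟩
  · exact hmk
  · exact (hv.distinct h).elim
  · exact (hv.distinct h.symm).elim

theorem symm_mem_block (hv : IsModeSystem R Ω v) (h : IsBlockDiagonalisation freq R T D)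
    (i : Mode) : T.symm (v i) ∈ block freq (freq i) := by
  have hker : T.symm (v (.inr (.inr 0))) ∈ block freq 0 :=
    h.symm_mem_block_of_eigenvector (ν := 0) (by norm_num) (by simpa using hv.ker)
  match i with
  | .inl m => exact h.symm_mem_block_of_eigenvector (hv.close m) (hv.pos m)
  | .inr (.inl m) =>
    refine h.symm_mem_block_of_eigenvector ?_ (hv.neg m)
    rw [freq_inr_inl, ← freq_inl, Int.cast_neg, ← neg_sub', abs_neg]
    exact hv.close m
  | .inr (.inr 0) => exact hker
  | .inr (.inr 1) =>
    exact h.symm_mem_block (ν := 0) (w := v (.inr (.inr 0))) (by norm_num [freq_inr_inr])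
      (by rwa [freq_inr_inr]) (by simpa using hv.gen_ker)

theorem linearIndepOn_symm (hv : IsModeSystem R Ω v) (h : IsBlockDiagonalisation freq R T D)
    {k : ℤ} (hk : k ≠ 0) : LinearIndepOn ℝ (fun i => T.symm (v i)) {i | freq i = k} := by
  let energy : Mode → ℝ := Sum.elim Ω (Sum.elim (fun m => -Ω m) 0)
  refine linearIndepOn_of_diagAddMaps (D := D) (E := energy) (k := k) ?_
    (fun i hi => hi ▸ hv.symm_mem_block h i) (fun i _ => by simpa using hv.ne_zero i) ?_
  · rintro (m | m | i) hi (l | l | j) hj hE <;>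
      simp only [Set.mem_ofPred_eq, freq_inl, freq_inr_inl, freq_inr_inr] at hi hj <;>
      first
        | omega
        | simpa [energy, hv.injective.eq_iff] using hE
  · rintro (m | m | i) hi <;> rw [← map_smul]
    · exact h.maps_symm (hv.pos m)
    · exact h.maps_symm (hv.neg m)
    · exact (hk (hi.symm.trans (freq_inr_inr i))).elim

theorem linearIndepOn_symm_ker (hv : IsModeSystem R Ω v) (h : IsBlockDiagonalisation freq R T D) :
    LinearIndepOn ℝ (fun i => T.symm (v i)) {i | freq i = 0} := by
  have hset : {i | freq i = 0} = {.inr (.inr 0), .inr (.inr 1)} := Set.ext fun _ =>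
    freq_eq_zero_iff
  have hker : D (T.symm (v (.inr (.inr 0)))) = 0 := by
    rw [(h.maps_symm hv.ker).apply_eq_of_mem_block (hv.symm_mem_block h _), freq_inr_inr]
    simp
  have hgen : D (T.symm (v (.inr (.inr 1)))) = T.symm (v (.inr (.inr 0))) := by
    rw [(h.maps_symm hv.gen_ker).apply_eq_of_mem_block (hv.symm_mem_block h _), freq_inr_inr]
    simp
  rw [hset, LinearIndepOn.pair_iff _ (by simp)]
  intro s t hst
  have hDst := congrArg D hst
  simp only [map_add, map_smul, hker, hgen, smul_zero, zero_add, map_zero] at hDst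
  have ht : t = 0 := by simpa [hv.ne_zero] using hDst
  exact ⟨by simpa [ht, hv.ne_zero] using hst, ht⟩

theorem isScaledRieszBasis (hv : IsModeSystem R Ω v) (h : IsBlockDiagonalisation freq R T D) :
    IsScaledRieszBasis v := by
  have hbasis := isScaledRieszBasis_of_mem_block degenerateModes
    (fun _ hi _ hij => eq_of_freq_eq hi hij) (hv.symm_mem_block h) fun k => by
      rcases eq_or_ne k 0 with rfl | hk
      · exact hv.linearIndepOn_symm_ker h
      · exact hv.linearIndepOn_symm h hk
  simpa using hbasis.map T

end IsModeSystem

/-- The perturbation is singular on the block of the degenerate eigenvalue `1`, since `1` remains an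
eigenvalue; hence its other eigenvalue there is its trace. -/
theorem exists_positive_modes (h : IsBlockDiagonalisation freq R T D) {x : L2 Mode} (hx0 : x ≠ 0)
    (hx : DiagAddMaps freq R x ((1 : ℝ) • x))
    (ht : D (basisVec (.inl 0)) (.inl 0) + D (basisVec (.inl 1)) (.inl 1) ≠ 0) :
    ∃ (Ω : ℕ → ℝ) (u : ℕ → L2 Mode), Ω 0 ≠ Ω 1 ∧ ∀ m, u m ≠ 0 ∧
      DiagAddMaps freq R (u m) (Ω m • u m) ∧ |(freq (.inl m) : ℝ) - Ω m| < 1 / 2 := by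
  obtain ⟨hsmall, x', hx'0, hx'⟩ := h.exists_trace_eigenvector (k := 1) (p := .inl 0)
    (q := .inl 1) (by simp) (fun _ => freq_eq_one_iff) hx0 (by simpa using hx) ht
  set t := D (basisVec (.inl 0)) (.inl 0) + D (basisVec (.inl 1)) (.inl 1)
  let Ω : ℕ → ℝ
    | 0 => 1
    | 1 => 1 + t
    | m + 2 => freq (.inl (m + 2)) + D (basisVec (.inl (m + 2))) (.inl (m + 2))
  let u : ℕ → L2 Mode
    | 0 => x
    | 1 => x'
    | m + 2 => T (basisVec (.inl (m + 2)))
  refine ⟨Ω, u, by simpa [Ω] using ht, fun m => ?_⟩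
  match m with
  | 0 => exact ⟨hx0, hx, by norm_num [Ω, freq_inl]⟩
  | 1 => exact ⟨hx'0, by simpa [Ω, u] using hx', by simpa [Ω, freq_inl] using hsmall⟩
  | m + 2 =>
    refine ⟨?_, h.maps_basisVec fun _ => eq_of_freq_eq (by simp [degenerateModes]), ?_⟩
    · refine T.map_ne_zero_iff.2 (norm_ne_zero_iff.1 ?_)
      rw [norm_basisVec]
      exact one_ne_zero
    · simpa [Ω] using h.abs_apply_basisVec_lt (.inl (m + 2)) (.inl (m + 2))

end ModeSystem

/-! ### Hermite functions -/

section Hermite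

open MeasureTheory Polynomial

theorem derivative_hermite (n : ℕ) : derivative (hermite n) = n * hermite (n - 1) := by
  induction n with
  | zero => simp
  | succ n ih =>
    cases n with
    | zero => simp
    | succ n =>
      rw [hermite_succ, derivative_sub, derivative_mul, ih, derivative_mul, derivative_X,
        derivative_natCast, Nat.add_sub_cancel, Nat.add_sub_cancel, hermite_succ n]
      push_cast
      ring

theorem aeval_hermite_succ (n : ℕ) (x : ℝ) :
    aeval x (hermite (n + 1)) = x * aeval x (hermite n) - n * aeval x (hermite (n - 1)) := by
  rw [hermite_succ, derivative_hermite]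
  simp

/-- The matrix elements `√(n/2)` of position and derivative in the Hermite basis. -/
noncomputable def ladderCoeff (n : ℕ) : ℝ := √((n : ℝ) / 2)

@[simp] theorem ladderCoeff_zero : ladderCoeff 0 = 0 := by simp [ladderCoeff]

theorem ladderCoeff_sq (n : ℕ) : ladderCoeff n ^ 2 = n / 2 := Real.sq_sqrt (by positivity)

theorem ladderCoeff_succ_pos (n : ℕ) : 0 < ladderCoeff (n + 1) := Real.sqrt_pos.2 (by positivity)

/-- The normalising constant of the Hermite functions relative to the probabilists' Hermite
polynomials. -/
noncomputable def hermiteNormConst (n : ℕ) : ℝ := (√((n.factorial : ℝ) * √Real.pi))⁻¹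

theorem hermiteFun_eq (n : ℕ) (x : ℝ) : hermiteFun n x =
    hermiteNormConst n * aeval (√2 * x) (hermite n) * Real.exp (-x ^ 2 / 2) := by
  have hpow : √((2 : ℝ) ^ n) = √2 ^ n := by
    rw [Real.sqrt_eq_iff_mul_self_eq (by positivity) (by positivity), ← mul_pow,
      Real.mul_self_sqrt zero_le_two]
  have hconst : √((n.factorial : ℝ) * √Real.pi) ≠ 0 :=
    (Real.sqrt_pos.2 (mul_pos (by positivity) (Real.sqrt_pos.2 Real.pi_pos))).ne'
  rw [hermiteFun, physHermite, mul_assoc ((2 : ℝ) ^ n),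
    Real.sqrt_mul (by positivity : (0 : ℝ) ≤ 2 ^ n), hpow, hermiteNormConst]
  field_simp

theorem hermiteNormConst_eq (n : ℕ) :
    hermiteNormConst n = √2 * ladderCoeff (n + 1) * hermiteNormConst (n + 1) := by
  have hsqrt : √2 * ladderCoeff (n + 1) = √((n : ℝ) + 1) := by
    rw [ladderCoeff, ← Real.sqrt_mul zero_le_two]
    congr 1
    push_cast
    ring
  have hpos : √((n : ℝ) + 1) ≠ 0 := by positivity
  rw [hsqrt, hermiteNormConst, hermiteNormConst, Nat.factorial_succ, Nat.cast_mul, mul_assoc,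
    Nat.cast_succ, Real.sqrt_mul (by positivity : (0 : ℝ) ≤ n + 1), mul_inv,
    mul_inv_cancel_left₀ hpos]

theorem two_mul_ladderCoeff_mul_hermiteNormConst_pred (n : ℕ) :
    2 * ladderCoeff n * hermiteNormConst (n - 1) = √2 * n * hermiteNormConst n := by
  cases n with
  | zero => simp
  | succ n =>
    rw [Nat.add_sub_cancel, hermiteNormConst_eq]
    linear_combination 2 * √2 * hermiteNormConst (n + 1) * ladderCoeff_sq (n + 1)

theorem mul_hermiteFun (n : ℕ) (x : ℝ) : x * hermiteFun n x =
    ladderCoeff n * hermiteFun (n - 1) x + ladderCoeff (n + 1) * hermiteFun (n + 1) x := by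
  simp only [hermiteFun_eq, aeval_hermite_succ]
  set H := aeval (√2 * x) (hermite n)
  set G := aeval (√2 * x) (hermite (n - 1))
  set E := Real.exp (-x ^ 2 / 2)
  linear_combination (x * H * E - 1 / 2 * G * E * n * √2) * hermiteNormConst_eq n -
    1 / 2 * G * E * two_mul_ladderCoeff_mul_hermiteNormConst_pred n -
    1 / 2 * G * E * n * ladderCoeff (n + 1) * hermiteNormConst (n + 1) *
      Real.mul_self_sqrt zero_le_two

theorem hasDerivAt_hermiteFun (n : ℕ) (x : ℝ) : HasDerivAt (hermiteFun n)
    (ladderCoeff n * hermiteFun (n - 1) x - ladderCoeff (n + 1) * hermiteFun (n + 1) x) x := by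
  have hpoly : HasDerivAt (fun y : ℝ => aeval (√2 * y) (hermite n))
      (aeval (√2 * x) (derivative (hermite n)) * √2) x :=
    ((hermite n).hasDerivAt_aeval (√2 * x)).comp x (by
      simpa using (hasDerivAt_id x).const_mul √2)
  have hexp : HasDerivAt (fun y : ℝ => Real.exp (-y ^ 2 / 2)) (Real.exp (-x ^ 2 / 2) * (-x)) x := by
    refine HasDerivAt.exp ((((hasDerivAt_pow 2 x).neg).div_const 2).congr_deriv ?_)
    simp
    ring
  rw [funext (hermiteFun_eq n)]
  refine ((hpoly.const_mul (hermiteNormConst n)).mul hexp).congr_deriv ?_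
  have hmul := mul_hermiteFun n x
  simp only [derivative_hermite, map_mul, map_natCast, hermiteFun_eq] at hmul ⊢
  linear_combination -hmul - aeval (√2 * x) (hermite (n - 1)) * Real.exp (-x ^ 2 / 2) *
    two_mul_ladderCoeff_mul_hermiteNormConst_pred n

theorem continuous_hermiteFun (n : ℕ) : Continuous (hermiteFun n) :=
  continuous_iff_continuousAt.2 fun x => (hasDerivAt_hermiteFun n x).continuousAt

theorem hermiteFun_zero (x : ℝ) : hermiteFun 0 x = (√√Real.pi)⁻¹ * Real.exp (-x ^ 2 / 2) := by
  simp [hermiteFun_eq, hermiteNormConst]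

theorem integrable_eval_mul_exp (P : ℝ[X]) {b : ℝ} (hb : 0 < b) :
    Integrable fun x : ℝ => P.eval x * Real.exp (-b * x ^ 2) := by
  simp_rw [eval_eq_sum_range, Finset.sum_mul]
  refine integrable_finsetSum _ fun k _ => ?_
  have hmonomial := (integrable_rpow_mul_exp_neg_mul_sq hb (s := k)
    (neg_one_lt_zero.trans_le (Nat.cast_nonneg k))).const_mul (P.coeff k)
  simpa [Real.rpow_natCast, mul_assoc] using hmonomial

theorem exp_neg_sq_half_mul_self (x : ℝ) :
    Real.exp (-x ^ 2 / 2) * Real.exp (-x ^ 2 / 2) = Real.exp (-1 * x ^ 2) := by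
  rw [← Real.exp_add]
  ring_nf

theorem exists_hermiteFun_eq_eval (n : ℕ) : ∃ P : ℝ[X], ∀ x,
    hermiteFun n x = P.eval x * Real.exp (-x ^ 2 / 2) := by
  refine ⟨C (hermiteNormConst n) * ((hermite n).map (Int.castRingHom ℝ)).comp (C √2 * X),
    fun x => ?_⟩
  rw [hermiteFun_eq]
  simp [aeval_def, eval_map]

theorem integrable_hermiteFun_mul (n m : ℕ) :
    Integrable fun x => hermiteFun n x * hermiteFun m x := by
  obtain ⟨P, hP⟩ := exists_hermiteFun_eq_eval n
  obtain ⟨Q, hQ⟩ := exists_hermiteFun_eq_eval m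
  convert! integrable_eval_mul_exp (P * Q) one_pos using 2 with x
  rw [hP, hQ, eval_mul, ← exp_neg_sq_half_mul_self]
  ring

theorem integral_deriv_mul_hermiteFun (m n : ℕ) :
    ladderCoeff m * (∫ x, hermiteFun (m - 1) x * hermiteFun n x) -
      ladderCoeff (m + 1) * (∫ x, hermiteFun (m + 1) x * hermiteFun n x) +
      (ladderCoeff n * (∫ x, hermiteFun m x * hermiteFun (n - 1) x) -
      ladderCoeff (n + 1) * (∫ x, hermiteFun m x * hermiteFun (n + 1) x)) = 0 := by
  have hInt (c : ℝ) (k l : ℕ) := (integrable_hermiteFun_mul k l).const_mul c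
  have hleft := (hInt (ladderCoeff m) (m - 1) n).sub (hInt (ladderCoeff (m + 1)) (m + 1) n)
  have hright := (hInt (ladderCoeff n) m (n - 1)).sub (hInt (ladderCoeff (n + 1)) m (n + 1))
  have hparts := integral_eq_zero_of_hasDerivAt_of_integrable
    (fun x => (hasDerivAt_hermiteFun m x).mul (hasDerivAt_hermiteFun n x))
    ((hleft.add hright).congr (.of_forall fun x => by
      simp only [Pi.add_apply, Pi.sub_apply]
      ring))
    (integrable_hermiteFun_mul m n)
  rw [← hparts]
  simp only [← integral_const_mul]
  rw [← integral_sub (hInt _ _ _) (hInt _ _ _), ← integral_sub (hInt _ _ _) (hInt _ _ _)]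
  refine (integral_add hleft hright).symm.trans (integral_congr_ae (.of_forall fun x => ?_))
  simp only [Pi.sub_apply]
  ring

theorem integral_mul_hermiteFun_comm (m n : ℕ) :
    ladderCoeff m * (∫ x, hermiteFun (m - 1) x * hermiteFun n x) +
      ladderCoeff (m + 1) * (∫ x, hermiteFun (m + 1) x * hermiteFun n x) =
      ladderCoeff n * (∫ x, hermiteFun m x * hermiteFun (n - 1) x) +
      ladderCoeff (n + 1) * (∫ x, hermiteFun m x * hermiteFun (n + 1) x) := by
  have hInt (c : ℝ) (k l : ℕ) := (integrable_hermiteFun_mul k l).const_mul c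
  simp only [← integral_const_mul]
  rw [← integral_add (hInt _ _ _) (hInt _ _ _), ← integral_add (hInt _ _ _) (hInt _ _ _)]
  refine integral_congr_ae (.of_forall fun x => ?_)
  dsimp only
  linear_combination hermiteFun m x * mul_hermiteFun n x - hermiteFun n x * mul_hermiteFun m x

theorem ladderCoeff_mul_integral_pred (m n : ℕ) :
    ladderCoeff m * (∫ x, hermiteFun (m - 1) x * hermiteFun n x) =
      ladderCoeff (n + 1) * (∫ x, hermiteFun m x * hermiteFun (n + 1) x) := by
  linarith [integral_deriv_mul_hermiteFun m n, integral_mul_hermiteFun_comm m n]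

theorem integral_hermiteFun_zero_mul_self : ∫ x, hermiteFun 0 x * hermiteFun 0 x = 1 := by
  have hsq (x : ℝ) : hermiteFun 0 x * hermiteFun 0 x = (√Real.pi)⁻¹ * Real.exp (-1 * x ^ 2) := by
    rw [hermiteFun_zero, mul_mul_mul_comm, ← mul_inv, Real.mul_self_sqrt (Real.sqrt_nonneg _),
      exp_neg_sq_half_mul_self]
  simp_rw [hsq]
  rw [integral_const_mul, integral_gaussian, div_one,
    inv_mul_cancel₀ (Real.sqrt_pos.2 Real.pi_pos).ne']

theorem integral_hermiteFun_mul (m n : ℕ) :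
    ∫ x, hermiteFun m x * hermiteFun n x = if m = n then 1 else 0 := by
  have hzero (n : ℕ) : ∫ x, hermiteFun 0 x * hermiteFun (n + 1) x = 0 := by
    have hlad := ladderCoeff_mul_integral_pred 0 n
    rw [ladderCoeff_zero, zero_mul] at hlad
    exact (mul_eq_zero.1 hlad.symm).resolve_left (ladderCoeff_succ_pos n).ne'
  induction m generalizing n with
  | zero =>
    cases n with
    | zero => exact integral_hermiteFun_zero_mul_self
    | succ n => simp [hzero]
  | succ m ih =>
    cases n with
    | zero =>
      simp_rw [mul_comm (hermiteFun (m + 1) _)]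
      simp [hzero]
    | succ n =>
      have hlad := ladderCoeff_mul_integral_pred (m + 1) n
      refine mul_left_cancel₀ (ladderCoeff_succ_pos n).ne' (hlad.symm.trans ?_)
      rw [Nat.add_sub_cancel, ih n]
      rcases eq_or_ne m n with rfl | hmn
      · simp
      · simp [hmn]

theorem integrable_sum_hermiteFun_mul_sum {s t : Finset ℕ} (a b : ℕ → ℝ) (f g : ℕ → ℕ) :
    Integrable fun x =>
      (∑ n ∈ s, a n * hermiteFun (f n) x) * ∑ m ∈ t, b m * hermiteFun (g m) x := by
  simp_rw [Finset.sum_mul_sum, mul_mul_mul_comm]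
  exact integrable_finsetSum _ fun _ _ => integrable_finsetSum _ fun _ _ =>
    (integrable_hermiteFun_mul _ _).const_mul _

theorem integrable_sum_hermiteFun_sq {s : Finset ℕ} (a : ℕ → ℝ) (f : ℕ → ℕ) :
    Integrable fun x => (∑ n ∈ s, a n * hermiteFun (f n) x) ^ 2 := by
  simpa only [sq] using integrable_sum_hermiteFun_mul_sum a a f f

theorem integral_sum_hermiteFun_sq {s : Finset ℕ} {a : ℕ → ℝ} {f : ℕ → ℕ}
    (hf : ∀ n m, a n ≠ 0 → a m ≠ 0 → f n = f m → n = m) :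
    ∫ x, (∑ n ∈ s, a n * hermiteFun (f n) x) ^ 2 = ∑ n ∈ s, a n ^ 2 := by
  have hintegral (n m : ℕ) : Integrable fun x =>
      a n * a m * (hermiteFun (f n) x * hermiteFun (f m) x) :=
    (integrable_hermiteFun_mul _ _).const_mul _
  simp_rw [sq (Finset.sum s _), Finset.sum_mul_sum, mul_mul_mul_comm]
  rw [integral_finsetSum _ fun _ _ => integrable_finsetSum _ fun _ _ => hintegral _ _]
  refine Finset.sum_congr rfl fun n hn => ?_
  rw [integral_finsetSum _ fun _ _ => hintegral _ _]
  simp_rw [integral_const_mul, integral_hermiteFun_mul]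
  rw [Finset.sum_eq_single_of_mem n hn, if_pos rfl, mul_one, sq]
  intro m _ hmn
  rcases eq_or_ne (a n) 0 with han | han
  · rw [han, zero_mul, zero_mul]
  rcases eq_or_ne (a m) 0 with ham | ham
  · rw [ham, mul_zero, zero_mul]
  · rw [if_neg fun h => hmn (hf n m han ham h).symm, mul_zero]

theorem sq_le_integral_sq_add_integral_deriv_sq {u u' : ℝ → ℝ} (hu : ∀ x, HasDerivAt u (u' x) x)
    (hu_sq : Integrable fun x => u x ^ 2) (hu'_sq : Integrable fun x => u' x ^ 2)
    (huu' : Integrable fun x => u x * u' x) (x : ℝ) :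
    u x ^ 2 ≤ (∫ x, u x ^ 2) + ∫ x, u' x ^ 2 := by
  have hderiv (y : ℝ) : HasDerivAt (fun y => u y ^ 2) (2 * (u y * u' y)) y := by
    refine ((hu y).pow 2).congr_deriv ?_
    simp
    ring
  have hintegral := (huu'.const_mul 2).integrableOn (s := Set.Iic x)
  have hlim := tendsto_zero_of_hasDerivAt_of_integrableOn_Iic (a := x) (fun y _ => hderiv y)
    hintegral hu_sq.integrableOn
  have hftc := integral_Iic_of_hasDerivAt_of_tendsto' (a := x) (fun y _ => hderiv y) hintegral hlim
  rw [sub_zero] at hftc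
  calc u x ^ 2 = ∫ y in Set.Iic x, 2 * (u y * u' y) := hftc.symm
    _ ≤ ∫ y in Set.Iic x, (u y ^ 2 + u' y ^ 2) :=
        setIntegral_mono hintegral (hu_sq.add hu'_sq).integrableOn fun y => by
          linarith [two_mul_le_add_sq (u y) (u' y)]
    _ ≤ ∫ y, (u y ^ 2 + u' y ^ 2) :=
        setIntegral_le_integral (hu_sq.add hu'_sq) (.of_forall fun y => by
          simp only [Pi.zero_apply]
          positivity)
    _ = (∫ x, u x ^ 2) + ∫ x, u' x ^ 2 := integral_add hu_sq hu'_sq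

theorem hasDerivAt_sum_hermiteFun (s : Finset ℕ) (a : ℕ → ℝ) (x : ℝ) :
    HasDerivAt (fun x => ∑ n ∈ s, a n * hermiteFun n x)
      ((∑ n ∈ s, (a n * ladderCoeff n) * hermiteFun (n - 1) x) -
        ∑ n ∈ s, (a n * ladderCoeff (n + 1)) * hermiteFun (n + 1) x) x := by
  refine (HasDerivAt.fun_sum fun n _ => (hasDerivAt_hermiteFun n x).const_mul (a n)).congr_deriv ?_
  rw [← Finset.sum_sub_distrib]
  exact Finset.sum_congr rfl fun n _ => by ring

theorem integrable_deriv_sum_hermiteFun_sq (s : Finset ℕ) (a : ℕ → ℝ) :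
    Integrable fun x => ((∑ n ∈ s, (a n * ladderCoeff n) * hermiteFun (n - 1) x) -
        ∑ n ∈ s, (a n * ladderCoeff (n + 1)) * hermiteFun (n + 1) x) ^ 2 := by
  simp_rw [sub_sq, mul_assoc (2 : ℝ)]
  exact ((integrable_sum_hermiteFun_sq _ _).sub
    ((integrable_sum_hermiteFun_mul_sum _ _ _ _).const_mul 2)).add
      (integrable_sum_hermiteFun_sq _ _)

theorem integral_deriv_sum_hermiteFun_sq_le (s : Finset ℕ) (a : ℕ → ℝ) :
    ∫ x, ((∑ n ∈ s, (a n * ladderCoeff n) * hermiteFun (n - 1) x) -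
        ∑ n ∈ s, (a n * ladderCoeff (n + 1)) * hermiteFun (n + 1) x) ^ 2 ≤
      ∑ n ∈ s, (2 * (n : ℝ) + 1) * a n ^ 2 := by
  have hlow := (integrable_sum_hermiteFun_sq (s := s) (fun n => a n * ladderCoeff n)
    fun n => n - 1).const_mul 2
  have hraise := (integrable_sum_hermiteFun_sq (s := s) (fun n => a n * ladderCoeff (n + 1))
    fun n => n + 1).const_mul 2
  refine (integral_mono (integrable_deriv_sum_hermiteFun_sq s a) (hlow.add hraise)
    fun x => ?_).trans_eq ?_
  · simp only [Pi.add_apply]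
    have hparallelogram (p q : ℝ) : (p - q) ^ 2 ≤ 2 * p ^ 2 + 2 * q ^ 2 := by
      linarith [sq_nonneg (p + q)]
    exact hparallelogram _ _
  · rw [integral_add' hlow hraise, integral_const_mul, integral_const_mul,
      integral_sum_hermiteFun_sq, integral_sum_hermiteFun_sq, Finset.mul_sum, Finset.mul_sum,
      ← Finset.sum_add_distrib]
    · refine Finset.sum_congr rfl fun n _ => ?_
      rw [mul_pow, mul_pow, ladderCoeff_sq, ladderCoeff_sq]
      push_cast
      ring
    · exact fun n m _ _ hnm => Nat.succ_injective hnm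
    · rintro (_ | n) (_ | m) hn hm hnm
      · rfl
      · simp at hn
      · simp at hm
      · exact congrArg Nat.succ hnm

theorem sum_hermiteFun_sq_le (s : Finset ℕ) (a : ℕ → ℝ) (x : ℝ) :
    (∑ n ∈ s, a n * hermiteFun n x) ^ 2 ≤ 2 * ∑ n ∈ s, (1 + (n : ℝ)) * a n ^ 2 := by
  have hcross : Integrable fun x => (∑ n ∈ s, a n * hermiteFun n x) *
      ((∑ n ∈ s, (a n * ladderCoeff n) * hermiteFun (n - 1) x) -
        ∑ n ∈ s, (a n * ladderCoeff (n + 1)) * hermiteFun (n + 1) x) := by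
    simp_rw [mul_sub]
    exact (integrable_sum_hermiteFun_mul_sum a _ id _).sub
      (integrable_sum_hermiteFun_mul_sum a _ id _)
  calc (∑ n ∈ s, a n * hermiteFun n x) ^ 2
      ≤ _ := sq_le_integral_sq_add_integral_deriv_sq (hasDerivAt_sum_hermiteFun s a)
        (integrable_sum_hermiteFun_sq a id) (integrable_deriv_sum_hermiteFun_sq s a) hcross x
    _ ≤ ∑ n ∈ s, a n ^ 2 + ∑ n ∈ s, (2 * (n : ℝ) + 1) * a n ^ 2 :=
        add_le_add (integral_sum_hermiteFun_sq (f := id) fun _ _ _ _ h => h).le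
          (integral_deriv_sum_hermiteFun_sq_le s a)
    _ = 2 * ∑ n ∈ s, (1 + (n : ℝ)) * a n ^ 2 := by
        rw [← Finset.sum_add_distrib, Finset.mul_sum]
        exact Finset.sum_congr rfl fun n _ => by ring

theorem sum_hermiteFun_sq_div_le (s : Finset ℕ) (x : ℝ) :
    ∑ n ∈ s, ((√(1 + (n : ℝ)))⁻¹ * hermiteFun n x) ^ 2 ≤ 2 := by
  set k := ∑ n ∈ s, ((√(1 + (n : ℝ)))⁻¹ * hermiteFun n x) ^ 2
  have hweight (n : ℕ) : (√(1 + (n : ℝ)))⁻¹ ^ 2 = (1 + (n : ℝ))⁻¹ := by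
    rw [inv_pow, Real.sq_sqrt (by positivity)]
  have hembed := sum_hermiteFun_sq_le s (fun n => (1 + (n : ℝ))⁻¹ * hermiteFun n x) x
  have hvalue : ∑ n ∈ s, (1 + (n : ℝ))⁻¹ * hermiteFun n x * hermiteFun n x = k :=
    Finset.sum_congr rfl fun n _ => by
      rw [mul_pow, hweight]
      ring
  have henergy : ∑ n ∈ s, (1 + (n : ℝ)) * ((1 + (n : ℝ))⁻¹ * hermiteFun n x) ^ 2 = k :=
    Finset.sum_congr rfl fun n _ => by
      rw [mul_pow, mul_pow, hweight]
      field_simp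
  rw [hvalue, henergy] at hembed
  by_contra! hlt
  nlinarith

end Hermite

/-! ### Multiplication operators -/

section Potential

open MeasureTheory

/-- The weights `(1 + n)^{-1/2}`. A function with Hermite coefficients in `l²_{1/2}(ℕ)` is
described below by its weighted coordinates: the coefficients are `energyWeight n * a n` with `a`
in `l²(ℕ)`. -/
noncomputable def energyWeight (n : ℕ) : ℝ := (√(1 + (n : ℝ)))⁻¹

theorem energyWeight_pos (n : ℕ) : 0 < energyWeight n :=
  inv_pos.2 (Real.sqrt_pos.2 (by positivity))

theorem energyWeight_sq (n : ℕ) : energyWeight n ^ 2 = (1 + (n : ℝ))⁻¹ := by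
  rw [energyWeight, inv_pow, Real.sq_sqrt (by positivity)]

/-- The evaluation functional at `x`: if `a` are the weighted coordinates of a function `u`, then
`inner ℝ (evalVec x) a = u x`. -/
noncomputable def evalVec (x : ℝ) : Ell2 :=
  ⟨fun n => energyWeight n * hermiteFun n x,
    (memℓp_two_iff_summable_sq fun n => energyWeight n * hermiteFun n x).2
      (summable_of_sum_le (fun _ => sq_nonneg _) fun s => sum_hermiteFun_sq_div_le s x)⟩

theorem evalVec_apply (x : ℝ) (n : ℕ) : evalVec x n = energyWeight n * hermiteFun n x := rfl

theorem norm_evalVec_sq_le (x : ℝ) : ‖evalVec x‖ ^ 2 ≤ 2 :=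
  hasSum_le_of_sum_le (hasSum_sq (evalVec x)) fun s => sum_hermiteFun_sq_div_le s x

theorem abs_inner_evalVec_le (x : ℝ) (a : Ell2) : |inner ℝ (evalVec x) a| ≤ √2 * ‖a‖ := by
  refine (abs_real_inner_le_norm _ _).trans ?_
  gcongr
  exact Real.le_sqrt_of_sq_le (norm_evalVec_sq_le x)

theorem abs_inner_evalVec_mul_le (a b : Ell2) (x : ℝ) :
    |inner ℝ (evalVec x) a * inner ℝ (evalVec x) b| ≤ 2 * ‖a‖ * ‖b‖ :=
  calc |inner ℝ (evalVec x) a * inner ℝ (evalVec x) b|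
      ≤ (√2 * ‖a‖) * (√2 * ‖b‖) := by
        rw [abs_mul]
        gcongr <;> exact abs_inner_evalVec_le _ _
    _ = (√2 * √2) * ‖a‖ * ‖b‖ := by ring
    _ = 2 * ‖a‖ * ‖b‖ := by rw [Real.mul_self_sqrt zero_le_two]

theorem measurable_inner_evalVec (a : Ell2) : Measurable fun x => inner ℝ (evalVec x) a := by
  have hlim (x : ℝ) : Filter.Tendsto
      (fun N => ∑ n ∈ Finset.range N, a n * (energyWeight n * hermiteFun n x))
      Filter.atTop (nhds (inner ℝ (evalVec x) a)) := by
    simpa [evalVec_apply] using (lp.hasSum_inner (𝕜 := ℝ) (evalVec x) a).tendsto_sum_nat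
  refine measurable_of_tendsto_metrizable (f := fun N x =>
    ∑ n ∈ Finset.range N, a n * (energyWeight n * hermiteFun n x)) (fun N => ?_)
    (tendsto_pi_nhds.2 hlim)
  exact Finset.measurable_fun_sum _ fun n _ =>
    ((continuous_hermiteFun n).measurable.const_mul _).const_mul _

theorem integrable_mul_inner_evalVec {f : ℝ → ℝ} (hf : Integrable f) (a b : Ell2) :
    Integrable fun x => f x * (inner ℝ (evalVec x) a * inner ℝ (evalVec x) b) :=
  hf.mul_bdd (c := 2 * ‖a‖ * ‖b‖)
    ((measurable_inner_evalVec a).mul (measurable_inner_evalVec b)).aestronglyMeasurable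
    (.of_forall fun x => abs_inner_evalVec_mul_le a b x)

theorem integral_abs_mul_le_sqrt_mul_sqrt {f g : ℝ → ℝ} (hf : Continuous f) (hg : Continuous g)
    (hf_sq : Integrable fun x => f x ^ 2) (hg_sq : Integrable fun x => g x ^ 2) :
    ∫ x, |f x * g x| ≤ √(∫ x, f x ^ 2) * √(∫ x, g x ^ 2) := by
  have hholder := integral_mul_norm_le_Lp_mul_Lq (μ := volume) (f := f) (g := g) (p := 2) (q := 2)
    (by rw [Real.holderConjugate_iff]; norm_num)
    (by simpa using (memLp_two_iff_integrable_sq hf.aestronglyMeasurable).2 hf_sq)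
    (by simpa using (memLp_two_iff_integrable_sq hg.aestronglyMeasurable).2 hg_sq)
  simpa [Real.sqrt_eq_rpow, abs_mul] using hholder

theorem integral_abs_sum_hermiteFun_mul_sum_le (s t : Finset ℕ) (x y : ℕ → ℝ) :
    ∫ z, |(∑ n ∈ s, x n * hermiteFun n z) * ∑ m ∈ t, y m * hermiteFun m z| ≤
      √(∑ n ∈ s, x n ^ 2) * √(∑ m ∈ t, y m ^ 2) := by
  have hcont (s : Finset ℕ) (x : ℕ → ℝ) : Continuous fun z => ∑ n ∈ s, x n * hermiteFun n z :=
    continuous_finsetSum _ fun n _ => continuous_const.mul (continuous_hermiteFun n)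
  refine (integral_abs_mul_le_sqrt_mul_sqrt (hcont s x) (hcont t y)
    (integrable_sum_hermiteFun_sq x id) (integrable_sum_hermiteFun_sq y id)).trans_eq ?_
  exact congrArg₂ (√· * √·) (integral_sum_hermiteFun_sq (f := id) fun _ _ _ _ h => h)
    (integral_sum_hermiteFun_sq (f := id) fun _ _ _ _ h => h)

/-- The matrix of multiplication by `u v`, where `u` and `v` have the weighted coordinates `a` and
`b`. -/
noncomputable def potentialEntry (a b : Ell2) (n m : ℕ) : ℝ :=
  ∫ x, hermiteFun n x * hermiteFun m x * (inner ℝ (evalVec x) a * inner ℝ (evalVec x) b)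

theorem integrable_potentialEntry (a b : Ell2) (n m : ℕ) : Integrable fun x =>
    hermiteFun n x * hermiteFun m x * (inner ℝ (evalVec x) a * inner ℝ (evalVec x) b) :=
  integrable_mul_inner_evalVec (integrable_hermiteFun_mul n m) a b

theorem sum_potentialEntry_eq_integral (a b : Ell2) (s t : Finset ℕ) (x y : ℕ → ℝ) :
    ∑ n ∈ s, ∑ m ∈ t, x n * potentialEntry a b n m * y m =
      ∫ z, ((∑ n ∈ s, x n * hermiteFun n z) * ∑ m ∈ t, y m * hermiteFun m z) *
        (inner ℝ (evalVec z) a * inner ℝ (evalVec z) b) := by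
  have hexpand (z : ℝ) : ((∑ n ∈ s, x n * hermiteFun n z) * ∑ m ∈ t, y m * hermiteFun m z) *
      (inner ℝ (evalVec z) a * inner ℝ (evalVec z) b) = ∑ n ∈ s, ∑ m ∈ t, x n * y m *
        (hermiteFun n z * hermiteFun m z * (inner ℝ (evalVec z) a * inner ℝ (evalVec z) b)) := by
    simp_rw [Finset.sum_mul_sum, Finset.sum_mul]
    exact Finset.sum_congr rfl fun n _ => Finset.sum_congr rfl fun m _ => by ring
  have hint (n m : ℕ) := (integrable_potentialEntry a b n m).const_mul (x n * y m)
  simp_rw [hexpand]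
  rw [integral_finsetSum _ fun _ _ => integrable_finsetSum _ fun _ _ => hint _ _]
  refine Finset.sum_congr rfl fun n _ => ?_
  rw [integral_finsetSum _ fun _ _ => hint _ _]
  refine Finset.sum_congr rfl fun m _ => ?_
  rw [integral_const_mul, potentialEntry]
  ring

theorem formBoundedBy_potentialEntry (a b : Ell2) :
    FormBoundedBy (potentialEntry a b) (2 * ‖a‖ * ‖b‖) := by
  intro s t x y
  rw [sum_potentialEntry_eq_integral, ← Real.norm_eq_abs]
  set f : ℝ → ℝ := fun z => (∑ n ∈ s, x n * hermiteFun n z) * ∑ m ∈ t, y m * hermiteFun m z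
  have hf : Integrable f := integrable_sum_hermiteFun_mul_sum x y id id
  calc ‖∫ z, f z * (inner ℝ (evalVec z) a * inner ℝ (evalVec z) b)‖
      ≤ ∫ z, 2 * ‖a‖ * ‖b‖ * |f z| := by
        refine norm_integral_le_of_norm_le (hf.abs.const_mul _) (.of_forall fun z => ?_)
        rw [norm_mul, mul_comm]
        exact mul_le_mul_of_nonneg_right (abs_inner_evalVec_mul_le a b z) (abs_nonneg _)
    _ = 2 * ‖a‖ * ‖b‖ * ∫ z, |f z| := integral_const_mul _ _
    _ ≤ 2 * ‖a‖ * ‖b‖ * (√(∑ n ∈ s, x n ^ 2) * √(∑ m ∈ t, y m ^ 2)) := by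
        gcongr
        exact integral_abs_sum_hermiteFun_mul_sum_le s t x y
    _ = 2 * ‖a‖ * ‖b‖ * √(∑ n ∈ s, x n ^ 2) * √(∑ m ∈ t, y m ^ 2) := by ring

theorem potentialEntry_add_left (a a' b : Ell2) (n m : ℕ) :
    potentialEntry (a + a') b n m = potentialEntry a b n m + potentialEntry a' b n m := by
  simp_rw [potentialEntry, inner_add_right, add_mul, mul_add]
  exact integral_add (integrable_potentialEntry ..) (integrable_potentialEntry ..)

theorem potentialEntry_smul_left (c : ℝ) (a b : Ell2) (n m : ℕ) :
    potentialEntry (c • a) b n m = c * potentialEntry a b n m := by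
  simp_rw [potentialEntry, inner_smul_right, ← integral_const_mul]
  exact integral_congr_ae (.of_forall fun x => by ring)

theorem potentialEntry_comm (a b : Ell2) (n m : ℕ) :
    potentialEntry a b n m = potentialEntry b a n m := by
  simp_rw [potentialEntry, mul_comm (inner ℝ (evalVec _) a)]

theorem potentialEntry_symm (a b : Ell2) (n m : ℕ) :
    potentialEntry a b n m = potentialEntry a b m n := by
  simp_rw [potentialEntry, mul_comm (hermiteFun n _)]

theorem potentialEntry_basisVec (j k n m : ℕ) :
    potentialEntry (basisVec j) (basisVec k) n m =
      energyWeight j * energyWeight k * K n m j k := by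
  simp_rw [potentialEntry, K, ← integral_const_mul, inner_basisVec_right, evalVec_apply]
  exact integral_congr_ae (.of_forall fun x => by ring)

theorem exists_potential : ∃ P : Ell2 →L[ℝ] Ell2 →L[ℝ] (Ell2 →L[ℝ] Ell2),
    ∀ a b n m, P a b (basisVec m) n = potentialEntry a b n m := by
  choose P hnorm hentry using fun a b : Ell2 =>
    (formBoundedBy_potentialEntry a b).exists_clm (by positivity)
  have hcomm (a b : Ell2) : P a b = P b a := clm_ext_entries fun i k => by
    rw [hentry, hentry, potentialEntry_comm]
  have hadd (a a' b : Ell2) : P (a + a') b = P a b + P a' b := clm_ext_entries fun i k => by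
    simp [hentry, potentialEntry_add_left]
  have hsmul (c : ℝ) (a b : Ell2) : P (c • a) b = c • P a b := clm_ext_entries fun i k => by
    simp [hentry, potentialEntry_smul_left]
  let bilin : Ell2 →ₗ[ℝ] Ell2 →ₗ[ℝ] (Ell2 →L[ℝ] Ell2) := LinearMap.mk₂ ℝ P hadd hsmul
    (fun a b b' => by rw [hcomm, hadd, hcomm b, hcomm b'])
    (fun c a b => by rw [hcomm, hsmul, hcomm b])
  exact ⟨bilin.mkContinuous₂ 2 hnorm, fun a b n m => hentry a b n m⟩

/-- The operator of multiplication by `u v` in the Hermite basis, where `u` and `v` have the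
weighted coordinates `a` and `b`. -/
noncomputable def potential : Ell2 →L[ℝ] Ell2 →L[ℝ] (Ell2 →L[ℝ] Ell2) := exists_potential.choose

theorem potential_apply_basisVec (a b : Ell2) (n m : ℕ) :
    potential a b (basisVec m) n = potentialEntry a b n m :=
  exists_potential.choose_spec a b n m

theorem potential_comm (a b : Ell2) : potential a b = potential b a :=
  clm_ext_entries fun i k => by
    rw [potential_apply_basisVec, potential_apply_basisVec, potentialEntry_comm]

theorem potential_basisVec (j k m n : ℕ) :
    potential (basisVec j) (basisVec k) (basisVec m) n =
      energyWeight j * energyWeight k * K n m j k := by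
  rw [potential_apply_basisVec, potentialEntry_basisVec]

theorem isSelfAdjoint_potential (a b : Ell2) : IsSelfAdjoint (potential a b) := by
  refine clm_ext_entries fun m n => ?_
  rw [ContinuousLinearMap.star_eq_adjoint, ← inner_basisVec_left,
    ContinuousLinearMap.adjoint_inner_right, inner_basisVec_right, potential_apply_basisVec,
    potential_apply_basisVec, potentialEntry_symm]

end Potential

/-! ### Position and derivative -/

section Ladder

open MeasureTheory

theorem energyWeight_le_one (n : ℕ) : energyWeight n ≤ 1 :=
  inv_le_one_of_one_le₀ (Real.one_le_sqrt.2 (by simp))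

theorem exists_energyIncl : ∃ T : Ell2 →L[ℝ] Ell2, ∀ x n, T x n = energyWeight n * x n :=
  (exists_diagonal energyWeight zero_le_one fun n => by
    rw [abs_of_pos (energyWeight_pos n)]
    exact energyWeight_le_one n).imp fun _ h => h.2

/-- The inclusion of `l²_{1/2}(ℕ)` into `l²(ℕ)`, in weighted coordinates. -/
noncomputable def energyIncl : Ell2 →L[ℝ] Ell2 := exists_energyIncl.choose

theorem energyIncl_apply (x : Ell2) (n : ℕ) : energyIncl x n = energyWeight n * x n :=
  exists_energyIncl.choose_spec x n

theorem energyIncl_basisVec (n : ℕ) : energyIncl (basisVec n) = energyWeight n • basisVec n := by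
  ext k
  rw [energyIncl_apply]
  rcases eq_or_ne k n with rfl | hkn
  · simp
  · simp [basisVec_of_ne hkn]

theorem exists_lowerOp : ∃ T : Ell2 →L[ℝ] Ell2, ∀ x n,
    T x n = ladderCoeff (n + 1) * energyWeight (n + 1) * x (n + 1) := by
  refine (exists_weighted_comp (· + 1) (fun n => ladderCoeff (n + 1) * energyWeight (n + 1))
    zero_le_one (fun n => ?_) (Nat.succ_injective.injOn)).imp fun _ h => h.2
  rw [← sq_le_one_iff_abs_le_one, mul_pow, ladderCoeff_sq, energyWeight_sq, ← div_eq_mul_inv,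
    div_le_one (by positivity)]
  push_cast
  linarith [(Nat.cast_nonneg n : (0 : ℝ) ≤ n)]

theorem exists_raiseOp : ∃ T : Ell2 →L[ℝ] Ell2, ∀ x n,
    T x n = ladderCoeff n * energyWeight (n - 1) * x (n - 1) := by
  refine (exists_weighted_comp (· - 1) (fun n => ladderCoeff n * energyWeight (n - 1))
    zero_le_one (fun n => ?_) ?_).imp fun _ h => h.2
  · rw [← sq_le_one_iff_abs_le_one, mul_pow, ladderCoeff_sq, energyWeight_sq, ← div_eq_mul_inv,
      div_le_one (by positivity)]
    cases n with
    | zero => simp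
    | succ n =>
      rw [Nat.add_sub_cancel]
      push_cast
      linarith [(Nat.cast_nonneg n : (0 : ℝ) ≤ n)]
  · rintro (_ | n) hn (_ | m) hm hnm
    · rfl
    · simp at hn
    · simp at hm
    · exact congrArg Nat.succ hnm

/-- The lowering part of position and derivative, from weighted coordinates to `l²(ℕ)`. -/
noncomputable def lowerOp : Ell2 →L[ℝ] Ell2 := exists_lowerOp.choose

/-- The raising part of position and derivative, from weighted coordinates to `l²(ℕ)`. -/
noncomputable def raiseOp : Ell2 →L[ℝ] Ell2 := exists_raiseOp.choose

/-- Multiplication by the independent variable, from weighted coordinates to `l²(ℕ)`. -/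
noncomputable def positionOp : Ell2 →L[ℝ] Ell2 := lowerOp + raiseOp

/-- Differentiation, from weighted coordinates to `l²(ℕ)`. -/
noncomputable def derivOp : Ell2 →L[ℝ] Ell2 := lowerOp - raiseOp

theorem lowerOp_apply (x : Ell2) (n : ℕ) :
    lowerOp x n = ladderCoeff (n + 1) * energyWeight (n + 1) * x (n + 1) :=
  exists_lowerOp.choose_spec x n

theorem raiseOp_apply (x : Ell2) (n : ℕ) :
    raiseOp x n = ladderCoeff n * energyWeight (n - 1) * x (n - 1) :=
  exists_raiseOp.choose_spec x n

theorem lowerOp_basisVec (j : ℕ) :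
    lowerOp (basisVec j) = (energyWeight j * ladderCoeff j) • basisVec (j - 1) := by
  ext n
  simp only [lowerOp_apply, lp.coeFn_smul, Pi.smul_apply, smul_eq_mul, basisVec_apply]
  rcases j with _ | j
  · simp
  · rcases eq_or_ne n j with rfl | hnj
    · simp [mul_comm]
    · simp [hnj]

theorem raiseOp_basisVec (j : ℕ) :
    raiseOp (basisVec j) = (energyWeight j * ladderCoeff (j + 1)) • basisVec (j + 1) := by
  ext n
  simp only [raiseOp_apply, lp.coeFn_smul, Pi.smul_apply, smul_eq_mul, basisVec_apply]
  rcases n with _ | n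
  · simp
  · rcases eq_or_ne n j with rfl | hnj
    · simp [mul_comm]
    · simp [hnj]

theorem abs_hermiteFun_le (m : ℕ) (x : ℝ) : |hermiteFun m x| ≤ (energyWeight m)⁻¹ * √2 := by
  have hcoord := abs_apply_le_norm (evalVec x) m
  rw [evalVec_apply, abs_mul, abs_of_pos (energyWeight_pos m)] at hcoord
  rw [inv_mul_eq_div, le_div_iff₀ (energyWeight_pos m), mul_comm]
  exact hcoord.trans (Real.le_sqrt_of_sq_le (norm_evalVec_sq_le x))

theorem integrable_K (n j k m : ℕ) : Integrable fun x =>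
    hermiteFun n x * (hermiteFun j x * hermiteFun k x * hermiteFun m x) := by
  have hbdd := ((integrable_hermiteFun_mul n j).mul_bdd
    (continuous_hermiteFun k).aestronglyMeasurable (.of_forall (abs_hermiteFun_le k))).mul_bdd
    (continuous_hermiteFun m).aestronglyMeasurable (.of_forall (abs_hermiteFun_le m))
  exact hbdd.congr (.of_forall fun x => by ring)

theorem K_swap_left (n j k m : ℕ) : K n j k m = K n k j m := by
  simp_rw [K, mul_comm (hermiteFun j _)]

theorem K_swap_right (n j k m : ℕ) : K n j k m = K n j m k := by
  simp_rw [K, mul_right_comm (hermiteFun j _)]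

theorem K_position (n j k m : ℕ) :
    ladderCoeff n * K (n - 1) j k m + ladderCoeff (n + 1) * K (n + 1) j k m =
      ladderCoeff j * K n (j - 1) k m + ladderCoeff (j + 1) * K n (j + 1) k m := by
  have hint (c : ℝ) (n j k m : ℕ) := (integrable_K n j k m).const_mul c
  simp only [K, ← integral_const_mul]
  rw [← integral_add (hint ..) (hint ..), ← integral_add (hint ..) (hint ..)]
  refine integral_congr_ae (.of_forall fun x => ?_)
  dsimp only
  linear_combination hermiteFun k x * hermiteFun m x *
    (hermiteFun n x * mul_hermiteFun j x - hermiteFun j x * mul_hermiteFun n x)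

theorem K_derivative (n j k m : ℕ) :
    (ladderCoeff n * K (n - 1) j k m - ladderCoeff (n + 1) * K (n + 1) j k m) +
      (ladderCoeff j * K n (j - 1) k m - ladderCoeff (j + 1) * K n (j + 1) k m) +
      (ladderCoeff k * K n j (k - 1) m - ladderCoeff (k + 1) * K n j (k + 1) m) +
      (ladderCoeff m * K n j k (m - 1) - ladderCoeff (m + 1) * K n j k (m + 1)) = 0 := by
  have hint (c : ℝ) (n j k m : ℕ) := (integrable_K n j k m).const_mul c
  have hint₁ := (hint (ladderCoeff n) (n - 1) j k m).sub (hint (ladderCoeff (n + 1)) (n + 1) j k m)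
  have hint₂ := (hint (ladderCoeff j) n (j - 1) k m).sub (hint (ladderCoeff (j + 1)) n (j + 1) k m)
  have hint₃ := (hint (ladderCoeff k) n j (k - 1) m).sub (hint (ladderCoeff (k + 1)) n j (k + 1) m)
  have hint₄ := (hint (ladderCoeff m) n j k (m - 1)).sub (hint (ladderCoeff (m + 1)) n j k (m + 1))
  have hprod (x : ℝ) := (hasDerivAt_hermiteFun n x).mul (((hasDerivAt_hermiteFun j x).mul
    (hasDerivAt_hermiteFun k x)).mul (hasDerivAt_hermiteFun m x))
  have hzero := integral_eq_zero_of_hasDerivAt_of_integrable hprod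
    ((((hint₁.add hint₂).add hint₃).add hint₄).congr (.of_forall fun x => by
      simp only [Pi.add_apply, Pi.sub_apply, Pi.mul_apply]
      ring)) (integrable_K n j k m)
  rw [← hzero]
  simp only [K, ← integral_const_mul]
  rw [← integral_sub (hint ..) (hint ..), ← integral_sub (hint ..) (hint ..),
    ← integral_sub (hint ..) (hint ..), ← integral_sub (hint ..) (hint ..)]
  refine ((congrArg₂ _ (congrArg₂ _ (integral_add hint₁ hint₂).symm rfl |>.trans
    (integral_add (hint₁.add hint₂) hint₃).symm) rfl).trans
    (integral_add ((hint₁.add hint₂).add hint₃) hint₄).symm).trans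
    (integral_congr_ae (.of_forall fun x => ?_))
  simp only [Pi.add_apply, Pi.sub_apply, Pi.mul_apply]
  ring

theorem trilinear_eq_zero {F : Ell2 → Ell2 → Ell2 → ℝ}
    (hleft : ∀ b c, ∃ L : Ell2 →L[ℝ] ℝ, ∀ a, F a b c = L a)
    (hmiddle : ∀ a c, ∃ L : Ell2 →L[ℝ] ℝ, ∀ b, F a b c = L b)
    (hright : ∀ a b, ∃ L : Ell2 →L[ℝ] ℝ, ∀ c, F a b c = L c)
    (hbasis : ∀ i j k, F (basisVec i) (basisVec j) (basisVec k) = 0) (a b c : Ell2) :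
    F a b c = 0 := by
  have hlinear {f : Ell2 → ℝ} (hf : ∃ L : Ell2 →L[ℝ] ℝ, ∀ a, f a = L a)
      (hf_basis : ∀ i, f (basisVec i) = 0) (a : Ell2) : f a = 0 := by
    obtain ⟨L, hL⟩ := hf
    have hL_zero : L = 0 := clm_ext_basisVec fun i => (hL _).symm.trans (hf_basis i)
    rw [hL, hL_zero, zero_apply]
  exact hlinear (hleft b c) (fun i => hlinear (hmiddle _ c)
    (fun j => hlinear (hright _ _) (fun k => hbasis i j k) c) b) a

theorem potential_energyIncl_comm (a b c : Ell2) :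
    potential a b (energyIncl c) = potential a c (energyIncl b) := by
  ext n
  rw [← sub_eq_zero]
  refine trilinear_eq_zero
    (F := fun a b c => potential a b (energyIncl c) n - potential a c (energyIncl b) n)
    (fun b c => ⟨coordCLM n ∘L (potential.flip b).flip (energyIncl c) -
      coordCLM n ∘L (potential.flip c).flip (energyIncl b), fun a => by simp⟩)
    (fun a c => ⟨coordCLM n ∘L (potential a).flip (energyIncl c) -
      coordCLM n ∘L potential a c ∘L energyIncl, fun b => by simp⟩)
    (fun a b => ⟨coordCLM n ∘L potential a b ∘L energyIncl -
      coordCLM n ∘L (potential a).flip (energyIncl b), fun c => by simp⟩) (fun i j k => ?_) a b c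
  simp only [energyIncl_basisVec, map_smul, lp.coeFn_smul, Pi.smul_apply, smul_eq_mul,
    potential_basisVec]
  rw [K_swap_left n k, K_swap_right n i, K_swap_left n i]
  ring

theorem potential_positionOp (a b c : Ell2) (n : ℕ) : potential a b (positionOp c) n =
    ladderCoeff n * potential a b (energyIncl c) (n - 1) +
      ladderCoeff (n + 1) * potential a b (energyIncl c) (n + 1) := by
  rw [← sub_eq_zero]
  refine trilinear_eq_zero (F := fun a b c => potential a b (positionOp c) n -
      (ladderCoeff n * potential a b (energyIncl c) (n - 1) +
        ladderCoeff (n + 1) * potential a b (energyIncl c) (n + 1)))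
    (fun b c => ⟨coordCLM n ∘L (potential.flip b).flip (positionOp c) -
      (ladderCoeff n • coordCLM (n - 1) ∘L (potential.flip b).flip (energyIncl c) +
        ladderCoeff (n + 1) • coordCLM (n + 1) ∘L (potential.flip b).flip (energyIncl c)),
      fun a => by simp⟩)
    (fun a c => ⟨coordCLM n ∘L (potential a).flip (positionOp c) -
      (ladderCoeff n • coordCLM (n - 1) ∘L (potential a).flip (energyIncl c) +
        ladderCoeff (n + 1) • coordCLM (n + 1) ∘L (potential a).flip (energyIncl c)),
      fun b => by simp⟩)
    (fun a b => ⟨coordCLM n ∘L potential a b ∘L positionOp -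
      (ladderCoeff n • coordCLM (n - 1) ∘L potential a b ∘L energyIncl +
        ladderCoeff (n + 1) • coordCLM (n + 1) ∘L potential a b ∘L energyIncl),
      fun c => by simp⟩)
    (fun i j k => ?_) a b c
  simp only [positionOp, add_apply, lowerOp_basisVec, raiseOp_basisVec, energyIncl_basisVec,
    map_add, map_smul, lp.coeFn_smul, lp.coeFn_add, Pi.add_apply, Pi.smul_apply, smul_eq_mul,
    potential_basisVec]
  linear_combination -(energyWeight i * energyWeight j * energyWeight k) * K_position n k i j

/-- The Leibniz rule: the right-hand side is the derivative of the product of `a`, `b`, `c` in terms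
of its Hermite coefficients. -/
theorem potential_derivOp (a b c : Ell2) (n : ℕ) :
    potential b c (derivOp a) n + potential a c (derivOp b) n + potential a b (derivOp c) n =
      ladderCoeff (n + 1) * potential a b (energyIncl c) (n + 1) -
        ladderCoeff n * potential a b (energyIncl c) (n - 1) := by
  rw [← sub_eq_zero]
  refine trilinear_eq_zero (F := fun a b c =>
      potential b c (derivOp a) n + potential a c (derivOp b) n + potential a b (derivOp c) n -
      (ladderCoeff (n + 1) * potential a b (energyIncl c) (n + 1) -
        ladderCoeff n * potential a b (energyIncl c) (n - 1)))
    (fun b c => ⟨coordCLM n ∘L potential b c ∘L derivOp +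
      coordCLM n ∘L (potential.flip c).flip (derivOp b) +
      coordCLM n ∘L (potential.flip b).flip (derivOp c) -
      (ladderCoeff (n + 1) • coordCLM (n + 1) ∘L (potential.flip b).flip (energyIncl c) -
        ladderCoeff n • coordCLM (n - 1) ∘L (potential.flip b).flip (energyIncl c)),
      fun a => by simp⟩)
    (fun a c => ⟨coordCLM n ∘L (potential.flip c).flip (derivOp a) +
      coordCLM n ∘L potential a c ∘L derivOp + coordCLM n ∘L (potential a).flip (derivOp c) -
      (ladderCoeff (n + 1) • coordCLM (n + 1) ∘L (potential a).flip (energyIncl c) -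
        ladderCoeff n • coordCLM (n - 1) ∘L (potential a).flip (energyIncl c)),
      fun b => by simp⟩)
    (fun a b => ⟨coordCLM n ∘L (potential b).flip (derivOp a) +
      coordCLM n ∘L (potential a).flip (derivOp b) + coordCLM n ∘L potential a b ∘L derivOp -
      (ladderCoeff (n + 1) • coordCLM (n + 1) ∘L potential a b ∘L energyIncl -
        ladderCoeff n • coordCLM (n - 1) ∘L potential a b ∘L energyIncl), fun c => by simp⟩)
    (fun i j k => ?_) a b c
  have hrotate (p : ℕ) : K n p j k = K n k p j := by rw [K_swap_right, K_swap_left]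
  have hswap (p : ℕ) : K n p i k = K n k i p := by
    rw [K_swap_left, K_swap_right n i, K_swap_left]
  simp only [derivOp, sub_apply, lowerOp_basisVec, raiseOp_basisVec, energyIncl_basisVec, map_sub,
    map_smul, lp.coeFn_smul, lp.coeFn_sub, Pi.sub_apply, Pi.smul_apply, smul_eq_mul,
    potential_basisVec, hrotate, hswap]
  linear_combination (energyWeight i * energyWeight j * energyWeight k) * K_derivative n k i j

end Ladder

/-! ### The equations in weighted coordinates -/

section WeightedCoordinates

theorem hasSum_mul_potential_basisVec (a b c : Ell2) (n : ℕ) :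
    HasSum (fun j => a j * potential (basisVec j) b c n) (potential a b c n) := by
  simpa using (coordCLM n ∘L (potential.flip b).flip c).hasSum (hasSum_smul_basisVec a)

theorem V_eq_potential {A : ℕ → ℝ} {a : Ell2} (hA : ∀ n, A n = energyWeight n * a n) (n m : ℕ) :
    V A n m = potential a a (basisVec m) n := by
  have hinner (j : ℕ) : ∑' k, K n m j k * A j * A k =
      a j * potential (basisVec j) a (basisVec m) n := by
    have hsum := (hasSum_mul_potential_basisVec a (basisVec j) (basisVec m) n).mul_left (a j)
    rw [potential_comm a] at hsum
    rw [← hsum.tsum_eq]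
    refine tsum_congr fun k => ?_
    rw [potential_comm, potential_basisVec, hA, hA]
    ring
  rw [V]
  simp_rw [hinner]
  exact (hasSum_mul_potential_basisVec a a (basisVec m) n).tsum_eq

theorem Lplus_eq_potential {A : ℕ → ℝ} {a : Ell2} (hA : ∀ n, A n = energyWeight n * a n)
    (σ μ : ℝ) (B : Ell2) (n : ℕ) :
    Lplus σ A μ B n = (n - μ) * B n + 3 * σ * potential a a B n := by
  rw [Lplus, ← (hasSum_entries (potential a a) B n).tsum_eq]
  simp_rw [V_eq_potential hA]

theorem Lminus_eq_potential {A : ℕ → ℝ} {a : Ell2} (hA : ∀ n, A n = energyWeight n * a n)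
    (σ μ : ℝ) (B : Ell2) (n : ℕ) :
    Lminus σ A μ B n = (n - μ) * B n + σ * potential a a B n := by
  rw [Lminus, ← (hasSum_entries (potential a a) B n).tsum_eq]
  simp_rw [V_eq_potential hA]

/-- The cubic nonlinearity of the stationary equation, as a function of weighted coordinates. -/
noncomputable def cubic (a : Ell2) : Ell2 := potential a a (energyIncl a)

theorem contDiff_cubic {k : WithTop ℕ∞} : ContDiff ℝ k cubic :=
  (potential.contDiff.clm_apply contDiff_id).clm_apply energyIncl.contDiff

theorem cubic_smul (c : ℝ) (a : Ell2) : cubic (c • a) = c ^ 3 • cubic a := by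
  simp only [cubic, map_smul, smul_apply, smul_smul]
  congr 1
  ring

theorem stationaryField_energyIncl (σ μ : ℝ) (a : Ell2) (n : ℕ) :
    stationaryField σ (energyIncl a) μ n = (μ - n) * energyIncl a n - σ * cubic a n := by
  have hinner (m : ℕ) :
      ∑' j, ∑' k, K n m j k * energyIncl a m * energyIncl a j * energyIncl a k =
        potential a a (basisVec m) n * energyIncl a m := by
    rw [← V_eq_potential (energyIncl_apply a), V, ← tsum_mul_right]
    refine tsum_congr fun j => ?_
    rw [← tsum_mul_right]
    exact tsum_congr fun k => by ring
  rw [stationaryField]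
  simp_rw [hinner]
  rw [(hasSum_entries (potential a a) (energyIncl a) n).tsum_eq, cubic]

/-- `a` consists of the weighted coordinates of a real stationary state of frequency `μ`. -/
def IsStationary (σ μ : ℝ) (a : Ell2) : Prop :=
  ∀ n : ℕ, stationaryField σ (energyIncl a) μ n = 0

theorem IsStationary.eq_zero {σ μ : ℝ} {a : Ell2} (h : IsStationary σ μ a) (n : ℕ) :
    (n - μ) * energyIncl a n + σ * cubic a n = 0 := by
  linear_combination (stationaryField_energyIncl σ μ a n).symm.trans (h n) * (-1)

theorem sqrt_mul_energyWeight (n : ℕ) : √(1 + (n : ℝ)) * energyWeight n = 1 :=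
  mul_inv_cancel₀ (Real.sqrt_pos.2 (by positivity)).ne'

theorem rpow_half_mul_energyWeight (n : ℕ) : (1 + (n : ℝ)) ^ (1 / 2 : ℝ) * energyWeight n = 1 := by
  rw [← Real.sqrt_eq_rpow, sqrt_mul_energyWeight]

theorem weightedNorm_half {A : ℕ → ℝ} {a : Ell2} (hA : ∀ n, A n = energyWeight n * a n) :
    weightedNorm (1 / 2) A = ‖a‖ := by
  have hterm (n : ℕ) : (1 + (n : ℝ)) ^ (2 * (1 / 2) : ℝ) * |A n| ^ 2 = a n ^ 2 := by
    rw [sq_abs, hA, mul_pow, energyWeight_sq, mul_one_div_cancel two_ne_zero, Real.rpow_one,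
      mul_inv_cancel_left₀ (by positivity)]
  simp_rw [weightedNorm, hterm]
  rw [(hasSum_sq a).tsum_eq, Real.sqrt_sq (norm_nonneg _)]

end WeightedCoordinates

/-! ### Explicit integrals -/

section Moments

open MeasureTheory

theorem integrable_pow_mul_exp (k : ℕ) :
    Integrable fun x : ℝ => x ^ k * Real.exp (-2 * x ^ 2) := by
  simpa using integrable_eval_mul_exp (Polynomial.X ^ k) (b := 2) two_pos

theorem integral_pow_add_two_mul_exp (k : ℕ) : ∫ x : ℝ, x ^ (k + 2) * Real.exp (-2 * x ^ 2) =
    (k + 1) / 4 * ∫ x : ℝ, x ^ k * Real.exp (-2 * x ^ 2) := by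
  have hderiv (x : ℝ) : HasDerivAt (fun x : ℝ => x ^ (k + 1) * Real.exp (-2 * x ^ 2))
      ((k + 1) * (x ^ k * Real.exp (-2 * x ^ 2)) - 4 * (x ^ (k + 2) * Real.exp (-2 * x ^ 2)))
      x := by
    have hexponent : HasDerivAt (fun x : ℝ => -2 * x ^ 2) (-2 * (2 * x)) x := by
      simpa using (hasDerivAt_pow 2 x).const_mul (-2)
    refine ((hasDerivAt_pow (k + 1) x).mul hexponent.exp).congr_deriv ?_
    rw [Nat.add_sub_cancel]
    push_cast
    ring
  have hlow := (integrable_pow_mul_exp k).const_mul ((k : ℝ) + 1)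
  have hhigh := (integrable_pow_mul_exp (k + 2)).const_mul 4
  have hzero := integral_eq_zero_of_hasDerivAt_of_integrable hderiv (hlow.sub hhigh)
    (integrable_pow_mul_exp (k + 1))
  rw [integral_sub hlow hhigh, integral_const_mul, integral_const_mul] at hzero
  linarith

theorem integral_exp_neg_two_mul_sq :
    ∫ x : ℝ, Real.exp (-2 * x ^ 2) = Real.pi * (√(2 * Real.pi))⁻¹ := by
  rw [integral_gaussian, ← div_eq_mul_inv, eq_div_iff (by positivity),
    ← Real.sqrt_mul (by positivity),
    show Real.pi / 2 * (2 * Real.pi) = Real.pi ^ 2 by ring, Real.sqrt_sq Real.pi_pos.le]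

theorem hermiteFun_zero_pow_four (x : ℝ) :
    hermiteFun 0 x ^ 4 = Real.pi⁻¹ * Real.exp (-2 * x ^ 2) := by
  have hconst : (√√Real.pi)⁻¹ ^ 4 = Real.pi⁻¹ := by
    rw [inv_pow, show 4 = 2 * 2 from rfl, pow_mul, Real.sq_sqrt (Real.sqrt_nonneg _),
      Real.sq_sqrt Real.pi_pos.le]
  rw [hermiteFun_zero, mul_pow, hconst, ← Real.exp_nat_mul]
  congr 2
  push_cast
  ring

theorem hermiteFun_one_sq (x : ℝ) : hermiteFun 1 x ^ 2 = 2 * x ^ 2 * hermiteFun 0 x ^ 2 := by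
  have hrec := mul_hermiteFun 0 x
  have hcoeff := ladderCoeff_sq 1
  simp only [ladderCoeff_zero, zero_mul, zero_add, Nat.cast_one] at hrec hcoeff
  linear_combination -2 * (x * hermiteFun 0 x + ladderCoeff 1 * hermiteFun 1 x) * hrec -
    (2 * hermiteFun 1 x ^ 2) * hcoeff

theorem hermiteFun_two_sq (x : ℝ) :
    hermiteFun 2 x ^ 2 = (2 * x ^ 4 - 2 * x ^ 2 + 1 / 2) * hermiteFun 0 x ^ 2 := by
  have hrec_one := mul_hermiteFun 1 x
  have hrec_zero := mul_hermiteFun 0 x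
  have hcoeff_one := ladderCoeff_sq 1
  have hcoeff_two : ladderCoeff 2 = 1 := by simp [ladderCoeff]
  simp only [ladderCoeff_zero, zero_mul, zero_add, Nat.cast_one, Nat.sub_self, Nat.reduceAdd,
    hcoeff_two, one_mul] at hrec_one hrec_zero hcoeff_one
  have htwo : hermiteFun 2 x = x * hermiteFun 1 x - ladderCoeff 1 * hermiteFun 0 x := by linarith
  rw [htwo]
  linear_combination x ^ 2 * hermiteFun_one_sq x + hermiteFun 0 x ^ 2 * hcoeff_one +
    2 * x * hermiteFun 0 x * hrec_zero

theorem integral_poly_mul_hermiteFun_zero_pow_four (a b c : ℝ) :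
    ∫ x, (a * x ^ 2 + b * x ^ 4 + c * x ^ 6) * hermiteFun 0 x ^ 4 =
      (a / 4 + 3 * b / 16 + 15 * c / 64) * (√(2 * Real.pi))⁻¹ := by
  have hint (c : ℝ) (k : ℕ) := (integrable_pow_mul_exp k).const_mul (Real.pi⁻¹ * c)
  have hsplit : ∫ x, (a * x ^ 2 + b * x ^ 4 + c * x ^ 6) * hermiteFun 0 x ^ 4 =
      Real.pi⁻¹ * a * (∫ x : ℝ, x ^ 2 * Real.exp (-2 * x ^ 2)) +
      Real.pi⁻¹ * b * (∫ x : ℝ, x ^ 4 * Real.exp (-2 * x ^ 2)) +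
      Real.pi⁻¹ * c * (∫ x : ℝ, x ^ 6 * Real.exp (-2 * x ^ 2)) := by
    simp only [← integral_const_mul]
    rw [← integral_add (hint a 2) (hint b 4)]
    refine Eq.trans ?_ (integral_add ((hint a 2).add (hint b 4)) (hint c 6))
    refine integral_congr_ae (.of_forall fun x => ?_)
    simp only [hermiteFun_zero_pow_four]
    ring
  have hpow_two := integral_pow_add_two_mul_exp 0
  have hpow_four := integral_pow_add_two_mul_exp 2
  have hpow_six := integral_pow_add_two_mul_exp 4
  simp only [pow_zero, one_mul, integral_exp_neg_two_mul_sq] at hpow_two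
  rw [hsplit, hpow_six, hpow_four, hpow_two]
  push_cast
  field_simp
  ring

theorem K_1111 : K 1 1 1 1 = 3 / √(32 * Real.pi) := by
  have hintegral : K 1 1 1 1 =
      ∫ x, (0 * x ^ 2 + 4 * x ^ 4 + 0 * x ^ 6) * hermiteFun 0 x ^ 4 := by
    refine integral_congr_ae (.of_forall fun x => ?_)
    dsimp only
    linear_combination (hermiteFun 1 x ^ 2 + 2 * x ^ 2 * hermiteFun 0 x ^ 2) * hermiteFun_one_sq x
  have hsqrt : √(32 * Real.pi) = 4 * √(2 * Real.pi) := by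
    rw [show (32 : ℝ) * Real.pi = 4 ^ 2 * (2 * Real.pi) by ring, Real.sqrt_mul (by positivity),
      Real.sqrt_sq (by norm_num)]
  rw [hintegral, integral_poly_mul_hermiteFun_zero_pow_four, hsqrt]
  field_simp
  ring

theorem K_2211_sub_K_0011 : K 2 2 1 1 - K 0 0 1 1 = -(1 / 16) * (√(2 * Real.pi))⁻¹ := by
  have hK_two : K 2 2 1 1 =
      ∫ x, (1 * x ^ 2 + (-4) * x ^ 4 + 4 * x ^ 6) * hermiteFun 0 x ^ 4 := by
    refine integral_congr_ae (.of_forall fun x => ?_)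
    dsimp only
    linear_combination hermiteFun 2 x ^ 2 * hermiteFun_one_sq x +
      2 * x ^ 2 * hermiteFun 0 x ^ 2 * hermiteFun_two_sq x
  have hK_zero : K 0 0 1 1 = ∫ x, (2 * x ^ 2 + 0 * x ^ 4 + 0 * x ^ 6) * hermiteFun 0 x ^ 4 := by
    refine integral_congr_ae (.of_forall fun x => ?_)
    dsimp only
    linear_combination hermiteFun 0 x ^ 2 * hermiteFun_one_sq x
  rw [hK_two, hK_zero, integral_poly_mul_hermiteFun_zero_pow_four,
    integral_poly_mul_hermiteFun_zero_pow_four]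
  ring

end Moments

/-! ### Existence of dark solitons -/

section Existence

open Topology

/-- The weighted coordinates of `e₁`. -/
noncomputable def firstState : Ell2 := (energyWeight 1)⁻¹ • basisVec 1

theorem energyIncl_firstState : energyIncl firstState = basisVec 1 := by
  rw [firstState, map_smul, energyIncl_basisVec, smul_smul,
    inv_mul_cancel₀ (energyWeight_pos 1).ne', one_smul]

theorem potential_firstState (n m : ℕ) :
    potential firstState firstState (basisVec m) n = K n m 1 1 := by
  have hweight := (energyWeight_pos 1).ne'
  simp only [firstState, map_smul, smul_apply, lp.coeFn_smul, Pi.smul_apply, smul_eq_mul,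
    potential_basisVec]
  field_simp

theorem cubic_firstState : cubic firstState 1 = 3 / √(32 * Real.pi) := by
  rw [cubic, energyIncl_firstState, potential_firstState, K_1111]

theorem exists_contDiffAt_eq_smul {E : Type*} [NormedAddCommGroup E] [NormedSpace ℝ E]
    [CompleteSpace E] {k : WithTop ℕ∞} (hk : k ≠ 0) {G : E → E} (hG : ContDiff ℝ k G) :
    ∃ ψ : ℝ → E, ψ 0 = 0 ∧ ContDiffAt ℝ k ψ 0 ∧ ∀ᶠ s in 𝓝 0, ψ s = s • G (ψ s) := by
  let f : ℝ × E → E := fun u => u.2 - u.1 • G u.2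
  have hf : ContDiff ℝ k f := contDiff_snd.sub (contDiff_fst.smul (hG.comp contDiff_snd))
  have hpartial : fderiv ℝ f (0, 0) ∘L .inr ℝ _ _ = .id ℝ E := by
    have hcomp : HasFDerivAt (fun v : E => f (0, v)) (fderiv ℝ f (0, 0) ∘L .inr ℝ _ _) 0 :=
      HasFDerivAt.comp (g := f) (f := fun v : E => ((0 : ℝ), v)) 0
        (hf.differentiable hk (0, 0)).hasFDerivAt (hasFDerivAt_prodMk_right _ _)
    have hid : (fun v : E => f (0, v)) = id := by
      funext v
      simp [f]
    rw [hid] at hcomp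
    exact hcomp.unique (hasFDerivAt_id _)
  have hinv : (fderiv ℝ f (0, 0) ∘L .inr ℝ _ _).IsInvertible := hpartial ▸ ⟨.refl ℝ _, rfl⟩
  have hfa : ContDiffAt ℝ k f (0, 0) := hf.contDiffAt
  refine ⟨hfa.implicitFunction hk hinv, hfa.implicitFunction_apply_self hk hinv,
    hfa.contDiffAt_implicitFunction hk hinv, ?_⟩
  filter_upwards [hfa.eventually_apply_implicitFunction hk hinv] with s hs
  exact sub_eq_zero.1 (hs.trans (by simp [f]))

theorem sqrt_one_add_le_mul_abs_sub_one (n : ℕ) (hn : n ≠ 1) :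
    √(1 + (n : ℝ)) ≤ 2 * |(n : ℝ) - 1| := by
  refine Real.sqrt_le_left (by positivity) |>.2 ?_
  rw [mul_pow, sq_abs]
  rcases n with _ | _ | n
  · norm_num
  · exact absurd rfl hn
  · push_cast
    nlinarith [(Nat.cast_nonneg n : (0 : ℝ) ≤ n)]

/-- At `n = 1` the coefficient is `0⁻¹ = 0`, as it should be for the reduced resolvent. -/
theorem exists_reduced_resolvent : ∃ Q : Ell2 →L[ℝ] Ell2, ∀ x n,
    Q x n = (((n : ℝ) - 1) * energyWeight n)⁻¹ * x n := by
  refine (exists_diagonal (fun n : ℕ => (((n : ℝ) - 1) * energyWeight n)⁻¹) zero_le_two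
    fun n => ?_).imp fun _ h => h.2
  rcases eq_or_ne n 1 with rfl | hn
  · simp
  · rw [mul_inv, energyWeight, inv_inv, abs_mul, abs_inv, abs_of_nonneg (Real.sqrt_nonneg _),
      inv_mul_le_iff₀ (abs_pos.2 (sub_ne_zero.2 (by exact_mod_cast hn))), mul_comm]
    exact sqrt_one_add_le_mul_abs_sub_one n hn

/-- The Lyapunov–Schmidt ansatz `A = ε (e₁ + v)` with `v` orthogonal to `e₁`: the component of the
stationary equation along `e₁` determines `μ - 1 = s σ cubic (firstState + v) 1` with `s = ε²`, and
these are the other components, in weighted coordinates. -/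
def SolvesReduced (σ s : ℝ) (v : Ell2) : Prop :=
  v 1 = 0 ∧ ∀ n : ℕ, n ≠ 1 → ((n : ℝ) - 1) * (energyWeight n * v n) =
    s * (σ * cubic (firstState + v) 1 * (energyWeight n * v n) - σ * cubic (firstState + v) n)

theorem exists_reduced_branch (σ : ℝ) : ∃ ψ : ℝ → Ell2, ψ 0 = 0 ∧ ContDiffAt ℝ ω ψ 0 ∧
    ∀ᶠ s in 𝓝 0, SolvesReduced σ s (ψ s) := by
  obtain ⟨Q, hQ⟩ := exists_reduced_resolvent
  let G : Ell2 → Ell2 := fun v => Q ((σ * coordCLM 1 (cubic (firstState + v))) • energyIncl v -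
    σ • cubic (firstState + v))
  have hG : ContDiff ℝ ω G := by
    have hcubic : ContDiff ℝ ω fun v : Ell2 => cubic (firstState + v) :=
      contDiff_cubic.comp (contDiff_const.add contDiff_id)
    exact Q.contDiff.comp (((contDiff_const.mul ((coordCLM 1).contDiff.comp hcubic)).smul
      energyIncl.contDiff).sub (hcubic.const_smul σ))
  obtain ⟨ψ, hψ_zero, hψ, hfixed⟩ := exists_contDiffAt_eq_smul (by simp) hG
  refine ⟨ψ, hψ_zero, hψ, hfixed.mono fun s hs => ?_⟩
  have hcoord (n : ℕ) : ψ s n = s * ((((n : ℝ) - 1) * energyWeight n)⁻¹ *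
      (σ * cubic (firstState + ψ s) 1 * (energyWeight n * ψ s n) -
        σ * cubic (firstState + ψ s) n)) := by
    conv_lhs => rw [hs]
    simp only [G, lp.coeFn_smul, Pi.smul_apply, smul_eq_mul, hQ, lp.coeFn_sub, Pi.sub_apply,
      energyIncl_apply, coordCLM_apply]
  refine ⟨by rw [hcoord]; simp, fun n hn => ?_⟩
  have hgap : ((n : ℝ) - 1) ≠ 0 := sub_ne_zero.2 (by exact_mod_cast hn)
  have hweight := (energyWeight_pos n).ne'
  conv_lhs => rw [hcoord]
  field_simp

theorem SolvesReduced.isStationary {σ ε : ℝ} {v : Ell2} (h : SolvesReduced σ (ε ^ 2) v) :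
    IsStationary σ (1 + ε ^ 2 * (σ * cubic (firstState + v) 1)) (ε • (firstState + v)) := by
  intro n
  rw [stationaryField_energyIncl, cubic_smul, energyIncl_apply]
  simp only [lp.coeFn_smul, lp.coeFn_add, Pi.smul_apply, Pi.add_apply, smul_eq_mul]
  rcases eq_or_ne n 1 with rfl | hn
  · have hfirst : energyWeight 1 * firstState 1 = 1 := by
      rw [← energyIncl_apply, energyIncl_firstState, basisVec_self]
    rw [h.1]
    push_cast
    linear_combination ε ^ 3 * σ * cubic (firstState + v) 1 * hfirst
  · have hother : firstState n = 0 := by simp [firstState, basisVec_of_ne hn]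
    rw [hother]
    linear_combination -ε * h.2 n hn

theorem energyIncl_smul_firstState (ε : ℝ) :
    energyIncl (ε • firstState) = (lp.single 2 1 ε : Ell2) := by
  ext n
  rw [map_smul, energyIncl_firstState]
  rcases eq_or_ne n 1 with rfl | hn
  · simp
  · simp [basisVec_of_ne hn, hn]

theorem weightedNorm_energyIncl_sub_single (ε : ℝ) (a : Ell2) :
    weightedNorm (1 / 2) (energyIncl a - lp.single 2 1 ε : Ell2) = ‖a - ε • firstState‖ := by
  rw [← energyIncl_smul_firstState, ← map_sub, weightedNorm_half (energyIncl_apply _)]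

theorem smoothInWeighted_energyIncl {W : ℝ → Ell2} {S : Set ℝ} (hW : ContDiffOn ℝ ∞ W S) :
    SmoothInWeighted (1 / 2) (fun ε => energyIncl (W ε)) S :=
  ⟨W, fun ε _ n => by
    rw [energyIncl_apply, ← mul_assoc, rpow_half_mul_energyWeight, one_mul], hW⟩

theorem exists_darkSolitonFamily (σ : ℝ) : ∃ (A : ℝ → Ell2) (μ : ℝ → ℝ),
    IsDarkSolitonFamily σ A μ := by
  obtain ⟨ψ, hψ_zero, hψ, hsolves⟩ := exists_reduced_branch σ
  have hω : (ω : WithTop ℕ∞) ≠ 0 := by simp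
  let ν : ℝ → ℝ := fun s => σ * coordCLM 1 (cubic (firstState + ψ s))
  have hν {s : ℝ} (hs : ContDiffAt ℝ ω ψ s) : ContDiffAt ℝ ω ν s :=
    contDiffAt_const.mul ((coordCLM 1).contDiff.contDiffAt.comp s
      (contDiff_cubic.contDiffAt.comp s (contDiffAt_const.add hs)))
  have hν_zero : ν 0 = σ * (3 / √(32 * Real.pi)) := by
    simp only [ν, hψ_zero, add_zero, coordCLM_apply, cubic_firstState]
  obtain ⟨C₁, hC₁⟩ := (hψ.differentiableAt hω).isBigO_sub.bound
  obtain ⟨C₂, hC₂⟩ := ((hν hψ).differentiableAt hω).isBigO_sub.bound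
  simp only [hψ_zero, hν_zero, sub_zero, Real.norm_eq_abs] at hC₁ hC₂
  obtain ⟨r, hr, hball⟩ := Metric.eventually_nhds_iff.1 ((continuous_pow 2).tendsto' (0 : ℝ) 0
    (by simp) |>.eventually (hsolves.and ((hψ.eventually (by simp)).and (hC₁.and hC₂))))
  replace hball {ε : ℝ} (hε : ε ∈ Set.Ioo (-r) r) := hball (by
    rwa [dist_zero_right, Real.norm_eq_abs, abs_lt] : dist ε 0 < r)
  refine ⟨fun ε => energyIncl (ε • (firstState + ψ (ε ^ 2))), fun ε => 1 + ε ^ 2 * ν (ε ^ 2), r,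
    hr, C₁, C₂, smoothInWeighted_energyIncl fun ε hε => ?_, fun ε hε => ?_, fun ε hε => ?_⟩
  · have hcomp := (hball hε).2.1.comp (f := (· ^ 2)) ε (contDiff_id.pow 2).contDiffAt
    exact ((contDiffAt_id.smul (contDiffAt_const.add hcomp)).of_le le_top).contDiffWithinAt
  · have hcomp := (hν (hball hε).2.1).comp (f := (· ^ 2)) ε (contDiff_id.pow 2).contDiffAt
    exact ((contDiffAt_const.add ((contDiff_id.pow 2).contDiffAt.mul hcomp)).of_le
      le_top).contDiffWithinAt
  · obtain ⟨hred, -, hψ_le, hν_le⟩ := hball hε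
    refine ⟨hred.isStationary, ?_, ?_⟩
    · calc weightedNorm (1 / 2) _ = |ε| * ‖ψ (ε ^ 2)‖ := by
            rw [weightedNorm_energyIncl_sub_single, smul_add, add_sub_cancel_left, norm_smul,
              Real.norm_eq_abs]
        _ ≤ |ε| * (C₁ * |ε ^ 2|) := by gcongr
        _ = C₁ * |ε| ^ 3 := by rw [abs_pow]; ring
    · calc |1 + ε ^ 2 * ν (ε ^ 2) - 1 - 3 * σ * ε ^ 2 / √(32 * Real.pi)|
          = |ε ^ 2| * |ν (ε ^ 2) - σ * (3 / √(32 * Real.pi))| := by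
            rw [← abs_mul]
            ring_nf
        _ ≤ |ε ^ 2| * (C₂ * |ε ^ 2|) := by gcongr
        _ = C₂ * ε ^ 4 := by rw [abs_of_nonneg (sq_nonneg ε)]; ring

end Existence

/-! ### Dark soliton families in weighted coordinates -/

section Family

open Filter Topology

/-- `W` represents the dark soliton family `(A, μ)` in weighted coordinates: the properties of the
family that survive without quantitative error bounds. -/
structure IsWeightedFamily (σ : ℝ) (A : ℝ → Ell2) (μ : ℝ → ℝ) (W : ℝ → Ell2) : Prop where
  eq_energyIncl : ∀ᶠ ε in 𝓝 0, A ε = energyIncl (W ε)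
  differentiableAt : ∀ᶠ ε in 𝓝 0, DifferentiableAt ℝ W ε ∧ DifferentiableAt ℝ μ ε
  isStationary : ∀ᶠ ε in 𝓝 0, IsStationary σ (μ ε) (W ε)
  tendsto_profile : Tendsto (fun ε => ε⁻¹ • W ε) (𝓝[≠] 0) (𝓝 firstState)
  tendsto_deriv : Tendsto (deriv W) (𝓝[≠] 0) (𝓝 firstState)
  tendsto_frequency :
    Tendsto (fun ε => (ε ^ 2)⁻¹ * (μ ε - 1)) (𝓝[≠] 0) (𝓝 (σ * (3 / √(32 * Real.pi))))

theorem eq_energyIncl_of_weighted {A W : Ell2}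
    (h : ∀ n : ℕ, W n = (1 + (n : ℝ)) ^ (1 / 2 : ℝ) * A n) : A = energyIncl W := by
  ext n
  rw [energyIncl_apply, h, ← mul_assoc, mul_comm (energyWeight n), rpow_half_mul_energyWeight,
    one_mul]

theorem hasDerivAt_zero_of_norm_sub_smul_le {E : Type*} [NormedAddCommGroup E] [NormedSpace ℝ E]
    {W : ℝ → E} {w : E} {C : ℝ} (h : ∀ᶠ ε in 𝓝 0, ‖W ε - ε • w‖ ≤ C * |ε| ^ 3) :
    W 0 = 0 ∧ HasDerivAt W w 0 := by
  have hzero : W 0 = 0 := by simpa using h.self_of_nhds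
  refine ⟨hzero, hasDerivAt_iff_isLittleO_nhds_zero.2 ?_⟩
  have hcube : (fun ε => W (0 + ε) - W 0 - ε • w) =O[𝓝 0] fun ε : ℝ => ε ^ 3 :=
    .of_bound C (h.mono fun ε hε => by simpa [hzero] using hε)
  refine hcube.trans_isLittleO ?_
  simpa using Asymptotics.isLittleO_pow_pow (𝕜 := ℝ) (m := 1) (n := 3) (by norm_num)

theorem tendsto_sq_nhdsNE_zero : Tendsto (fun ε : ℝ => ε ^ 2) (𝓝[≠] 0) (𝓝 0) :=
  ((continuous_pow 2).tendsto' 0 0 (by simp)).mono_left nhdsWithin_le_nhds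

theorem tendsto_inv_sq_mul_of_abs_sub_le {f : ℝ → ℝ} {c C : ℝ}
    (h : ∀ᶠ ε in 𝓝 0, |f ε - c * ε ^ 2| ≤ C * ε ^ 4) :
    Tendsto (fun ε => (ε ^ 2)⁻¹ * f ε) (𝓝[≠] 0) (𝓝 c) := by
  refine tendsto_sub_nhds_zero_iff.1 (squeeze_zero_norm' ?_
    (by simpa using tendsto_sq_nhdsNE_zero.const_mul C))
  filter_upwards [h.filter_mono nhdsWithin_le_nhds, self_mem_nhdsWithin] with ε hε hne
  have hsq : 0 < ε ^ 2 := sq_pos_of_ne_zero hne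
  have hfactor : (ε ^ 2)⁻¹ * f ε - c = (ε ^ 2)⁻¹ * (f ε - c * ε ^ 2) := by
    rw [mul_sub, mul_left_comm, inv_mul_cancel₀ hsq.ne', mul_one]
  rw [Real.norm_eq_abs, hfactor, abs_mul, abs_inv, abs_of_pos hsq, inv_mul_le_iff₀ hsq]
  linarith

theorem IsDarkSolitonFamily.exists_isWeightedFamily {σ : ℝ} {A : ℝ → Ell2} {μ : ℝ → ℝ}
    (h : IsDarkSolitonFamily σ A μ) : ∃ W, IsWeightedFamily σ A μ W := by
  obtain ⟨r, hr, C₁, C₂, ⟨W, hW, hW_smooth⟩, hμ_smooth, hroot⟩ := h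
  have hnhds : Set.Ioo (-r) r ∈ 𝓝 (0 : ℝ) := Ioo_mem_nhds (neg_lt_zero.2 hr) hr
  have hA (ε : ℝ) (hε : ε ∈ Set.Ioo (-r) r) : A ε = energyIncl (W ε) :=
    eq_energyIncl_of_weighted (hW ε hε)
  have hWdiff (ε : ℝ) (hε : ε ∈ Set.Ioo (-r) r) : ContDiffAt ℝ ∞ W ε :=
    hW_smooth.contDiffAt (Ioo_mem_nhds hε.1 hε.2)
  obtain ⟨hW_zero, hW_deriv⟩ := hasDerivAt_zero_of_norm_sub_smul_le (W := W) (w := firstState) <| by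
    filter_upwards [hnhds] with ε hε
    rw [← weightedNorm_energyIncl_sub_single, ← hA ε hε]
    exact (hroot ε hε).2.1
  refine ⟨W, ?_, ?_, ?_, ?_, ?_, tendsto_inv_sq_mul_of_abs_sub_le (C := C₂) ?_⟩
  · filter_upwards [hnhds] using hA
  · filter_upwards [hnhds] with ε hε
    exact ⟨(hWdiff ε hε).differentiableAt (by simp),
      (hμ_smooth.contDiffAt (Ioo_mem_nhds hε.1 hε.2)).differentiableAt (by simp)⟩
  · filter_upwards [hnhds] with ε hε
    rw [IsStationary, ← hA ε hε]
    exact (hroot ε hε).1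
  · simpa [hW_zero] using hW_deriv.tendsto_slope_zero
  · have hcont : ContinuousOn (deriv W) (Set.Ioo (-r) r) :=
      ((contDiffOn_infty_iff_deriv_of_isOpen isOpen_Ioo).1 hW_smooth).2.continuousOn
    rw [← hW_deriv.deriv]
    exact (hcont.continuousAt hnhds).tendsto.mono_left nhdsWithin_le_nhds
  · filter_upwards [hnhds] with ε hε
    convert (hroot ε hε).2.2 using 2
    ring

theorem hasDerivAt_cubic {W : ℝ → Ell2} {w : Ell2} {t : ℝ} (h : HasDerivAt W w t) :
    HasDerivAt (fun t => cubic (W t)) ((3 : ℝ) • potential (W t) (W t) (energyIncl w)) t := by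
  have hpotential : HasDerivAt (fun t => potential (W t)) (potential w) t :=
    HasFDerivAt.comp_hasDerivAt (l := potential) t potential.hasFDerivAt h
  refine ((hpotential.clm_apply h).clm_apply
    (energyIncl.hasFDerivAt.comp_hasDerivAt t h)).congr_deriv ?_
  rw [add_apply, potential_comm w, Function.comp_apply, potential_energyIncl_comm (W t) w]
  module

theorem linearised_equation {σ : ℝ} {W : ℝ → Ell2} {μ : ℝ → ℝ} {ε : ℝ}
    (h : ∀ᶠ t in 𝓝 ε, IsStationary σ (μ t) (W t)) (hW : DifferentiableAt ℝ W ε)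
    (hμ : DifferentiableAt ℝ μ ε) (n : ℕ) :
    (n - μ ε) * energyIncl (deriv W ε) n +
      3 * σ * potential (W ε) (W ε) (energyIncl (deriv W ε)) n =
        deriv μ ε * energyIncl (W ε) n := by
  have hprofile :=
    (coordCLM n ∘L energyIncl).hasFDerivAt.comp_hasDerivAt ε hW.hasDerivAt
  have hcubic := (coordCLM n).hasFDerivAt.comp_hasDerivAt ε (hasDerivAt_cubic hW.hasDerivAt)
  have hequation := ((hμ.hasDerivAt.const_sub (n : ℝ)).mul hprofile).add (hcubic.const_mul σ)
  have hconst : HasDerivAt (fun _ : ℝ => (0 : ℝ)) _ ε :=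
    hequation.congr_of_eventuallyEq (h.mono fun t ht => (ht.eq_zero n).symm)
  have hzero := hconst.unique (hasDerivAt_const ε (0 : ℝ))
  simp only [coordCLM_apply, map_smul, smul_eq_mul, Function.comp_apply,
    ContinuousLinearMap.comp_apply] at hzero
  linear_combination hzero

namespace IsWeightedFamily

variable {σ : ℝ} {A W : ℝ → Ell2} {μ : ℝ → ℝ}

theorem tendsto_potential (h : IsWeightedFamily σ A μ W) :
    Tendsto (fun ε => (ε ^ 2)⁻¹ • potential (W ε) (W ε)) (𝓝[≠] 0)
      (𝓝 (potential firstState firstState)) := by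
  have hcont : Continuous fun a : Ell2 => potential a a :=
    potential.continuous.clm_apply continuous_id
  refine ((hcont.tendsto firstState).comp h.tendsto_profile).congr fun ε => ?_
  simp only [Function.comp_apply, map_smul, smul_apply, smul_smul]
  rw [sq, mul_inv]

theorem eventually_linearised (h : IsWeightedFamily σ A μ W) : ∀ᶠ ε in 𝓝 0, ∀ n : ℕ,
    (n - μ ε) * energyIncl (deriv W ε) n +
      3 * σ * potential (W ε) (W ε) (energyIncl (deriv W ε)) n =
        deriv μ ε * energyIncl (W ε) n := by
  filter_upwards [h.isStationary.eventually_nhds, h.differentiableAt] with ε hstat hdiff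
  exact linearised_equation hstat hdiff.1 hdiff.2

/-- The component of the linearised equation along `e₁`, divided by `ε²`, tends to
`-σ K₁₁₁₁ + 3 σ K₁₁₁₁`. -/
theorem eventually_deriv_ne_zero (h : IsWeightedFamily σ A μ W) (hσ : σ ≠ 0) :
    ∀ᶠ ε in 𝓝[≠] 0, deriv μ ε ≠ 0 := by
  have hincl := (energyIncl.continuous.tendsto _).comp h.tendsto_deriv
  have hpotential := (isBoundedBilinearMap_apply (𝕜 := ℝ)).continuous.tendsto
    (potential firstState firstState, energyIncl firstState) |>.comp
      (h.tendsto_potential.prodMk_nhds hincl)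
  have hlimit := ((h.tendsto_frequency.const_sub 0).smul hincl).add (hpotential.const_smul (3 * σ))
  have hfirst := ((coordCLM 1).continuous.tendsto _).comp hlimit
  have hvalue : coordCLM 1 ((0 - σ * (3 / √(32 * Real.pi))) • energyIncl firstState +
      (3 * σ) • potential firstState firstState (energyIncl firstState)) =
        2 * σ * (3 / √(32 * Real.pi)) := by
    rw [map_add, map_smul, map_smul, coordCLM_apply, coordCLM_apply, ← cubic, cubic_firstState,
      energyIncl_firstState, basisVec_self, smul_eq_mul, smul_eq_mul]
    ring
  rw [hvalue] at hfirst
  filter_upwards [hfirst.eventually_ne (by positivity),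
    h.eventually_linearised.filter_mono nhdsWithin_le_nhds] with ε hne hlin hzero
  apply hne
  have hlin_one := hlin 1
  rw [hzero, zero_mul] at hlin_one
  push_cast at hlin_one
  simp only [Function.comp_apply, coordCLM_apply, smul_apply, lp.coeFn_add, lp.coeFn_smul,
    Pi.add_apply, Pi.smul_apply, smul_eq_mul]
  linear_combination (ε ^ 2)⁻¹ * hlin_one

theorem eventually_inner_deriv_ne_zero (h : IsWeightedFamily σ A μ W) :
    ∀ᶠ ε in 𝓝[≠] 0, inner ℝ (energyIncl (W ε)) (energyIncl (deriv W ε)) ≠ 0 := by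
  have hlimit := ((energyIncl.continuous.tendsto _).comp h.tendsto_profile).inner (𝕜 := ℝ)
    ((energyIncl.continuous.tendsto _).comp h.tendsto_deriv)
  have hvalue : inner ℝ (energyIncl firstState) (energyIncl firstState) ≠ 0 := by
    rw [energyIncl_firstState, inner_basisVec_left, basisVec_self]
    exact one_ne_zero
  filter_upwards [hlimit.eventually_ne hvalue] with ε hne hzero
  simp [inner_smul_left, hzero] at hne

theorem eventually_dMu_eq (h : IsWeightedFamily σ A μ W) : ∀ᶠ ε in 𝓝 0,
    DifferentiableAt ℝ A ε ∧ dMu A μ ε = (deriv μ ε)⁻¹ • energyIncl (deriv W ε) := by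
  filter_upwards [h.eq_energyIncl.eventually_nhds, h.differentiableAt] with ε hA hdiff
  have hderiv : HasDerivAt A (energyIncl (deriv W ε)) ε :=
    (energyIncl.hasFDerivAt.comp_hasDerivAt ε hdiff.1.hasDerivAt).congr_of_eventuallyEq hA
  exact ⟨hderiv.differentiableAt, by rw [dMu, hderiv.deriv]⟩

end IsWeightedFamily

end Family

/-! ### The dipole mode of the harmonic trap -/

section Dipole

variable {σ μ : ℝ} {a : Ell2}

theorem ladderCoeff_mul_natCast_pred (n : ℕ) :
    ladderCoeff n * ((n - 1 : ℕ) : ℝ) = ladderCoeff n * (n - 1) := by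
  cases n <;> simp [ladderCoeff]

theorem positionOp_apply (a : Ell2) (n : ℕ) : positionOp a n =
    ladderCoeff (n + 1) * energyIncl a (n + 1) + ladderCoeff n * energyIncl a (n - 1) := by
  rw [energyIncl_apply, energyIncl_apply, ← mul_assoc, ← mul_assoc, ← lowerOp_apply,
    ← raiseOp_apply]
  rfl

theorem derivOp_apply (a : Ell2) (n : ℕ) : derivOp a n =
    ladderCoeff (n + 1) * energyIncl a (n + 1) - ladderCoeff n * energyIncl a (n - 1) := by
  rw [energyIncl_apply, energyIncl_apply, ← mul_assoc, ← mul_assoc, ← lowerOp_apply,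
    ← raiseOp_apply]
  rfl

theorem IsStationary.linearised_derivOp (h : IsStationary σ μ a) (n : ℕ) :
    (n - μ) * derivOp a n + 3 * σ * potential a a (derivOp a) n = -positionOp a n := by
  have hcubic : 3 * potential a a (derivOp a) n =
      ladderCoeff (n + 1) * cubic a (n + 1) - ladderCoeff n * cubic a (n - 1) := by
    rw [cubic, ← potential_derivOp]
    ring
  have habove := h.eq_zero (n + 1)
  push_cast at habove
  rw [derivOp_apply, positionOp_apply]
  linear_combination σ * hcubic + ladderCoeff (n + 1) * habove
    - ladderCoeff n * h.eq_zero (n - 1)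
    + energyIncl a (n - 1) * ladderCoeff_mul_natCast_pred n

theorem IsStationary.linearised_positionOp (h : IsStationary σ μ a) (n : ℕ) :
    (n - μ) * positionOp a n + σ * potential a a (positionOp a) n = -derivOp a n := by
  have hcubic : potential a a (positionOp a) n =
      ladderCoeff n * cubic a (n - 1) + ladderCoeff (n + 1) * cubic a (n + 1) := by
    rw [cubic, ← potential_positionOp]
  have habove := h.eq_zero (n + 1)
  push_cast at habove
  rw [derivOp_apply, positionOp_apply]
  linear_combination σ * hcubic + ladderCoeff (n + 1) * habove
    + ladderCoeff n * h.eq_zero (n - 1)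
    - energyIncl a (n - 1) * ladderCoeff_mul_natCast_pred n

theorem eq_zero_of_positionOp_derivOp_eq_zero (hposition : positionOp a = 0)
    (hderiv : derivOp a = 0) : a = 0 := by
  ext n
  have hadd := positionOp_apply a (n + 1)
  have hsub := derivOp_apply a (n + 1)
  rw [hposition, lp.coeFn_zero, Pi.zero_apply, Nat.add_sub_cancel] at hadd
  rw [hderiv, lp.coeFn_zero, Pi.zero_apply, Nat.add_sub_cancel, energyIncl_apply a n] at hsub
  rw [energyIncl_apply a n] at hadd
  have hcoeff : ladderCoeff (n + 1) ≠ 0 := (Real.sqrt_pos.2 (by positivity)).ne'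
  have hprod : ladderCoeff (n + 1) * (energyWeight n * a n) = 0 := by linarith
  simpa [hcoeff, (energyWeight_pos n).ne'] using hprod

end Dipole

/-! ### The linear problem in mode coordinates -/

section PairSpace

theorem inner_pair (B C B' C' : Ell2) :
    inner ℝ (pair B C) (pair B' C') = inner ℝ B B' + inner ℝ C C' := rfl

theorem pair_fst_snd (x : Ell2Pair) : pair x.fst x.snd = x := rfl

theorem pair_fst (B C : Ell2) : (pair B C).fst = B := rfl

theorem pair_snd (B C : Ell2) : (pair B C).snd = C := rfl

theorem smul_pair (c : ℝ) (B C : Ell2) : c • pair B C = pair (c • B) (c • C) := rfl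

theorem pair_eq_zero {B C : Ell2} : pair B C = 0 ↔ B = 0 ∧ C = 0 := by
  rw [pair, WithLp.toLp_eq_zero, Prod.mk_eq_zero]

/-- The off-diagonal operator matrix `[[0, S], [T, 0]]` on `l²(ℕ, ℝ²)`. -/
noncomputable def offDiagonal (S T : Ell2 →L[ℝ] Ell2) : Ell2Pair →L[ℝ] Ell2Pair :=
  ((WithLp.prodContinuousLinearEquiv 2 ℝ Ell2 Ell2).symm : Ell2 × Ell2 →L[ℝ] Ell2Pair) ∘L
    (S ∘L WithLp.sndL 2 ℝ Ell2 Ell2).prod (T ∘L WithLp.fstL 2 ℝ Ell2 Ell2)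

theorem offDiagonal_apply (S T : Ell2 →L[ℝ] Ell2) (x : Ell2Pair) :
    offDiagonal S T x = pair (S x.snd) (T x.fst) := rfl

theorem norm_offDiagonal_le {S T : Ell2 →L[ℝ] Ell2} {M : ℝ} (hS : ‖S‖ ≤ M) (hT : ‖T‖ ≤ M) :
    ‖offDiagonal S T‖ ≤ M := by
  have hM : 0 ≤ M := (norm_nonneg S).trans hS
  refine ContinuousLinearMap.opNorm_le_bound _ hM fun x => ?_
  refine abs_le_of_sq_le_sq' ?_ (by positivity) |>.2
  rw [mul_pow, offDiagonal_apply, WithLp.prod_norm_sq_eq_of_L2, WithLp.prod_norm_sq_eq_of_L2]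
  have hsnd := pow_le_pow_left₀ (norm_nonneg _) (S.le_of_opNorm_le hS x.snd) 2
  have hfst := pow_le_pow_left₀ (norm_nonneg _) (T.le_of_opNorm_le hT x.fst) 2
  rw [pair_fst, pair_snd]
  linarith

end PairSpace

section ModeCoordinates

theorem exists_level_eq_modeSign_eq_one (n : ℕ) : ∃ i, level i = n ∧ modeSign i = 1 := by
  match n with
  | 0 => exact ⟨.inr (.inl 0), rfl, rfl⟩
  | 1 => exact ⟨.inr (.inr 0), rfl, rfl⟩
  | n + 2 => exact ⟨.inl (n + 1), rfl, rfl⟩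

theorem exists_level_eq_modeSign_eq_neg_one (n : ℕ) : ∃ i, level i = n ∧ modeSign i = -1 := by
  match n with
  | 0 => exact ⟨.inl 0, rfl, rfl⟩
  | 1 => exact ⟨.inr (.inr 1), rfl, rfl⟩
  | n + 2 => exact ⟨.inr (.inl (n + 1)), rfl, rfl⟩

theorem modeSign_eq_one_or_neg_one (i : Mode) : modeSign i = 1 ∨ modeSign i = -1 :=
  mul_self_eq_one_iff.1 (modeSign_mul_self i)

theorem mode_ext {i j : Mode} (hlevel : level i = level j) (hsign : modeSign i = modeSign j) :
    i = j := by
  rcases i with (_ | m) | (_ | m) | i <;> rcases j with (_ | k) | (_ | k) | j <;>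
    try fin_cases i
  all_goals try fin_cases j
  all_goals simp_all [level, modeSign]

theorem forall_mode_iff {f g f' g' : ℕ → ℝ} :
    (∀ i, f (level i) + modeSign i * g (level i) = f' (level i) + modeSign i * g' (level i)) ↔
      ∀ n, f n = f' n ∧ g n = g' n := by
  refine ⟨fun h n => ?_, fun h i => by rw [(h _).1, (h _).2]⟩
  obtain ⟨i, hi, hi_sign⟩ := exists_level_eq_modeSign_eq_one n
  obtain ⟨j, hj, hj_sign⟩ := exists_level_eq_modeSign_eq_neg_one n
  have hplus := h i
  have hminus := h j
  rw [hi, hi_sign] at hplus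
  rw [hj, hj_sign] at hminus
  push_cast at hplus hminus
  constructor <;> linarith

/-- The unit eigenvector of a mode at `ε = 0`. -/
noncomputable def modeVec (i : Mode) : Ell2Pair :=
  pair ((√2)⁻¹ • basisVec (level i)) (((√2)⁻¹ * modeSign i) • basisVec (level i))

theorem inv_sqrt_two_mul_self : (√2)⁻¹ * (√2)⁻¹ = (1 / 2 : ℝ) := by
  rw [← mul_inv, Real.mul_self_sqrt zero_le_two, one_div]

theorem inner_modeVec (i : Mode) (x : Ell2Pair) :
    inner ℝ (modeVec i) x = (√2)⁻¹ * (x.fst (level i) + modeSign i * x.snd (level i)) := by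
  rw [← pair_fst_snd x, modeVec, inner_pair, inner_smul_left, inner_smul_left,
    inner_basisVec_left, inner_basisVec_left, pair_fst, pair_snd, conj_trivial, conj_trivial]
  ring

theorem orthonormal_modeVec : Orthonormal ℝ modeVec := by
  rw [orthonormal_iff_ite]
  intro i j
  have hinner : inner ℝ (modeVec i) (modeVec j) =
      1 / 2 * (1 + modeSign i * modeSign j) * basisVec (level j) (level i) := by
    rw [inner_modeVec, ← inv_sqrt_two_mul_self, modeVec, pair_fst, pair_snd, lp.coeFn_smul,
      lp.coeFn_smul, Pi.smul_apply, Pi.smul_apply, smul_eq_mul, smul_eq_mul]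
    ring
  rw [hinner]
  rcases eq_or_ne i j with rfl | hij
  · have hsign : (modeSign i : ℝ) * modeSign i = 1 := by exact_mod_cast modeSign_mul_self i
    rw [if_pos rfl, basisVec_self, hsign]
    norm_num
  rw [if_neg hij]
  rcases eq_or_ne (level i) (level j) with hlevel | hlevel
  · have hsign : (modeSign i : ℝ) * modeSign j = -1 := by
      rcases modeSign_eq_one_or_neg_one i with hi | hi <;>
        rcases modeSign_eq_one_or_neg_one j with hj | hj
      · exact (hij (mode_ext hlevel (hi.trans hj.symm))).elim
      · simp [hi, hj]
      · simp [hi, hj]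
      · exact (hij (mode_ext hlevel (hi.trans hj.symm))).elim
    rw [hsign]
    ring
  · rw [basisVec_of_ne hlevel, mul_zero]

theorem orthogonal_span_range_modeVec : (Submodule.span ℝ (Set.range modeVec))ᗮ = ⊥ := by
  refine (Submodule.eq_bot_iff _).2 fun x hx => ?_
  have hmode (i : Mode) : x.fst (level i) + modeSign i * x.snd (level i) = 0 := by
    have hinner := (Submodule.mem_orthogonal _ _).1 hx _ (Submodule.subset_span ⟨i, rfl⟩)
    rw [inner_modeVec] at hinner
    exact (mul_eq_zero.1 hinner).resolve_left (by positivity)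
  have hcoord := forall_mode_iff (f' := 0) (g' := 0).1 fun i => by simpa using hmode i
  rw [← pair_fst_snd x, pair_eq_zero]
  exact ⟨lp.ext (funext fun n => (hcoord n).1), lp.ext (funext fun n => (hcoord n).2)⟩

/-- The Hilbert basis of eigenvectors at `ε = 0`, as an isometry onto the coordinate space. -/
noncomputable def modeEquiv : Ell2Pair ≃ₗᵢ[ℝ] L2 Mode :=
  (HilbertBasis.mkOfOrthogonalEqBot orthonormal_modeVec orthogonal_span_range_modeVec).repr

theorem modeEquiv_apply (x : Ell2Pair) (i : Mode) :
    modeEquiv x i = (√2)⁻¹ * (x.fst (level i) + modeSign i * x.snd (level i)) := by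
  rw [← inner_modeVec, modeEquiv, HilbertBasis.repr_apply_apply,
    HilbertBasis.coe_mkOfOrthogonalEqBot]

theorem modeEquiv_symm_basisVec (i : Mode) : modeEquiv.symm (basisVec i) = modeVec i := by
  refine modeEquiv.symm_apply_eq.2 (lp.ext (funext fun j => ?_))
  rw [modeEquiv_apply, ← inner_modeVec, orthonormal_iff_ite.1 orthonormal_modeVec, basisVec_apply]

/-- The pair `x` is in the domain of `[B, C] ↦ [L₋ C, L₊ B]`, with image `z`, where `V` is the
potential. -/
def HamMaps (σ μ : ℝ) (V : Ell2 →L[ℝ] Ell2) (x z : Ell2Pair) : Prop :=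
  ∀ n : ℕ, (n - μ) * x.snd n + σ * V x.snd n = z.fst n ∧
    (n - μ) * x.fst n + 3 * σ * V x.fst n = z.snd n

/-- The bound on the distance between the linear problem and the problem at `ε = 0`. -/
noncomputable def perturbationSize (σ μ : ℝ) (V : Ell2 →L[ℝ] Ell2) : ℝ :=
  3 * |σ| * ‖V‖ + |μ - 1|

/-- The difference between the linear problem and the problem at `ε = 0`, in mode coordinates. -/
noncomputable def modePerturbation (σ μ : ℝ) (V : Ell2 →L[ℝ] Ell2) : L2 Mode →L[ℝ] L2 Mode :=
  (modeEquiv : Ell2Pair →L[ℝ] L2 Mode) ∘L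
    offDiagonal (σ • V - (μ - 1) • .id ℝ Ell2) ((3 * σ) • V - (μ - 1) • .id ℝ Ell2) ∘L
      (modeEquiv.symm : L2 Mode →L[ℝ] Ell2Pair)

variable (σ μ : ℝ) (V : Ell2 →L[ℝ] Ell2)

theorem modePerturbation_apply (y : L2 Mode) (i : Mode) : modePerturbation σ μ V y i =
    (√2)⁻¹ * ((σ * V (modeEquiv.symm y).snd (level i) -
        (μ - 1) * (modeEquiv.symm y).snd (level i)) +
      modeSign i * (3 * σ * V (modeEquiv.symm y).fst (level i) -
        (μ - 1) * (modeEquiv.symm y).fst (level i))) :=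
  modeEquiv_apply _ _

theorem norm_smul_sub_smul_id_le {c : ℝ} (hc : |c| ≤ 3 * |σ|) :
    ‖c • V - (μ - 1) • .id ℝ Ell2‖ ≤ perturbationSize σ μ V :=
  calc ‖c • V - (μ - 1) • .id ℝ Ell2‖ ≤ |c| * ‖V‖ + |μ - 1| * ‖ContinuousLinearMap.id ℝ Ell2‖ := by
        refine (norm_sub_le _ _).trans_eq ?_
        rw [norm_smul, norm_smul, Real.norm_eq_abs, Real.norm_eq_abs]
    _ ≤ 3 * |σ| * ‖V‖ + |μ - 1| * 1 := by
        gcongr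
        exact ContinuousLinearMap.norm_id_le
    _ = perturbationSize σ μ V := by rw [perturbationSize, mul_one]

theorem norm_modePerturbation_le : ‖modePerturbation σ μ V‖ ≤ perturbationSize σ μ V := by
  have hnorm := norm_offDiagonal_le
    (norm_smul_sub_smul_id_le σ μ V (c := σ) (by linarith [abs_nonneg σ]))
    (norm_smul_sub_smul_id_le σ μ V (c := 3 * σ) (by rw [abs_mul]; norm_num))
  refine ContinuousLinearMap.opNorm_le_bound _ ((norm_nonneg _).trans hnorm) fun y => ?_
  calc ‖modePerturbation σ μ V y‖ = ‖offDiagonal _ _ (modeEquiv.symm y)‖ := modeEquiv.norm_map _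
    _ ≤ perturbationSize σ μ V * ‖modeEquiv.symm y‖ := ContinuousLinearMap.le_of_opNorm_le _ hnorm _
    _ = perturbationSize σ μ V * ‖y‖ := by rw [modeEquiv.symm.norm_map]

variable {σ μ V}

theorem hamMaps_iff_diagAddMaps {x z : Ell2Pair} : HamMaps σ μ V x z ↔
    DiagAddMaps freq (modePerturbation σ μ V) (modeEquiv x) (modeEquiv z) := by
  have hcoord (i : Mode) : (freq i : ℝ) * modeEquiv x i + modePerturbation σ μ V (modeEquiv x) i =
      (√2)⁻¹ * (((level i - μ) * x.snd (level i) + σ * V x.snd (level i)) +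
        modeSign i * ((level i - μ) * x.fst (level i) + 3 * σ * V x.fst (level i))) := by
    have hsign : (modeSign i : ℝ) * modeSign i = 1 := by exact_mod_cast modeSign_mul_self i
    rw [modePerturbation_apply, modeEquiv_apply, modeEquiv.symm_apply_apply, freq]
    push_cast
    linear_combination (√2)⁻¹ * (level i - 1) * x.snd (level i) * hsign
  have hne : (√2)⁻¹ ≠ (0 : ℝ) := by positivity
  refine forall_mode_iff.symm.trans (forall_congr' fun i => ?_)
  rw [hcoord, modeEquiv_apply, mul_right_inj' hne]

theorem modePerturbation_basisVec_self (i : Mode) :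
    modePerturbation σ μ V (basisVec i) i =
      modeSign i * (2 * σ * V (basisVec (level i)) (level i) - (μ - 1)) := by
  rw [modePerturbation_apply, modeEquiv_symm_basisVec, modeVec, pair_fst, pair_snd]
  simp only [map_smul, lp.coeFn_smul, Pi.smul_apply, smul_eq_mul, basisVec_self]
  linear_combination (modeSign i : ℝ) *
    (4 * σ * V (basisVec (level i)) (level i) - 2 * (μ - 1)) * inv_sqrt_two_mul_self

end ModeCoordinates

/-! ### Eigenvectors of the linear problem -/

section Hamiltonian

variable {σ μ ν : ℝ} {V : Ell2 →L[ℝ] Ell2} {A A' : Ell2} {Ω : ℕ → ℝ} {B C : ℕ → Ell2}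

namespace HamMaps

theorem sub {x z x' z' : Ell2Pair} (h : HamMaps σ μ V x z) (h' : HamMaps σ μ V x' z') :
    HamMaps σ μ V (x - x') (z - z') := by
  rw [hamMaps_iff_diagAddMaps, map_sub, map_sub]
  exact (hamMaps_iff_diagAddMaps.1 h).sub (hamMaps_iff_diagAddMaps.1 h')

theorem smul {x z : Ell2Pair} (c : ℝ) (h : HamMaps σ μ V x z) :
    HamMaps σ μ V (c • x) (c • z) := by
  rw [hamMaps_iff_diagAddMaps, map_smul, map_smul]
  exact (hamMaps_iff_diagAddMaps.1 h).smul c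

theorem reflect {B C : Ell2} (h : HamMaps σ μ V (pair B C) (ν • pair B C)) :
    HamMaps σ μ V (pair B (-C)) ((-ν) • pair B (-C)) := fun n => by
  obtain ⟨hfst, hsnd⟩ := h n
  simp only [smul_pair, pair_fst, pair_snd, map_neg, lp.coeFn_neg, lp.coeFn_smul, Pi.neg_apply,
    Pi.smul_apply, smul_eq_mul] at hfst hsnd ⊢
  constructor <;> linarith

end HamMaps

theorem inner_eq_of_isSelfAdjoint (hV : IsSelfAdjoint V) {c : ℝ} {x y z w : Ell2}
    (hx : ∀ n : ℕ, (n - μ) * x n + c * V x n = z n)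
    (hy : ∀ n : ℕ, (n - μ) * y n + c * V y n = w n) : inner ℝ z y = inner ℝ x w := by
  have hoscillator : inner ℝ (z - c • V x) y = inner ℝ x (w - c • V y) := by
    rw [lp.inner_eq_tsum, lp.inner_eq_tsum]
    refine tsum_congr fun n => ?_
    simp only [lp.coeFn_sub, Pi.sub_apply, lp.coeFn_smul, Pi.smul_apply, smul_eq_mul, ← hx n,
      ← hy n, add_sub_cancel_right, RCLike.inner_apply, conj_trivial]
    ring
  have hVxy : inner ℝ (V x) y = inner ℝ x (V y) := hV.isSymmetric x y
  rw [inner_sub_left, inner_sub_right, inner_smul_left, inner_smul_right, hVxy,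
    conj_trivial] at hoscillator
  linarith

namespace HamMaps

theorem inner_fst_eq {x z x' z' : Ell2Pair} (hV : IsSelfAdjoint V) (h : HamMaps σ μ V x z)
    (h' : HamMaps σ μ V x' z') : inner ℝ z.fst x'.snd = inner ℝ x.snd z'.fst :=
  inner_eq_of_isSelfAdjoint hV (fun n => (h n).1) fun n => (h' n).1

theorem inner_snd_eq {x z x' z' : Ell2Pair} (hV : IsSelfAdjoint V) (h : HamMaps σ μ V x z)
    (h' : HamMaps σ μ V x' z') : inner ℝ z.snd x'.fst = inner ℝ x.fst z'.snd :=
  inner_eq_of_isSelfAdjoint hV (fun n => (h n).2) fun n => (h' n).2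

theorem inner_eq_zero_of_ne {ν' : ℝ} {x x' : Ell2Pair} (hV : IsSelfAdjoint V)
    (h : HamMaps σ μ V x (ν • x)) (h' : HamMaps σ μ V x' (ν' • x')) (hν : 0 < ν) (hν' : 0 < ν')
    (hne : ν ≠ ν') : inner ℝ x.fst x'.snd = 0 := by
  have hfst := h.inner_fst_eq hV h'
  have hsnd := h.inner_snd_eq hV h'
  simp only [WithLp.smul_fst, WithLp.smul_snd, inner_smul_left, inner_smul_right,
    conj_trivial] at hfst hsnd
  have hprod : ((ν - ν') * (ν + ν')) * inner ℝ x.fst x'.snd = 0 := by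
    linear_combination ν * hfst + ν' * hsnd
  exact (mul_eq_zero.1 hprod).resolve_left (mul_ne_zero (sub_ne_zero.2 hne) (by positivity))

end HamMaps

/-- `L₋ A = 0` and `L₊ A' = A` with `A ≠ 0`: the Jordan chain at the eigenvalue zero that comes from
the gauge symmetry. -/
structure IsKernelChain (σ μ : ℝ) (V : Ell2 →L[ℝ] Ell2) (A A' : Ell2) : Prop where
  ne_zero : A ≠ 0
  ker : HamMaps σ μ V (pair 0 A) 0
  gen_ker : HamMaps σ μ V (pair A' 0) (pair 0 A)

namespace IsKernelChain

theorem gen_ne_zero (h : IsKernelChain σ μ V A A') : A' ≠ 0 := by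
  rintro rfl
  refine h.ne_zero (lp.ext (funext fun n => ?_))
  simpa [pair_fst, pair_snd] using (h.gen_ker n).2.symm

theorem inner_fst_eq_zero {x : Ell2Pair} (h : IsKernelChain σ μ V A A') (hV : IsSelfAdjoint V)
    (hx : HamMaps σ μ V x (ν • x)) (hν : ν ≠ 0) : inner ℝ x.fst A = 0 := by
  have hinner := hx.inner_fst_eq hV h.ker
  simpa [pair_snd, inner_smul_left, hν] using hinner

theorem inner_snd_eq_zero {x : Ell2Pair} (h : IsKernelChain σ μ V A A') (hV : IsSelfAdjoint V)
    (hx : HamMaps σ μ V x (ν • x)) (hν : ν ≠ 0) : inner ℝ x.snd A' = 0 := by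
  have hinner := hx.inner_snd_eq hV h.gen_ker
  rw [pair_fst, pair_snd, h.inner_fst_eq_zero hV hx hν] at hinner
  simpa [inner_smul_left, hν] using hinner

end IsKernelChain

/-- Eigenvectors `[B m, C m]` of the linear problem for distinct positive eigenvalues `Ω m`. -/
structure IsPosEigensystem (σ μ : ℝ) (V : Ell2 →L[ℝ] Ell2) (Ω : ℕ → ℝ) (B C : ℕ → Ell2) :
    Prop where
  injective : Function.Injective Ω
  pos : ∀ m, 0 < Ω m
  ne_zero : ∀ m, pair (B m) (C m) ≠ 0
  maps : ∀ m, HamMaps σ μ V (pair (B m) (C m)) (Ω m • pair (B m) (C m))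

namespace IsPosEigensystem

theorem inner_eq_zero_of_ne (h : IsPosEigensystem σ μ V Ω B C) (hV : IsSelfAdjoint V) {j k : ℕ}
    (hjk : j ≠ k) : inner ℝ (B j) (C k) = 0 :=
  (h.maps j).inner_eq_zero_of_ne hV (h.maps k) (h.pos j) (h.pos k) (h.injective.ne hjk)

theorem eq_zero_of_inner_eq_zero (h : IsPosEigensystem σ μ V Ω B C) (hV : IsSelfAdjoint V)
    (hchain : IsKernelChain σ μ V A A') (hbasis : IsScaledRieszBasis (completeSet B C A A'))
    {x : Ell2Pair} (hx : HamMaps σ μ V x (ν • x)) (hν : ν ≠ 0)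
    (hinner : ∀ m, inner ℝ x.fst (C m) = 0) : x = 0 := by
  have hinner' (m : ℕ) : inner ℝ x.snd (B m) = 0 := by
    have hsymm := hx.inner_fst_eq hV (h.maps m)
    simpa [pair_fst, pair_snd, inner_smul_left, inner_smul_right, hinner, (h.pos m).ne'] using hsymm
  have hswap : pair x.snd x.fst = 0 := hbasis.eq_zero_of_inner_eq_zero <| by
    rintro (m | m | i)
    · change inner ℝ (pair x.snd x.fst) (pair (B m) (C m)) = 0
      rw [inner_pair, hinner, hinner', add_zero]
    · change inner ℝ (pair x.snd x.fst) (pair (B m) (-C m)) = 0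
      rw [inner_pair, inner_neg_right, hinner, hinner', neg_zero, add_zero]
    · fin_cases i
      · change inner ℝ (pair x.snd x.fst) (pair 0 A) = 0
        rw [inner_pair, inner_zero_right, hchain.inner_fst_eq_zero hV hx hν, add_zero]
      · change inner ℝ (pair x.snd x.fst) (pair A' 0) = 0
        rw [inner_pair, inner_zero_right, hchain.inner_snd_eq_zero hV hx hν, add_zero]
  rw [← pair_fst_snd x, pair_eq_zero]
  exact (pair_eq_zero.1 hswap).symm

theorem inner_ne_zero (h : IsPosEigensystem σ μ V Ω B C) (hV : IsSelfAdjoint V)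
    (hchain : IsKernelChain σ μ V A A') (hbasis : IsScaledRieszBasis (completeSet B C A A'))
    (m : ℕ) : inner ℝ (B m) (C m) ≠ 0 := fun hzero =>
  h.ne_zero m <| h.eq_zero_of_inner_eq_zero hV hchain hbasis (h.maps m) (h.pos m).ne' fun k => by
    rcases eq_or_ne m k with rfl | hmk
    exacts [hzero, h.inner_eq_zero_of_ne hV hmk]

theorem exists_eq_smul (h : IsPosEigensystem σ μ V Ω B C) (hV : IsSelfAdjoint V)
    (hchain : IsKernelChain σ μ V A A') (hbasis : IsScaledRieszBasis (completeSet B C A A'))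
    {x : Ell2Pair} (hx : HamMaps σ μ V x (ν • x)) (hν : 0 < ν) (hx_ne : x ≠ 0) :
    ∃ m, ν = Ω m ∧ ∃ c : ℝ, x = c • pair (B m) (C m) := by
  obtain ⟨m, hm⟩ : ∃ m, inner ℝ x.fst (C m) ≠ 0 := by
    by_contra! hinner
    exact hx_ne (h.eq_zero_of_inner_eq_zero hV hchain hbasis hx hν.ne' hinner)
  have hνm : ν = Ω m := by
    by_contra hne
    exact hm (hx.inner_eq_zero_of_ne hV (h.maps m) hν (h.pos m) hne)
  set c := inner ℝ x.fst (C m) / inner ℝ (B m) (C m) with hc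
  refine ⟨m, hνm, c, sub_eq_zero.1 ?_⟩
  have hdiff : HamMaps σ μ V (x - c • pair (B m) (C m)) (ν • (x - c • pair (B m) (C m))) := by
    rw [smul_sub, smul_comm ν, hνm]
    exact (hνm ▸ hx).sub ((h.maps m).smul c)
  refine h.eq_zero_of_inner_eq_zero hV hchain hbasis hdiff hν.ne' fun k => ?_
  rcases eq_or_ne m k with rfl | hmk
  · rw [WithLp.sub_fst, WithLp.smul_fst, pair_fst, inner_sub_left, inner_smul_left, conj_trivial,
      hc, div_mul_cancel₀ _ (h.inner_ne_zero hV hchain hbasis m), sub_self]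
  · exact hdiff.inner_eq_zero_of_ne hV (h.maps k) hν (h.pos k)
      (hνm ▸ h.injective.ne hmk)

end IsPosEigensystem

theorem IsScaledRieszBasis.completeSet_of_eq_smul {B₀ C₀ : ℕ → Ell2} (p : ℕ ≃ ℕ) {c : ℕ → ℝ}
    (hbasis : IsScaledRieszBasis (completeSet B₀ C₀ A A')) (hc : ∀ m, c m ≠ 0)
    (h : ∀ m, pair (B m) (C m) = c m • pair (B₀ (p m)) (C₀ (p m))) :
    IsScaledRieszBasis (completeSet B C A A') := by
  refine (hbasis.reindex (p.sumCongr (p.sumCongr (.refl (Fin 2))))).smul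
    (c := Sum.elim c (Sum.elim c fun _ => 1)) ?_ ?_
  · rintro (m | m | _)
    exacts [hc m, hc m, one_ne_zero]
  · rintro (m | m | _)
    · exact h m
    · have hB : B m = c m • B₀ (p m) := congrArg WithLp.fst (h m)
      have hC : C m = c m • C₀ (p m) := congrArg WithLp.snd (h m)
      change pair (B m) (-C m) = c m • pair (B₀ (p m)) (-C₀ (p m))
      rw [smul_pair, smul_neg, ← hB, ← hC]
    · exact (one_smul ℝ _).symm

theorem IsPosEigensystem.isScaledRieszBasis_of_range_subset {Ω₀ : ℕ → ℝ} {B₀ C₀ : ℕ → Ell2}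
    (h : IsPosEigensystem σ μ V Ω B C) (h₀ : IsPosEigensystem σ μ V Ω₀ B₀ C₀)
    (hV : IsSelfAdjoint V) (hchain : IsKernelChain σ μ V A A')
    (hbasis : IsScaledRieszBasis (completeSet B₀ C₀ A A')) (hrange : Set.range Ω₀ ⊆ Set.range Ω) :
    IsScaledRieszBasis (completeSet B C A A') := by
  choose p hp c hc using fun m =>
    h₀.exists_eq_smul hV hchain hbasis (h.maps m) (h.pos m) (h.ne_zero m)
  have hbijective : Function.Bijective p := by
    refine ⟨fun m k hmk => h.injective (by rw [hp, hp, hmk]), fun k => ?_⟩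
    obtain ⟨m, hm⟩ := hrange ⟨k, rfl⟩
    exact ⟨m, h₀.injective (by rw [← hp, hm])⟩
  exact hbasis.completeSet_of_eq_smul (.ofBijective p hbijective)
    (fun m hzero => h.ne_zero m (by rw [hc, hzero, zero_smul])) hc

theorem completeSet_ne_zero (hne : ∀ m, pair (B m) (C m) ≠ 0) (hA : A ≠ 0) (hA' : A' ≠ 0)
    (i : ℕ ⊕ ℕ ⊕ Fin 2) : completeSet B C A A' i ≠ 0 := by
  rcases i with m | m | i
  · exact hne m
  · intro hzero
    obtain ⟨hB, hC⟩ := pair_eq_zero.1 hzero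
    exact hne m (pair_eq_zero.2 ⟨hB, neg_eq_zero.1 hC⟩)
  · fin_cases i
    · exact fun hzero => hA (pair_eq_zero.1 hzero).2
    · exact fun hzero => hA' (pair_eq_zero.1 hzero).1

theorem IsKernelChain.isModeSystem (hchain : IsKernelChain σ μ V A A')
    (hclose : ∀ m, |(freq (.inl m) : ℝ) - Ω m| < 1 / 2) (hdistinct : Ω 0 ≠ Ω 1)
    (hne : ∀ m, pair (B m) (C m) ≠ 0)
    (hmaps : ∀ m, HamMaps σ μ V (pair (B m) (C m)) (Ω m • pair (B m) (C m))) :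
    IsModeSystem (modePerturbation σ μ V) Ω fun i => modeEquiv (completeSet B C A A' i) where
  ne_zero i := by
    simpa using completeSet_ne_zero hne hchain.ne_zero hchain.gen_ne_zero i
  close := hclose
  distinct := hdistinct
  pos m := by
    rw [← map_smul, ← hamMaps_iff_diagAddMaps]
    exact hmaps m
  neg m := by
    rw [← map_smul, ← hamMaps_iff_diagAddMaps]
    exact (hmaps m).reflect
  ker := by
    have hker := hamMaps_iff_diagAddMaps.1 hchain.ker
    rwa [map_zero] at hker
  gen_ker := hamMaps_iff_diagAddMaps.1 hchain.gen_ker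

theorem add_ne_zero_of_splitting {c : ℝ} {D : L2 Mode →L[ℝ] L2 Mode} (hc : 0 < c)
    (hD : ∀ i j, freq i = freq j → |D (basisVec j) i - modePerturbation σ μ V (basisVec j) i| ≤
      c * ‖modePerturbation σ μ V‖ ^ 2)
    (hsplit : 2 * c * perturbationSize σ μ V ^ 2 <
      |2 * σ * (V (basisVec 2) 2 - V (basisVec 0) 0)|) :
    D (basisVec (.inl 0)) (.inl 0) + D (basisVec (.inl 1)) (.inl 1) ≠ 0 := by
  intro hzero
  have herror (i : Mode) : |D (basisVec i) i - modePerturbation σ μ V (basisVec i) i| ≤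
      c * perturbationSize σ μ V ^ 2 := by
    refine (hD i i rfl).trans ?_
    gcongr
    exact norm_modePerturbation_le σ μ V
  have hsum := (abs_add_le _ _).trans (add_le_add (herror (.inl 0)) (herror (.inl 1)))
  have htrace : modePerturbation σ μ V (basisVec (.inl 0)) (.inl 0) +
      modePerturbation σ μ V (basisVec (.inl 1)) (.inl 1) =
        2 * σ * (V (basisVec 2) 2 - V (basisVec 0) 0) := by
    rw [modePerturbation_basisVec_self, modePerturbation_basisVec_self]
    simp only [level, modeSign, zero_add]
    push_cast
    ring
  rw [sub_add_sub_comm, hzero, htrace, zero_sub, abs_neg] at hsum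
  linarith

theorem exists_isPosEigensystem : ∃ δ > 0, ∃ c > 0, ∀ (σ μ : ℝ) (V : Ell2 →L[ℝ] Ell2)
    (A A' : Ell2) (x : Ell2Pair), perturbationSize σ μ V < δ →
    c * perturbationSize σ μ V ^ 2 < |2 * σ * (V (basisVec 2) 2 - V (basisVec 0) 0)| →
    x ≠ 0 → HamMaps σ μ V x ((1 : ℝ) • x) → IsKernelChain σ μ V A A' →
    ∃ Ω B C, IsPosEigensystem σ μ V Ω B C ∧ IsScaledRieszBasis (completeSet B C A A') := by
  obtain ⟨δ, hδ, c, hc, hblock⟩ := exists_isBlockDiagonalisation freq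
  refine ⟨δ, hδ, 2 * c, by positivity, fun σ μ V A A' x hsize hsplit hx_ne hx hchain => ?_⟩
  obtain ⟨T, D, hTD, hD⟩ :=
    hblock (modePerturbation σ μ V) ((norm_modePerturbation_le σ μ V).trans_lt hsize)
  obtain ⟨Ω, u, hdistinct, hu⟩ :=
    exists_positive_modes hTD (x := modeEquiv x) (by simpa using hx_ne)
      (by rw [← map_smul]; exact hamMaps_iff_diagAddMaps.1 hx)
      (add_ne_zero_of_splitting hc hD hsplit)
  let B (m : ℕ) : Ell2 := (modeEquiv.symm (u m)).fst
  let C (m : ℕ) : Ell2 := (modeEquiv.symm (u m)).snd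
  have hBC (m : ℕ) : modeEquiv (pair (B m) (C m)) = u m := modeEquiv.apply_symm_apply (u m)
  have hne (m : ℕ) : pair (B m) (C m) ≠ 0 := fun hzero =>
    (hu m).1 (by rw [← hBC, hzero, map_zero])
  have hmaps (m : ℕ) : HamMaps σ μ V (pair (B m) (C m)) (Ω m • pair (B m) (C m)) := by
    rw [hamMaps_iff_diagAddMaps, map_smul, hBC]
    exact (hu m).2.1
  have hmodes := hchain.isModeSystem (fun m => (hu m).2.2) hdistinct hne hmaps
  exact ⟨Ω, B, C, ⟨hmodes.injective, hmodes.eigenvalue_pos, hne, hmaps⟩,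
    (hmodes.isScaledRieszBasis hTD).of_isometry modeEquiv⟩

end Hamiltonian

/-! ### The linear problem along a dark soliton family -/

section Conclusions

open Filter Topology

variable {σ μ ν : ℝ} {V : Ell2 →L[ℝ] Ell2} {a A A' : Ell2} {Ω : ℕ → ℝ} {B C : ℕ → Ell2}

theorem memWeighted_one {c : ℝ} {x z : Ell2}
    (h : ∀ n : ℕ, (n - μ) * x n + c * V x n = z n) : MemWeighted 1 x := by
  refine (hasSum_sq (z + (1 + μ) • x - c • V x)).summable.congr fun n => ?_
  have hweight : (z + (1 + μ) • x - c • V x : Ell2) n = (1 + n) * x n := by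
    simp only [lp.coeFn_sub, lp.coeFn_add, Pi.sub_apply, Pi.add_apply, lp.coeFn_smul,
      Pi.smul_apply, smul_eq_mul, ← h n]
    ring
  rw [hweight, sq_abs, mul_one, Real.rpow_two, mul_pow]

theorem HamMaps.memWeighted_fst {x z : Ell2Pair} (h : HamMaps σ μ V x z) :
    MemWeighted 1 x.fst :=
  memWeighted_one fun n => (h n).2

theorem HamMaps.memWeighted_snd {x z : Ell2Pair} (h : HamMaps σ μ V x z) :
    MemWeighted 1 x.snd :=
  memWeighted_one fun n => (h n).1

theorem isEigenvector_iff {B C : Ell2} :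
    IsEigenvector σ (energyIncl a) μ ν B C ↔
      pair B C ≠ 0 ∧ HamMaps σ μ (potential a a) (pair B C) (ν • pair B C) := by
  have hplus := Lplus_eq_potential (energyIncl_apply a) σ μ B
  have hminus := Lminus_eq_potential (energyIncl_apply a) σ μ C
  refine ⟨fun h => ⟨h.ne_zero, fun n => ⟨(hminus n).symm.trans (h.right_eq n),
    (hplus n).symm.trans (h.left_eq n)⟩⟩, fun ⟨hne, hmaps⟩ => ?_⟩
  exact ⟨hne, hmaps.memWeighted_fst, hmaps.memWeighted_snd,
    fun n => (hplus n).trans (hmaps n).2, fun n => (hminus n).trans (hmaps n).1⟩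

theorem IsPosEigensystem.listsPosEigenvalues (h : IsPosEigensystem σ μ (potential a a) Ω B C)
    (hchain : IsKernelChain σ μ (potential a a) A A')
    (hbasis : IsScaledRieszBasis (completeSet B C A A')) :
    ListsPosEigenvalues σ (energyIncl a) μ Ω := by
  refine ⟨h.injective, Set.Subset.antisymm ?_ ?_⟩
  · rintro _ ⟨m, rfl⟩
    exact ⟨h.pos m, B m, C m, isEigenvector_iff.2 ⟨h.ne_zero m, h.maps m⟩⟩
  · rintro ν ⟨hν, B', C', hBC⟩
    obtain ⟨hne, hmaps⟩ := isEigenvector_iff.1 hBC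
    obtain ⟨m, hm, -⟩ :=
      h.exists_eq_smul (isSelfAdjoint_potential a a) hchain hbasis hmaps hν hne
    exact ⟨m, hm.symm⟩

theorem ListsPosEigenvalues.isPosEigensystem
    (hΩ : ListsPosEigenvalues σ (energyIncl a) μ Ω)
    (h : ∀ m, IsEigenvector σ (energyIncl a) μ (Ω m) (B m) (C m)) :
    IsPosEigensystem σ μ (potential a a) Ω B C where
  injective := hΩ.1
  pos m := (hΩ.2.le ⟨m, rfl⟩).1
  ne_zero m := (h m).ne_zero
  maps m := (isEigenvector_iff.1 (h m)).2

theorem IsKernelChain.symp_eq_zero {x k : Ell2Pair} (h : IsKernelChain σ μ V A A')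
    (hV : IsSelfAdjoint V) (hx : HamMaps σ μ V x (ν • x)) (hν : ν ≠ 0)
    (hk : k ∈ ({pair 0 A, pair A' 0} : Set Ell2Pair)) : symp x k = 0 := by
  rcases hk with rfl | rfl
  · rw [symp, pair_fst, pair_snd, inner_zero_right, h.inner_fst_eq_zero hV hx hν, sub_zero]
  · rw [symp, pair_fst, pair_snd, inner_zero_right, h.inner_snd_eq_zero hV hx hν, sub_zero]

theorem IsKernelChain.Lminus_eq_zero (h : IsKernelChain σ μ (potential a a) A A') (n : ℕ) :
    Lminus σ (energyIncl a) μ A n = 0 :=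
  (Lminus_eq_potential (energyIncl_apply a) σ μ A n).trans (h.ker n).1

theorem IsKernelChain.Lplus_eq (h : IsKernelChain σ μ (potential a a) A A') (n : ℕ) :
    Lplus σ (energyIncl a) μ A' n = A n :=
  (Lplus_eq_potential (energyIncl_apply a) σ μ A' n).trans (h.gen_ker n).2

theorem IsStationary.isKernelChain (h : IsStationary σ μ a) (hne : energyIncl a ≠ 0)
    (hgen : ∀ n : ℕ, (n - μ) * A' n + 3 * σ * potential a a A' n = energyIncl a n) :
    IsKernelChain σ μ (potential a a) (energyIncl a) A' where
  ne_zero := hne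
  ker n := ⟨h.eq_zero n, by simp [pair_fst]⟩
  gen_ker n := ⟨by simp [pair_fst, pair_snd], hgen n⟩

theorem pair_derivOp_neg_positionOp_ne_zero (ha : a ≠ 0) :
    pair (derivOp a) (-positionOp a) ≠ 0 := fun hzero => by
  obtain ⟨hderiv, hposition⟩ := pair_eq_zero.1 hzero
  exact ha (eq_zero_of_positionOp_derivOp_eq_zero (neg_eq_zero.1 hposition) hderiv)

theorem IsStationary.hamMaps_dipole (h : IsStationary σ μ a) :
    HamMaps σ μ (potential a a) (pair (derivOp a) (-positionOp a))
      ((1 : ℝ) • pair (derivOp a) (-positionOp a)) := fun n => by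
  have hposition := h.linearised_positionOp n
  rw [one_smul, pair_fst, pair_snd, map_neg, lp.coeFn_neg, lp.coeFn_neg, Pi.neg_apply,
    Pi.neg_apply]
  exact ⟨by linarith, h.linearised_derivOp n⟩

theorem eventually_lt_and_mul_sq_lt {α : Type*} {l : Filter α} {r f g : α → ℝ} {L S δ c : ℝ}
    (hr : Tendsto r l (𝓝 0)) (hr_pos : ∀ᶠ x in l, 0 < r x)
    (hf : Tendsto (fun x => (r x)⁻¹ * f x) l (𝓝 L))
    (hg : Tendsto (fun x => (r x)⁻¹ * g x) l (𝓝 S)) (hS : S ≠ 0) (hδ : 0 < δ) :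
    ∀ᶠ x in l, f x < δ ∧ c * f x ^ 2 < |g x| := by
  have hf_zero : Tendsto f l (𝓝 0) := by
    rw [← zero_mul L]
    refine (hr.mul hf).congr' (hr_pos.mono fun x hx => ?_)
    rw [mul_inv_cancel_left₀ hx.ne']
  have hquadratic := (hf_zero.const_mul c).mul hf
  rw [mul_zero, zero_mul] at hquadratic
  filter_upwards [hr_pos, hf_zero.eventually_lt_const hδ,
    hquadratic.eventually_lt hg.abs (abs_pos.2 hS)] with x hx hlt hsplit
  refine ⟨hlt, ?_⟩
  rw [abs_mul, abs_inv, abs_of_pos hx, mul_left_comm, mul_assoc, ← sq] at hsplit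
  exact lt_of_mul_lt_mul_left hsplit (inv_pos.2 hx).le

end Conclusions

section Family

open Filter Topology

namespace IsWeightedFamily

variable {σ : ℝ} {A W : ℝ → Ell2} {μ : ℝ → ℝ}

theorem tendsto_perturbationSize (h : IsWeightedFamily σ A μ W) :
    Tendsto (fun ε => (ε ^ 2)⁻¹ * perturbationSize σ (μ ε) (potential (W ε) (W ε))) (𝓝[≠] 0)
      (𝓝 (3 * |σ| * ‖potential firstState firstState‖ + |σ * (3 / √(32 * Real.pi))|)) := by
  refine ((h.tendsto_potential.norm.const_mul (3 * |σ|)).add h.tendsto_frequency.abs).congr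
    fun ε => ?_
  have hinv : 0 ≤ (ε ^ 2)⁻¹ := inv_nonneg.2 (sq_nonneg ε)
  rw [perturbationSize, norm_smul, abs_mul, Real.norm_eq_abs, abs_of_nonneg hinv]
  ring

theorem tendsto_splitting (h : IsWeightedFamily σ A μ W) :
    Tendsto (fun ε => (ε ^ 2)⁻¹ * (2 * σ * (potential (W ε) (W ε) (basisVec 2) 2 -
      potential (W ε) (W ε) (basisVec 0) 0))) (𝓝[≠] 0)
      (𝓝 (2 * σ * (-(1 / 16) * (√(2 * Real.pi))⁻¹))) := by
  have hcont : Continuous fun T : Ell2 →L[ℝ] Ell2 =>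
      2 * σ * (T (basisVec 2) 2 - T (basisVec 0) 0) := by
    simp_rw [← coordCLM_apply]
    fun_prop
  rw [← K_2211_sub_K_0011, ← potential_firstState, ← potential_firstState]
  refine ((hcont.tendsto _).comp h.tendsto_potential).congr fun ε => ?_
  simp only [Function.comp_apply, smul_apply, lp.coeFn_smul, Pi.smul_apply, smul_eq_mul]
  ring

theorem eventually_inner_dMu_ne_zero (h : IsWeightedFamily σ A μ W) (hσ : σ ≠ 0) :
    ∀ᶠ ε in 𝓝[≠] 0, inner ℝ (A ε) (dMu A μ ε) ≠ 0 := by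
  filter_upwards [h.eq_energyIncl.filter_mono nhdsWithin_le_nhds,
    h.eventually_dMu_eq.filter_mono nhdsWithin_le_nhds, h.eventually_deriv_ne_zero hσ,
    h.eventually_inner_deriv_ne_zero] with ε hA hdMu hderiv hinner
  rw [hdMu.2, hA, inner_smul_right]
  exact mul_ne_zero (inv_ne_zero hderiv) hinner

theorem eventually_isKernelChain (h : IsWeightedFamily σ A μ W) (hσ : σ ≠ 0) :
    ∀ᶠ ε in 𝓝[≠] 0,
      IsKernelChain σ (μ ε) (potential (W ε) (W ε)) (A ε) (dMu A μ ε) := by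
  filter_upwards [h.eq_energyIncl.filter_mono nhdsWithin_le_nhds,
    h.eventually_dMu_eq.filter_mono nhdsWithin_le_nhds, h.eventually_deriv_ne_zero hσ,
    h.eventually_inner_dMu_ne_zero hσ, h.isStationary.filter_mono nhdsWithin_le_nhds,
    h.eventually_linearised.filter_mono nhdsWithin_le_nhds]
    with ε hA hdMu hderiv hinner hstationary hlinearised
  have hne : A ε ≠ 0 := fun hzero => hinner (by rw [hzero, inner_zero_left])
  rw [hA] at hne ⊢
  refine hstationary.isKernelChain hne fun n => ?_
  rw [hdMu.2, map_smul]
  simp only [lp.coeFn_smul, Pi.smul_apply, smul_eq_mul]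
  linear_combination (deriv μ ε)⁻¹ * hlinearised n +
    energyIncl (W ε) n * inv_mul_cancel₀ hderiv

theorem eventually_exists_isPosEigensystem (h : IsWeightedFamily σ A μ W) (hσ : σ ≠ 0) :
    ∀ᶠ ε in 𝓝[≠] 0, ∃ Ω B C, IsPosEigensystem σ (μ ε) (potential (W ε) (W ε)) Ω B C ∧
      IsScaledRieszBasis (completeSet B C (A ε) (dMu A μ ε)) := by
  obtain ⟨δ, hδ, c, -, hexists⟩ := exists_isPosEigensystem
  have hsplitting_ne : 2 * σ * (-(1 / 16) * (√(2 * Real.pi))⁻¹) ≠ 0 := by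
    refine mul_ne_zero (mul_ne_zero two_ne_zero hσ) (mul_ne_zero (by norm_num) ?_)
    positivity
  have hsmall := eventually_lt_and_mul_sq_lt (c := c) tendsto_sq_nhdsNE_zero
    (eventually_mem_nhdsWithin.mono fun ε hε => sq_pos_of_ne_zero hε)
    h.tendsto_perturbationSize h.tendsto_splitting hsplitting_ne hδ
  filter_upwards [hsmall, h.eventually_isKernelChain hσ,
    h.eq_energyIncl.filter_mono nhdsWithin_le_nhds,
    h.isStationary.filter_mono nhdsWithin_le_nhds] with ε hsize hchain hA hstationary
  have hW : W ε ≠ 0 := fun hzero => hchain.ne_zero (by rw [hA, hzero, map_zero])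
  exact hexists σ (μ ε) _ _ _ _ hsize.1 hsize.2 (pair_derivOp_neg_positionOp_ne_zero hW)
    hstationary.hamMaps_dipole hchain

end IsWeightedFamily

end Family

end DarkSoliton

theorem mainTheorem6 (σ : ℝ) (hσ : σ ≠ 0) :
    (∃ (A : ℝ → DarkSoliton.Ell2) (μ : ℝ → ℝ), DarkSoliton.IsDarkSolitonFamily σ A μ) ∧
    ∀ (A : ℝ → DarkSoliton.Ell2) (μ : ℝ → ℝ), DarkSoliton.IsDarkSolitonFamily σ A μ →
      ∃ ε₀ > 0, ∀ ε : ℝ, 0 < |ε| → |ε| < ε₀ →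
        -- `L₋ A = 0` and `L₊ ∂_μ A = A`, with `∂_μ A` well defined
        (DarkSoliton.MemWeighted 1 (A ε) ∧
          (∀ n, DarkSoliton.Lminus σ (A ε) (μ ε) (A ε) n = 0) ∧
          DifferentiableAt ℝ A ε ∧ DifferentiableAt ℝ μ ε ∧ deriv μ ε ≠ 0 ∧
          DarkSoliton.MemWeighted 1 (DarkSoliton.dMu A μ ε) ∧
          (∀ n, DarkSoliton.Lplus σ (A ε) (μ ε) (DarkSoliton.dMu A μ ε) n = A ε n)) ∧
        inner ℝ (A ε) (DarkSoliton.dMu A μ ε) ≠ 0 ∧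
        (∃ Ω : ℕ → ℝ, DarkSoliton.ListsPosEigenvalues σ (A ε) (μ ε) Ω) ∧
        ∀ (Ω : ℕ → ℝ) (B C : ℕ → DarkSoliton.Ell2),
          DarkSoliton.ListsPosEigenvalues σ (A ε) (μ ε) Ω →
          (∀ m, DarkSoliton.IsEigenvector σ (A ε) (μ ε) (Ω m) (B m) (C m)) →
            (∀ m m', m' ≠ m → inner ℝ (B m') (C m) = 0) ∧
            (∀ m, inner ℝ (B m) (C m) ≠ 0) ∧
            (∀ m, ∀ k ∈ ({DarkSoliton.pair 0 (A ε),
                DarkSoliton.pair (DarkSoliton.dMu A μ ε) 0} : Set DarkSoliton.Ell2Pair),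
              DarkSoliton.symp (DarkSoliton.pair (B m) (C m)) k = 0 ∧
              DarkSoliton.symp (DarkSoliton.pair (B m) (-C m)) k = 0) ∧
            DarkSoliton.IsUnconditionalBasis
              (DarkSoliton.completeSet B C (A ε) (DarkSoliton.dMu A μ ε)) ∧
            DarkSoliton.IsRieszBasis (fun i =>
              ‖DarkSoliton.completeSet B C (A ε) (DarkSoliton.dMu A μ ε) i‖⁻¹ •
                DarkSoliton.completeSet B C (A ε) (DarkSoliton.dMu A μ ε) i) := by
  refine ⟨DarkSoliton.exists_darkSolitonFamily σ, fun A μ hfamily => ?_⟩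
  obtain ⟨W, hW⟩ := hfamily.exists_isWeightedFamily
  have hevent := ((hW.eq_energyIncl.and (hW.differentiableAt.and hW.eventually_dMu_eq)).filter_mono
    nhdsWithin_le_nhds).and ((hW.eventually_deriv_ne_zero hσ).and
      ((hW.eventually_inner_dMu_ne_zero hσ).and ((hW.eventually_isKernelChain hσ).and
        (hW.eventually_exists_isPosEigensystem hσ))))
  obtain ⟨ε₀, hε₀, hball⟩ := Metric.eventually_nhds_iff.1 (eventually_nhdsWithin_iff.1 hevent)
  refine ⟨ε₀, hε₀, fun ε hpos hlt => ?_⟩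
  obtain ⟨⟨hA, ⟨-, hdiff_μ⟩, hdiff_A, -⟩, hderiv, hinner, hchain, Ω₀, B₀, C₀, h₀, hbasis₀⟩ :=
    hball (by simpa using hlt) (abs_pos.1 hpos)
  rw [hA] at hinner hchain hbasis₀ ⊢
  have hV := DarkSoliton.isSelfAdjoint_potential (W ε) (W ε)
  have hΩ₀ := h₀.listsPosEigenvalues hchain hbasis₀
  refine ⟨⟨hchain.ker.memWeighted_snd, hchain.Lminus_eq_zero, hdiff_A, hdiff_μ, hderiv,
    hchain.gen_ker.memWeighted_fst, hchain.Lplus_eq⟩, hinner, ⟨Ω₀, hΩ₀⟩, fun Ω B C hΩ hBC => ?_⟩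
  have h := hΩ.isPosEigensystem hBC
  have hbasis := h.isScaledRieszBasis_of_range_subset h₀ hV hchain hbasis₀
    (hΩ₀.2.trans hΩ.2.symm).le
  exact ⟨fun _ _ hne => h.inner_eq_zero_of_ne hV hne, h.inner_ne_zero hV hchain hbasis,
    fun m _ hk => ⟨hchain.symp_eq_zero hV (h.maps m) (h.pos m).ne' hk,
      hchain.symp_eq_zero hV (h.maps m).reflect (neg_ne_zero.2 (h.pos m).ne') hk⟩,
    hbasis.isUnconditionalBasis, hbasis.isRieszBasis⟩
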